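/- **Setting.** Let $\tau:E\to M$ be a smooth real vector bundle of finite rank over a smooth finite-dimensional manifold without boundary, $\pi:E^*\to M$ its dual, $\mathrm{Sec}(\tau)$ its smooth sections. A skew-symmetric algebroid structure on $E$ is a skew-symmetric $\mathbb R$-bilinear bracket $[\cdot,\cdot]$ on $\mathrm{Sec}(\tau)$ together with a vector bundle morphism $\rho:E\to TM$ over $\mathrm{id}_M$ with $[X,fY]=f[X,Y]+\rho(X)(f)Y$; it is almost-Lie (AL) if moreover $\rho([X,Y])=[\rho(X),\rho(Y)]_{TM}$. It induces the morphism $\varepsilon:T^*E\to TE^*$ over $\mathrm{id}_{E^*}$ given, for $A\in T^*_eE$, $e\in E_x$, with restriction $z\in E^*_x$ to vertical vectors, by the unique vector $\varepsilon(A)\in T_zE^*$ such that $T\pi(\varepsilon(A))=\rho(e)$ and $d\iota_Y(\varepsilon(A))=\langle z,[X,Y](x)\rangle+\langle A,TX(\rho(Y(x)))\rangle$ for all $X,Y\in\mathrm{Sec}(\tau)$ with $X(x)=e$, where $\iota_Y$ is the linear function on $E^*$ defined by $Y$ (in coordinates $\varepsilon(x^a,y^i,p_b,z_j)=(x^a,z_i,\rho^b_ky^k,c^k_{ij}y^iz_k+\rho^a_jp_a)$).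 The dual relation $\kappa\subset TE\times TE$ consists of the pairs $(X,Y)$, $Y\in T_eE$, with $\rho(e)=T\tau(X)$ and $\langle X,\varepsilon(A)\rangle_{T\tau}=\langle Y,A\rangle$ for all $A\in T^*_eE$; here $\langle\cdot,\cdot\rangle_{T\tau}$ is the pairing of $TE\to TM$ with $TE^*\to TM$ obtained by differentiating the pairing of $E$ with $E^*$. For a manifold $Q$ let $\kappa_Q:TTQ\to TTQ$ be the canonical flip, and for $f:Q\to\mathbb R$ let $d_Tf:TQ\to\mathbb R$, $d_Tf(X)=\langle df,X\rangle$. Let $d_T\kappa=\kappa_E\circ T\kappa\circ\kappa_E$ be the relation of the tangent lift algebroid on $T\tau:TE\to TM$, where $T\kappa\subset TTE\times TTE$ consists of the velocities of curves in $\kappa$. Let $L:E\to\mathbb R$ be smooth, $\Lambda_L=\varepsilon\circ dL:E\to TE^*$, and let $\lambda_L:E\to E^*$ be its Legendre map (the fibre derivative of $L$). A curve $\gamma:[t_0,t_1]\to E$ is a solution of the Euler–Lagrange (EL) equation if $\frac{d}{dt}\lambda_L(\gamma(t))=\Lambda_L(\gamma(t))$ on $[t_0,t_1]$. Fix $t_0<t_1$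 and $k\in\{2,3,\dots,\infty\}$; curves are of class $C^k$. Let $E_{\tau\circ\gamma}$ be the space of sections of $E$ of class $C^k$ along $\tau\circ\gamma$ and $E^0_{\tau\circ\gamma}$ its subspace of sections vanishing at $t_0$ and $t_1$. For an EL solution $\gamma$ and $\xi\in E_{\tau\circ\gamma}$ let $\delta_\xi\gamma(t)$ be the vector of $T_{\gamma(t)}E$ that is $\kappa$-related to $\dot\xi(t)$. **Lemma.** Let $E$ be an AL algebroid and let $\gamma:[t_0,t_1]\to E$ be a $C^k$ solution of the EL equation for $L$. The morphism $\varepsilon$ and the curves $\delta_\xi\gamma$, $\xi\in E_{\tau\circ\gamma}$, are well defined (the vectors describing them exist and are unique). For $\eta\in E_{\tau\circ\gamma}$ and $\xi\in E^0_{\tau\circ\gamma}$ consider the $C^k$ curves $\Delta\xi(t)\in T_{\xi(t)}E$ such that $T\tau\circ\Delta\xi=\rho(\eta)$ and $\Delta\xi(t_0),\Delta\xi(t_1)$ are null vectors of the vector bundle $T\tau:TE\to TM$. Such curves exist. For each of them there is, for every $t$, exactly one vector $\delta_{\Delta\xi}(\delta_\eta\gamma)(t)\in T_{\delta_\eta\gamma(t)}TE$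 that is $d_T\kappa$-related to the velocity of $\Delta\xi$ at $t$; the curve $\delta_{(\Delta\xi,\eta)}\gamma:=\kappa_E\circ\delta_{\Delta\xi}(\delta_\eta\gamma)$ in $TTE$ projects to $\delta_\xi\gamma$ under $\tau_{TE}$ and to $\delta_\eta\gamma$ under $T\tau_E$; and the number $$\delta^2S_L(\gamma)(\eta,\xi):=\int_{t_0}^{t_1}\langle d\,d_TL(\delta_\xi\gamma(t)),\delta_{(\Delta\xi,\eta)}\gamma(t)\rangle\,dt$$ (the integrand is integrable) does not depend on the choice of $\Delta\xi$. It defines a bilinear form $\delta^2S_L(\gamma):E_{\tau\circ\gamma}\times E^0_{\tau\circ\gamma}\to\mathbb R$. Moreover the vectors $\kappa_{E^*}\circ T\Lambda_L(\delta_\eta\gamma(t))$ and $\frac{d}{dt}T\lambda_L(\delta_\eta\gamma(t))$ are attached at the same point of $TE^*$, their difference is vertical with respect to $T\pi:TE^*\to TM$, and, writing $\mathcal V_W\in TE^*$ for the vertical part of a vertical vector $W\in TTE^*$ (its image under the identification of vertical vectors with elements of the fibres of $T\pi$; here this fibre is the one over $T\tau(\Delta\xi(t))$), for every $\Delta\xi$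 as above $$\delta^2S_L(\gamma)(\eta,\xi)=\int_{t_0}^{t_1}\Big\langle\Delta\xi(t),\mathcal V_{\kappa_{E^*}\circ T\Lambda_L(\delta_\eta\gamma(t))-\frac{d}{dt}T\lambda_L(\delta_\eta\gamma(t))}\Big\rangle_{T\tau}\,dt,$$ the integrand being integrable. -/

import Mathlib

open Set Bundle
open scoped Manifold ContDiff Topology

noncomputable section

namespace Algebroid

/-! ### Tangent bundles, curves, canonical flip -/

section General

variable {V : Type*} [NormedAddCommGroup V] [NormedSpace ℝ V]
  {H : Type*} [TopologicalSpace H] (I : ModelWithCorners ℝ V H)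
  {Q : Type*} [TopologicalSpace Q] [ChartedSpace H Q]

/-- The tangent prolongation `ċ(t) ∈ T Q` of a curve `c` defined on `[t₀, t₁]`. Curves on the
interval are maps on `ℝ` of which only the restriction to `[t₀, t₁]` is ever used. -/
def prolong (t₀ t₁ : ℝ) (c : ℝ → Q) (t : ℝ) : TangentBundle I Q :=
  ⟨c t, mfderivWithin 𝓘(ℝ, ℝ) I c (Icc t₀ t₁) t (1 : ℝ)⟩

/-- The tangent lift `d_T f : T Q → ℝ`, `d_T f (X) = ⟨df, X⟩`, of a function. -/
def dT (f : Q → ℝ) (X : TangentBundle I Q) : ℝ :=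
  mfderiv I 𝓘(ℝ, ℝ) f X.1 X.2

/-- Difference of two vectors of `T Q` attached at the same point (it is attached at the base
point of the first one). -/
def fibSub (X Y : TangentBundle I Q) : TangentBundle I Q :=
  ⟨X.1, (show V from X.2) - (show V from Y.2)⟩

variable [IsManifold I 1 Q]

/-- The canonical flip `κ_Q : T T Q → T T Q`. In the coordinates `(q, q̇, δq, δq̇)` of `T T Q` it is
`(q, q̇, δq, δq̇) ↦ (q, δq, q̇, δq̇)`. Mathlib writes a tangent vector to a manifold in the preferred
chart at its base point, and the preferred chart of `T Q` at `(q, q̇)` is the one induced by the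
preferred chart of `Q` at `q`; hence the four entries below are these coordinates. -/
def tflip (A : TangentBundle I.tangent (TangentBundle I Q)) :
    TangentBundle I.tangent (TangentBundle I Q) :=
  ⟨⟨A.1.1, (show V × V from A.2).1⟩, ((show V from A.1.2), (show V × V from A.2).2)⟩

end General

/-! ### The vector bundle `τ : E → M` and its dual `π : E* → M` -/

section Bundles

variable {B : Type*} [NormedAddCommGroup B] [NormedSpace ℝ B]
  {F : Type*} [NormedAddCommGroup F] [NormedSpace ℝ F]
  {M : Type*} [TopologicalSpace M] [ChartedSpace B M]
  {E : M → Type*} [TopologicalSpace (TotalSpace F E)]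
  [∀ x, AddCommGroup (E x)] [∀ x, Module ℝ (E x)] [∀ x, TopologicalSpace (E x)]
  [FiberBundle F E] [VectorBundle ℝ F E]

variable (B F E) in
/-- The manifold `T E`. -/
abbrev TE : Type _ := TangentBundle (𝓘(ℝ, B).prod 𝓘(ℝ, F)) (TotalSpace F E)

variable (B F E) in
/-- The manifold `T T E`. -/
abbrev TTE [IsManifold 𝓘(ℝ, B) ∞ M] [ContMDiffVectorBundle ∞ F E 𝓘(ℝ, B)] : Type _ :=
  TangentBundle (𝓘(ℝ, B).prod 𝓘(ℝ, F)).tangent (TE B F E)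

variable (E) in
/-- The fibre of the dual bundle `E*`. -/
abbrev DualFib (x : M) : Type _ := E x →L[ℝ] Bundle.Trivial M ℝ x

variable (F E) in
/-- The total space of the dual bundle `E*`. -/
abbrev DualTot : Type _ := TotalSpace (F →L[ℝ] ℝ) (DualFib E)

variable [∀ x, IsTopologicalAddGroup (E x)] [∀ x, ContinuousSMul ℝ (E x)]

variable (B F E) in
/-- The manifold `T E*`. -/
abbrev TDual : Type _ := TangentBundle (𝓘(ℝ, B).prod 𝓘(ℝ, F →L[ℝ] ℝ)) (DualTot F E)

variable (B F E) in
/-- The manifold `T T E*`. -/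
abbrev TTDual [IsManifold 𝓘(ℝ, B) ∞ M] [ContMDiffVectorBundle ∞ F E 𝓘(ℝ, B)] : Type _ :=
  TangentBundle (𝓘(ℝ, B).prod 𝓘(ℝ, F →L[ℝ] ℝ)).tangent (TDual B F E)

/-- `T τ : T E → T M`. -/
def Tτ (X : TE B F E) : TangentBundle 𝓘(ℝ, B) M :=
  tangentMap (𝓘(ℝ, B).prod 𝓘(ℝ, F)) 𝓘(ℝ, B) (π F E) X

/-- `T π : T E* → T M`. -/
def Tπ (Φ : TDual B F E) : TangentBundle 𝓘(ℝ, B) M :=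
  tangentMap (𝓘(ℝ, B).prod 𝓘(ℝ, F →L[ℝ] ℝ)) 𝓘(ℝ, B) (π (F →L[ℝ] ℝ) (DualFib E)) Φ

/-- The null vector, with respect to the vector bundle structure `T τ : T E → T M`, over `v ∈ T M`:
the image of `v` under the tangent map of the zero section of `τ`. -/
def nullVec (v : TangentBundle 𝓘(ℝ, B) M) : TE B F E :=
  tangentMap 𝓘(ℝ, B) (𝓘(ℝ, B).prod 𝓘(ℝ, F)) (zeroSection F E) v

variable (B) in
/-- The vertical lift `E_x → T_e E`, for `e ∈ E_x`; in coordinates `v ↦ (0, v)`. -/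
def vertLift (e : TotalSpace F E) :
    E e.1 →L[ℝ] TangentSpace (𝓘(ℝ, B).prod 𝓘(ℝ, F)) e :=
  (ContinuousLinearMap.inr ℝ B F).comp
    ((trivializationAt F E e.1).continuousLinearMapAt ℝ e.1)

/-- `T*τ : T*E → E*`, the restriction of a covector `A ∈ T*_e E` to vertical vectors. -/
def covProj (e : TotalSpace F E)
    (A : TangentSpace (𝓘(ℝ, B).prod 𝓘(ℝ, F)) e →L[ℝ] ℝ) : DualFib E e.1 :=
  A.comp (vertLift B e)

/-- The pairing `⟨X, Φ⟩_{Tτ}` of `X ∈ T E` and `Φ ∈ T E*` over the same vector of `T M`, i.e. the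
derivative of the pairing of `E` with `E*`. In the coordinates `X = (x, y, ẋ, ẏ)`,
`Φ = (x, z, ẋ, ż)` it is `⟨y, ż⟩ + ⟨ẏ, z⟩`. -/
def pairT (X : TE B F E) (Φ : TDual B F E) : ℝ :=
  (show B × (F →L[ℝ] ℝ) from Φ.2).2 (trivializationAt F E X.1.1 X.1).2 +
    (trivializationAt (F →L[ℝ] ℝ) (DualFib E) Φ.1.1 Φ.1).2 (show B × F from X.2).2

/-- The linear function `ι_Y : E* → ℝ`, `ι_Y(z) = ⟨z, Y⟩`, of a section `Y` of `E`. -/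
def ι (Y : ∀ x, E x) (z : DualTot F E) : ℝ := z.2 (Y z.1)

section Vertical

variable [IsManifold 𝓘(ℝ, B) ∞ M] [ContMDiffVectorBundle ∞ F E 𝓘(ℝ, B)]

/-- `W ∈ T T E*` is vertical with respect to the vector bundle `T π : T E* → T M`. -/
def IsVert (W : TTDual B F E) : Prop :=
  mfderiv (𝓘(ℝ, B).prod 𝓘(ℝ, F →L[ℝ] ℝ)).tangent 𝓘(ℝ, B).tangent
    (Tπ : TDual B F E → TangentBundle 𝓘(ℝ, B) M) W.1 W.2 = 0

/-- The vertical part `𝒱_W ∈ T E*` of a vector `W ∈ T T E*` vertical with respect to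
`T π : T E* → T M`: its image under the identification of the vertical space at `P ∈ T E*` with the
fibre of `T π` through `P`. In coordinates `P = (x, z, ẋ, ż)`, `W = (P, 0, δz, 0, δż)`, and
`𝒱_W = (x, δz, ẋ, δż)`. -/
def vertPart (W : TTDual B F E) : TDual B F E :=
  ⟨⟨W.1.1.1, (show (B × (F →L[ℝ] ℝ)) × (B × (F →L[ℝ] ℝ)) from W.2).1.2.comp
      ((trivializationAt F E W.1.1.1).continuousLinearMapAt ℝ W.1.1.1)⟩,
    ((show B × (F →L[ℝ] ℝ) from W.1.2).1,
      (show (B × (F →L[ℝ] ℝ)) × (B × (F →L[ℝ] ℝ)) from W.2).2.2)⟩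

end Vertical

end Bundles

/-! ### Algebroids -/

section Algebroids

variable (B : Type*) [NormedAddCommGroup B] [NormedSpace ℝ B]
  (F : Type*) [NormedAddCommGroup F] [NormedSpace ℝ F]
  {M : Type*} [TopologicalSpace M] [ChartedSpace B M]
  (E : M → Type*) [TopologicalSpace (TotalSpace F E)]
  [∀ x, AddCommGroup (E x)] [∀ x, Module ℝ (E x)] [∀ x, TopologicalSpace (E x)]
  [FiberBundle F E] [VectorBundle ℝ F E] [IsManifold 𝓘(ℝ, B) ∞ M]

/-- A skew-symmetric algebroid structure on the vector bundle `τ : E → M`. -/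
structure SkewAlgebroid where
  /-- the bracket on smooth sections -/
  bracket : Cₛ^∞⟮𝓘(ℝ, B); F, E⟯ →ₗ[ℝ] Cₛ^∞⟮𝓘(ℝ, B); F, E⟯ →ₗ[ℝ] Cₛ^∞⟮𝓘(ℝ, B); F, E⟯
  /-- the anchor -/
  anchor : ∀ x, E x →L[ℝ] TangentSpace 𝓘(ℝ, B) x
  smooth_anchor : ContMDiff (𝓘(ℝ, B).prod 𝓘(ℝ, F)) 𝓘(ℝ, B).tangent ∞
    (fun e : TotalSpace F E => (⟨e.1, anchor e.1 e.2⟩ : TangentBundle 𝓘(ℝ, B) M))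
  skew : ∀ X Y, bracket X Y = -bracket Y X
  leibniz : ∀ (X Y Z : Cₛ^∞⟮𝓘(ℝ, B); F, E⟯) (f : M → ℝ), ContMDiff 𝓘(ℝ, B) 𝓘(ℝ, ℝ) ∞ f →
    (∀ x, Z x = f x • Y x) → ∀ x, bracket X Z x =
      f x • bracket X Y x + dT 𝓘(ℝ, B) f ⟨x, anchor x (X x)⟩ • Y x

variable {B F E}

namespace SkewAlgebroid

variable (𝔞 : SkewAlgebroid B F E)

/-- `𝔞` is almost-Lie: the anchor maps the bracket to the Lie bracket of vector fields. -/
def IsAlmostLie : Prop :=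
  ∀ (X Y : Cₛ^∞⟮𝓘(ℝ, B); F, E⟯) (x : M), 𝔞.anchor x (𝔞.bracket X Y x) =
    VectorField.mlieBracket 𝓘(ℝ, B) (fun y => 𝔞.anchor y (X y)) (fun y => 𝔞.anchor y (Y y)) x

/-- The anchor as a map `ρ : E → T M`. -/
def ρ (e : TotalSpace F E) : TangentBundle 𝓘(ℝ, B) M := ⟨e.1, 𝔞.anchor e.1 e.2⟩

variable [∀ x, IsTopologicalAddGroup (E x)] [∀ x, ContinuousSMul ℝ (E x)]

/-- `V` is the value at `A ∈ T*_e E` of the morphism `ε : T*E → T E*` of the algebroid.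
Let `Π` be the linear bivector field on `E*` determined by `{ι_X, ι_Y} = ι_[X,Y]` and
`{ι_X, f ∘ π} = ρ(X)(f) ∘ π`. With `z = T*τ(A)`, the covector `R_E(A) ∈ T*_z E*` is
`dι_X - π^*(X^*A)` for any section `X` with `X(x) = e`; contracting it with `Π` gives the vector
`V ∈ T_z E*` with `Tπ(V) = ρ(e)` and
`dι_Y(V) = ⟨z, [X,Y]⟩ + ⟨A, TX(ρ(Y))⟩` for all such `X` and all sections `Y`. -/
def IsEps (e : TotalSpace F E) (A : TangentSpace (𝓘(ℝ, B).prod 𝓘(ℝ, F)) e →L[ℝ] ℝ)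
    (V : TangentSpace (𝓘(ℝ, B).prod 𝓘(ℝ, F →L[ℝ] ℝ))
      (⟨e.1, covProj e A⟩ : DualTot F E)) : Prop :=
  Tπ (⟨⟨e.1, covProj e A⟩, V⟩ : TDual B F E) = 𝔞.ρ e ∧
  ∀ X Y : Cₛ^∞⟮𝓘(ℝ, B); F, E⟯, X e.1 = e.2 →
    (mfderiv (𝓘(ℝ, B).prod 𝓘(ℝ, F →L[ℝ] ℝ)) 𝓘(ℝ, ℝ) (ι (Y : ∀ x, E x))
        (⟨e.1, covProj e A⟩ : DualTot F E) V : ℝ) =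
      (covProj e A (𝔞.bracket X Y e.1) : ℝ) +
        A (mfderiv 𝓘(ℝ, B) (𝓘(ℝ, B).prod 𝓘(ℝ, F)) (fun y => TotalSpace.mk' F y (X y)) e.1
          (𝔞.anchor e.1 (Y e.1)))

/-- The morphism `ε : T*E → T E*` over the identity of `E*`. -/
def ε (e : TotalSpace F E) (A : TangentSpace (𝓘(ℝ, B).prod 𝓘(ℝ, F)) e →L[ℝ] ℝ) : TDual B F E :=
  ⟨⟨e.1, covProj e A⟩, Classical.epsilon (𝔞.IsEps e A)⟩

/-- The relation `κ ⊂ T E × T E` dual to `ε`. -/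
def Kappa (X Y : TE B F E) : Prop :=
  𝔞.ρ Y.1 = Tτ X ∧
    ∀ A : TangentSpace (𝓘(ℝ, B).prod 𝓘(ℝ, F)) Y.1 →L[ℝ] ℝ, pairT X (𝔞.ε Y.1 A) = A Y.2

/-- The infinitesimal admissible variation `δ_ξ γ = κ_γ(ξ̇)` of `γ` generated by `ξ`: the vector of
`T_γ E` which is `κ`-related to `ξ̇`. -/
def var (t₀ t₁ : ℝ) (γ : ℝ → TotalSpace F E) (ξ : ∀ t, E (γ t).1) (t : ℝ) : TE B F E :=
  ⟨γ t, Classical.epsilon fun V : TangentSpace (𝓘(ℝ, B).prod 𝓘(ℝ, F)) (γ t) =>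
    𝔞.Kappa (prolong (𝓘(ℝ, B).prod 𝓘(ℝ, F)) t₀ t₁
      (fun s => (⟨(γ s).1, ξ s⟩ : TotalSpace F E)) t) ⟨γ t, V⟩⟩

/-- The Legendre map `λ_L = T*τ ∘ dL : E → E*`. -/
def legendre (_𝔞 : SkewAlgebroid B F E) (L : TotalSpace F E → ℝ) (e : TotalSpace F E) :
    DualTot F E :=
  ⟨e.1, covProj e (mfderiv (𝓘(ℝ, B).prod 𝓘(ℝ, F)) 𝓘(ℝ, ℝ) L e)⟩

/-- The Tulczyjew differential `Λ_L = ε ∘ dL : E → T E*`. -/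
def tulczyjew (L : TotalSpace F E → ℝ) (e : TotalSpace F E) : TDual B F E :=
  𝔞.ε e (mfderiv (𝓘(ℝ, B).prod 𝓘(ℝ, F)) 𝓘(ℝ, ℝ) L e)

/-- `γ : [t₀, t₁] → E` solves the Euler-Lagrange equation `d/dt λ_L(γ) = Λ_L(γ)`. -/
def IsELSolution (L : TotalSpace F E → ℝ) (t₀ t₁ : ℝ) (γ : ℝ → TotalSpace F E) : Prop :=
  ∀ t ∈ Icc t₀ t₁, prolong (𝓘(ℝ, B).prod 𝓘(ℝ, F →L[ℝ] ℝ)) t₀ t₁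
    (fun s => 𝔞.legendre L (γ s)) t = 𝔞.tulczyjew L (γ t)

variable [ContMDiffVectorBundle ∞ F E 𝓘(ℝ, B)]

/-- The tangent relation `T κ ⊂ T T E × T T E`, made of the velocities of smooth curves in `κ`. -/
def TKappa (U W : TTE B F E) : Prop :=
  ∃ X Y : ℝ → TE B F E,
    ContMDiffAt 𝓘(ℝ, ℝ) (𝓘(ℝ, B).prod 𝓘(ℝ, F)).tangent ∞ X 0 ∧
    ContMDiffAt 𝓘(ℝ, ℝ) (𝓘(ℝ, B).prod 𝓘(ℝ, F)).tangent ∞ Y 0 ∧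
    (∀ᶠ s in 𝓝 (0 : ℝ), 𝔞.Kappa (X s) (Y s)) ∧
    U = ⟨X 0, mfderiv 𝓘(ℝ, ℝ) (𝓘(ℝ, B).prod 𝓘(ℝ, F)).tangent X 0 (1 : ℝ)⟩ ∧
    W = ⟨Y 0, mfderiv 𝓘(ℝ, ℝ) (𝓘(ℝ, B).prod 𝓘(ℝ, F)).tangent Y 0 (1 : ℝ)⟩

/-- The relation `d_T κ = κ_E ∘ T κ ∘ κ_E` of the tangent lift algebroid `T τ : T E → T M`. -/
def dTKappa (U W : TTE B F E) : Prop :=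
  𝔞.TKappa (tflip (𝓘(ℝ, B).prod 𝓘(ℝ, F)) U) (tflip (𝓘(ℝ, B).prod 𝓘(ℝ, F)) W)

/-- For a curve `Γ` in `T E` and a curve `Δξ` in `T E` over the same curve in `T M`, the variation
`δ_{Δξ} Γ = d_Tκ_Γ((Δξ)˙)` with respect to the tangent lift algebroid. -/
def liftVar (t₀ t₁ : ℝ) (Γ Δξ : ℝ → TE B F E) (t : ℝ) : TTE B F E :=
  ⟨Γ t, Classical.epsilon fun W : TangentSpace (𝓘(ℝ, B).prod 𝓘(ℝ, F)).tangent (Γ t) =>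
    𝔞.dTKappa (prolong (𝓘(ℝ, B).prod 𝓘(ℝ, F)).tangent t₀ t₁ Δξ t) ⟨Γ t, W⟩⟩

/-- The curve `δ_{(Δξ, η)} γ = κ_E ∘ δ_{Δξ}(δ_η γ)` in `T T E`. -/
def var₂ (t₀ t₁ : ℝ) (γ : ℝ → TotalSpace F E) (η : ∀ t, E (γ t).1) (Δξ : ℝ → TE B F E)
    (t : ℝ) : TTE B F E :=
  tflip (𝓘(ℝ, B).prod 𝓘(ℝ, F)) (𝔞.liftVar t₀ t₁ (𝔞.var t₀ t₁ γ η) Δξ t)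

/-- `Δξ` is a curve in `T_ξ E` of class `C^k` with `T τ ∘ Δξ = ρ(η)` whose values at the end-points
are null vectors with respect to `T τ`. -/
structure IsLiftedGenerator (k : ℕ∞) (t₀ t₁ : ℝ) (γ : ℝ → TotalSpace F E)
    (η ξ : ∀ t, E (γ t).1) (Δξ : ℝ → TE B F E) : Prop where
  smooth : ContMDiffOn 𝓘(ℝ, ℝ) (𝓘(ℝ, B).prod 𝓘(ℝ, F)).tangent k Δξ (Icc t₀ t₁)
  base : ∀ t ∈ Icc t₀ t₁, (Δξ t).1 = ⟨(γ t).1, ξ t⟩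
  anchored : ∀ t ∈ Icc t₀ t₁, Tτ (Δξ t) = 𝔞.ρ ⟨(γ t).1, η t⟩
  null_left : Δξ t₀ = nullVec (Tτ (Δξ t₀))
  null_right : Δξ t₁ = nullVec (Tτ (Δξ t₁))

/-- `κ_{E*} ∘ T Λ_L(δ_η γ(t)) ∈ T T E*`. -/
def jacobiForce (L : TotalSpace F E → ℝ) (t₀ t₁ : ℝ) (γ : ℝ → TotalSpace F E)
    (η : ∀ t, E (γ t).1) (t : ℝ) : TTDual B F E :=
  tflip (𝓘(ℝ, B).prod 𝓘(ℝ, F →L[ℝ] ℝ))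
    (tangentMap (𝓘(ℝ, B).prod 𝓘(ℝ, F)) (𝓘(ℝ, B).prod 𝓘(ℝ, F →L[ℝ] ℝ)).tangent
      (𝔞.tulczyjew L) (𝔞.var t₀ t₁ γ η t))

/-- `d/dt T λ_L(δ_η γ(t)) ∈ T T E*`. -/
def jacobiMomentum (L : TotalSpace F E → ℝ) (t₀ t₁ : ℝ) (γ : ℝ → TotalSpace F E)
    (η : ∀ t, E (γ t).1) (t : ℝ) : TTDual B F E :=
  prolong (𝓘(ℝ, B).prod 𝓘(ℝ, F →L[ℝ] ℝ)).tangent t₀ t₁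
    (fun s => tangentMap (𝓘(ℝ, B).prod 𝓘(ℝ, F)) (𝓘(ℝ, B).prod 𝓘(ℝ, F →L[ℝ] ℝ))
      (𝔞.legendre L) (𝔞.var t₀ t₁ γ η s)) t

/-- The difference `κ_{E*} ∘ T Λ_L(δ_η γ) - d/dt T λ_L(δ_η γ)`, taken in `T (T E*)`. -/
def jacobiDefect (L : TotalSpace F E → ℝ) (t₀ t₁ : ℝ) (γ : ℝ → TotalSpace F E)
    (η : ∀ t, E (γ t).1) (t : ℝ) : TTDual B F E :=
  fibSub (𝓘(ℝ, B).prod 𝓘(ℝ, F →L[ℝ] ℝ)).tangent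
    (𝔞.jacobiForce L t₀ t₁ γ η t) (𝔞.jacobiMomentum L t₀ t₁ γ η t)

end SkewAlgebroid

end Algebroids

/-! ### Sections along a curve -/

section Along

variable {B : Type*} [NormedAddCommGroup B] [NormedSpace ℝ B]
  {F : Type*} [NormedAddCommGroup F] [NormedSpace ℝ F]
  {M : Type*} [TopologicalSpace M] [ChartedSpace B M]
  {E : M → Type*} [TopologicalSpace (TotalSpace F E)]
  [∀ x, AddCommGroup (E x)] [∀ x, Module ℝ (E x)] [∀ x, TopologicalSpace (E x)]
  [FiberBundle F E] [VectorBundle ℝ F E]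

set_option linter.unusedSectionVars false in
theorem along_mem_baseSet (k : ℕ∞) (t₀ t₁ : ℝ) (γ : ℝ → TotalSpace F E)
    (hγ : ContMDiffOn 𝓘(ℝ, ℝ) (𝓘(ℝ, B).prod 𝓘(ℝ, F)) k γ (Icc t₀ t₁)) (t : ℝ)
    (ht : t ∈ Icc t₀ t₁) :
    ∀ᶠ s in 𝓝[Icc t₀ t₁] t, (γ s).1 ∈ (trivializationAt F E (γ t).1).baseSet := by
  have h := (contMDiffWithinAt_totalSpace.1 (hγ t ht)).1.continuousWithinAt
  exact h ((trivializationAt F E (γ t).1).open_baseSet.mem_nhds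
    (FiberBundle.mem_baseSet_trivializationAt F E (γ t).1))

/-- The space `E_{τ∘γ}` of sections of `E` of class `C^k` along the base path of `γ`. -/
def sectionsAlong (k : ℕ∞) (t₀ t₁ : ℝ) (γ : ℝ → TotalSpace F E)
    (hγ : ContMDiffOn 𝓘(ℝ, ℝ) (𝓘(ℝ, B).prod 𝓘(ℝ, F)) k γ (Icc t₀ t₁)) :
    Submodule ℝ (∀ t, E (γ t).1) where
  carrier := {ξ | ContMDiffOn 𝓘(ℝ, ℝ) (𝓘(ℝ, B).prod 𝓘(ℝ, F)) k
    (fun t => (⟨(γ t).1, ξ t⟩ : TotalSpace F E)) (Icc t₀ t₁)}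
  zero_mem' := by
    intro t ht
    have h := contMDiffWithinAt_totalSpace.1 (hγ t ht)
    exact ((contMDiff_zeroSection ℝ E).contMDiffAt.comp_contMDiffWithinAt t h.1)
  add_mem' := by
    intro a b ha hb t ht
    have h1 := contMDiffWithinAt_totalSpace.1 (ha t ht)
    have h2 := contMDiffWithinAt_totalSpace.1 (hb t ht)
    have hev := along_mem_baseSet k t₀ t₁ γ hγ t ht
    refine contMDiffWithinAt_totalSpace.2 ⟨h1.1, (h1.2.add h2.2).congr_of_eventuallyEq_of_mem ?_ ht⟩
    filter_upwards [hev] with s hs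
    exact ((trivializationAt F E (γ t).1).linear ℝ hs).1 _ _
  smul_mem' := by
    intro c a ha t ht
    have h1 := contMDiffWithinAt_totalSpace.1 (ha t ht)
    have hev := along_mem_baseSet k t₀ t₁ γ hγ t ht
    refine contMDiffWithinAt_totalSpace.2 ⟨h1.1, ((contMDiffWithinAt_const (I := 𝓘(ℝ, ℝ))
      (I' := 𝓘(ℝ, ℝ)) (c := c)).smul h1.2).congr_of_eventuallyEq_of_mem ?_ ht⟩
    filter_upwards [hev] with s hs
    exact ((trivializationAt F E (γ t).1).linear ℝ hs).2 _ _

/-- The space `E^0_{τ∘γ}` of the sections in `E_{τ∘γ}` vanishing at the end-points. -/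
def sectionsAlong₀ (k : ℕ∞) (t₀ t₁ : ℝ) (γ : ℝ → TotalSpace F E)
    (hγ : ContMDiffOn 𝓘(ℝ, ℝ) (𝓘(ℝ, B).prod 𝓘(ℝ, F)) k γ (Icc t₀ t₁)) :
    Submodule ℝ (∀ t, E (γ t).1) where
  carrier := {ξ | ξ ∈ sectionsAlong k t₀ t₁ γ hγ ∧ ξ t₀ = 0 ∧ ξ t₁ = 0}
  zero_mem' := ⟨zero_mem _, rfl, rfl⟩
  add_mem' := fun {a b} ha hb => ⟨add_mem ha.1 hb.1, by simp [ha.2.1, hb.2.1],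
    by simp [ha.2.2, hb.2.2]⟩
  smul_mem' := fun c a ha => ⟨Submodule.smul_mem _ c ha.1, by simp [ha.2.1], by simp [ha.2.2]⟩

end Along

end Algebroid

end

set_option linter.unusedSectionVars false

/-! Everything is computed in coordinates. Near `x₀`, a chart of `M` and a trivialisation of `E`
turn the algebroid into two smooth functions of `u ∈ B`: the anchor `ρ̂(u)` (`anchorCo`) and the
bracket `ĉ(u)` of constant sections (`bracketCo`). Write `γ = (u, y)`, and keep `η`, `ξ` for the
fibre coordinates of the two sections. Testing the definition of `ε` on constant sections gives its
coordinate formula (`isEps_iff`), and dualising gives `κ` (`kappa_iff`): the vector `κ`-related to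
`ξ̇` must be `δ_ξγ = (ρ̂ξ, ξ̇ + ĉ(y, ξ))`, and it exists because an Euler-Lagrange solution
satisfies `u̇ = ρ̂y`.

The tangent relation consists of the equations of `κ` and their derivatives (`tKappaCo_of_tKappa`,
`tKappa_of_tKappaCo`). A lifted generator is `Δξ = (u, ξ, ρ̂η, ζ)` with only `ζ` free. The equations
for `δ_{Δξ}(δ_ηγ)` determine it, and the one constraint on the data that is neither automatic nor
part of the Euler-Lagrange equation is `d/dt(ρ̂η) = δ_η(ρ̂y)`. It is the almost-Lie identity in
coordinates (`anchorVel_comm`).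

Let `p` be the fibre derivative of `L` and `f` the fibre part of `Λ_L`, so that `ṗ = f` along `γ`.
In the difference of `κ_{E*} ∘ TΛ_L(δ_ηγ)` and `d/dt Tλ_L(δ_ηγ)` the components `δx` and `δz` vanish
by the Euler-Lagrange equation and `δẋ` by the almost-Lie identity. What survives is `J(η) =
Df(δ_ηγ) - d/dt(Dp(δ_ηγ))`, linear in `η`. Since `δz = 0`, pairing the vertical part with `Δξ` gives
`J(η)ξ`, in which `ζ` does not occur (`pairT_vertPart`).

The two integrals are compared through `P = ⟨Δξ, Tλ_L(δ_ηγ)⟩ = Dp(δ_ηγ)ξ + p ζ`. The first integrand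
equals `Df(δ_ηγ)ξ + Dp(δ_ηγ)ξ̇ + f ζ + p ζ̇` (`dT_dT_var₂`), so `ṗ = f` makes it `Ṗ + J(η)ξ`
(`hasDerivWithinAt_pairT_momentum`). At the end-points `Δξ` is null, so `P = 0` there and both
integrals equal `∫ J(η)ξ dt`. This number does not involve `Δξ` and is bilinear; it is taken as the
definition of the form.

Two more facts are needed. The flip and the pairing are defined in the preferred chart at a base
point which moves with `t`, while time derivatives must be taken in a fixed chart. Hence both are
shown to have the same expression in all charts: `tco_tflip`, by symmetry of second derivatives, and
`pairT_eq`. Lifted generators are obtained by averaging local horizontal lifts with a partition of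
unity (`exists_isLiftedGenerator`). -/

noncomputable section

namespace Algebroid

/-! ### Coordinates on tangent bundles -/

section TangentCoordinates

variable {V : Type*} [NormedAddCommGroup V] [NormedSpace ℝ V]
  {H : Type*} [TopologicalSpace H] {I : ModelWithCorners ℝ V H}
  {Q : Type*} [TopologicalSpace Q] [ChartedSpace H Q]

variable (I) in
/-- The coordinates `(q, q̇)` of a tangent vector in the preferred chart at `q₀`. -/
def tco (q₀ : Q) (X : TangentBundle I Q) : V × V :=
  (extChartAt I q₀ X.1, mfderiv I 𝓘(ℝ, V) (extChartAt I q₀) X.1 X.2)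

variable (I) in
/-- The components of a tangent vector in the preferred chart at its base point. -/
def raw (X : TangentBundle I Q) : V := X.2

variable [IsManifold I 1 Q]

/-- The charts of `T Q` are the tangent maps of the charts of `Q`. This makes `tco` a genuine chart
on `T Q`, in which smoothness and derivatives may be read, although it is written with the chart of
`Q` alone. -/
theorem extChartAt_tangent {X₀ X : TangentBundle I Q} (h : X.1 ∈ (chartAt H X₀.1).source) :
    extChartAt I.tangent X₀ X = tco I X₀.1 X := by
  rw [FiberBundle.extChartAt]
  refine Prod.ext ?_ ?_
  · rfl
  · have h1 := TangentBundle.continuousLinearMapAt_trivializationAt (I := I) h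
    have h2 := Trivialization.linearMapAt_apply (R := ℝ)
      (trivializationAt V (TangentSpace I) X₀.1) (b := X.1) X.2
    have h3 := h2.trans (if_pos h)
    exact h3.symm.trans (congrArg (fun φ => φ X.2) h1)

theorem tco_self (X : TangentBundle I Q) : tco I X.1 X = (extChartAt I X.1 X.1, raw I X) := by
  rw [tco, mfderiv_extChartAt_self]; rfl

theorem tco_snd_self {q : Q} (v : TangentSpace I q) :
    (tco I q (⟨q, v⟩ : TangentBundle I Q)).2 = v :=
  congrArg Prod.snd (tco_self (⟨q, v⟩ : TangentBundle I Q))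

/-- Equalities of tangent vectors below are all reduced to coordinates in one chart by this
injectivity; `exists_tco_snd` and `tco_snd_inj` do the same for existence and uniqueness in a fixed
tangent space. -/
theorem tco_inj {q₀ : Q} {X Y : TangentBundle I Q} (hX : X.1 ∈ (chartAt H q₀).source)
    (hY : Y.1 ∈ (chartAt H q₀).source) (h : tco I q₀ X = tco I q₀ Y) : X = Y := by
  have e : ∀ Z : TangentBundle I Q, Z.1 ∈ (chartAt H q₀).source →
      Z ∈ (extChartAt I.tangent (⟨q₀, 0⟩ : TangentBundle I Q)).source := by
    intro Z hZ
    rw [extChartAt_source, TangentBundle.mem_chart_source_iff]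
    exact hZ
  refine (extChartAt I.tangent (⟨q₀, 0⟩ : TangentBundle I Q)).injOn (e X hX) (e Y hY) ?_
  rw [extChartAt_tangent (by exact hX), extChartAt_tangent (by exact hY)]
  exact h

theorem exists_tco_snd {q₀ q : Q} (hq : q ∈ (chartAt H q₀).source) (w : V) :
    ∃ v : TangentSpace I q, (tco I q₀ (⟨q, v⟩ : TangentBundle I Q)).2 = w :=
  (isInvertible_mfderiv_extChartAt (I := I) (by rwa [extChartAt_source])).bijective.2 w

theorem tco_snd_inj {q₀ q : Q} (hq : q ∈ (chartAt H q₀).source) {v w : TangentSpace I q}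
    (h : (tco I q₀ (⟨q, v⟩ : TangentBundle I Q)).2 = (tco I q₀ (⟨q, w⟩ : TangentBundle I Q)).2) :
    v = w :=
  (isInvertible_mfderiv_extChartAt (I := I) (by rwa [extChartAt_source])).bijective.1 h

theorem tco_prolong {t₀ t₁ t : ℝ} {c : ℝ → Q} {q₀ : Q} (ht : t₀ < t₁) (htt : t ∈ Icc t₀ t₁)
    (hc : MDifferentiableWithinAt 𝓘(ℝ, ℝ) I c (Icc t₀ t₁) t)
    (hq : c t ∈ (chartAt H q₀).source) :
    tco I q₀ (prolong I t₀ t₁ c t) =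
      (extChartAt I q₀ (c t), derivWithin (fun s => extChartAt I q₀ (c s)) (Icc t₀ t₁) t) := by
  refine Prod.ext rfl ?_
  have hu : UniqueMDiffWithinAt 𝓘(ℝ, ℝ) (Icc t₀ t₁) t :=
    (uniqueDiffOn_Icc ht t htt).uniqueMDiffWithinAt
  have h := mfderiv_comp_mfderivWithin t (mdifferentiableAt_extChartAt (I := I) hq) hc hu
  rw [mfderivWithin_eq_fderivWithin] at h
  have h2 := congrArg (fun φ => φ (1 : ℝ)) h
  exact h2.symm

theorem tco_velocity {c : ℝ → Q} {q₀ : Q} {s : ℝ}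
    (hc : MDifferentiableAt 𝓘(ℝ, ℝ) I c s) (hq : c s ∈ (chartAt H q₀).source) :
    tco I q₀ (⟨c s, mfderiv 𝓘(ℝ, ℝ) I c s (1 : ℝ)⟩ : TangentBundle I Q) =
      (extChartAt I q₀ (c s), deriv (fun s => extChartAt I q₀ (c s)) s) := by
  refine Prod.ext rfl ?_
  have h := mfderiv_comp s (mdifferentiableAt_extChartAt (I := I) hq) hc
  rw [mfderiv_eq_fderiv] at h
  have h2 := congrArg (fun φ => φ (1 : ℝ)) h
  exact h2.symm

variable {W : Type*} [NormedAddCommGroup W] [NormedSpace ℝ W]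

/-- The differential of a vector-valued map, from an expression of the map in coordinates. -/
theorem mfderiv_eq_of_coord {f : Q → W} {g : V → W} {q₀ q : Q} {g' : V →L[ℝ] W}
    (hq : q ∈ (chartAt H q₀).source)
    (hfg : f =ᶠ[𝓝 q] fun p => g (extChartAt I q₀ p))
    (hg : HasFDerivAt g g' (extChartAt I q₀ q)) (v : TangentSpace I q) :
    mfderiv I 𝓘(ℝ, W) f q v = g' (tco I q₀ (⟨q, v⟩ : TangentBundle I Q)).2 := by
  have h1 : HasMFDerivAt 𝓘(ℝ, V) 𝓘(ℝ, W) g (extChartAt I q₀ q) g' := hg.hasMFDerivAt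
  have h2 := h1.comp q (mdifferentiableAt_extChartAt (I := I) hq).hasMFDerivAt
  rw [(h2.congr_of_eventuallyEq hfg).mfderiv]
  rfl

section Maps

variable {V' : Type*} [NormedAddCommGroup V'] [NormedSpace ℝ V']
  {H' : Type*} [TopologicalSpace H'] {I' : ModelWithCorners ℝ V' H'}
  {Q' : Type*} [TopologicalSpace Q'] [ChartedSpace H' Q'] [IsManifold I' 1 Q']

/-- The coordinates of the image of a vector under a tangent map. -/
theorem tco_mfderiv {f : Q → Q'} {g : V → V'} {q₀ q : Q} {q₀' : Q'} {g' : V →L[ℝ] V'}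
    (hq : q ∈ (chartAt H q₀).source) (hq' : f q ∈ (chartAt H' q₀').source)
    (hf : MDifferentiableAt I I' f q)
    (hfg : (fun p => extChartAt I' q₀' (f p)) =ᶠ[𝓝 q] fun p => g (extChartAt I q₀ p))
    (hg : HasFDerivAt g g' (extChartAt I q₀ q)) (v : TangentSpace I q) :
    tco I' q₀' (⟨f q, mfderiv I I' f q v⟩ : TangentBundle I' Q') =
      (g (extChartAt I q₀ q), g' (tco I q₀ (⟨q, v⟩ : TangentBundle I Q)).2) := by
  refine Prod.ext hfg.self_of_nhds ?_
  have h := mfderiv_comp q (mdifferentiableAt_extChartAt (I := I') hq') hf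
  have h2 := congrArg (fun φ => φ v) h
  exact h2.symm.trans (mfderiv_eq_of_coord hq hfg hg v)

end Maps

end TangentCoordinates

/-! ### Independence of the canonical flip from the chart -/

section Flip

variable {V : Type*} [NormedAddCommGroup V] [NormedSpace ℝ V]
  {H : Type*} [TopologicalSpace H] {I : ModelWithCorners ℝ V H} [I.Boundaryless]
  {Q : Type*} [TopologicalSpace Q] [ChartedSpace H Q] [IsManifold I ∞ Q]

theorem exists_transition {q₀ q : Q} (hq : q ∈ (chartAt H q₀).source) :
    ∃ ψ : V → V, ContDiffAt ℝ ∞ ψ (extChartAt I q q) ∧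
      ∀ᶠ p in 𝓝 q, extChartAt I q₀ p = ψ (extChartAt I q p) := by
  refine ⟨extChartAt I q₀ ∘ (extChartAt I q).symm, ?_, ?_⟩
  · have h := contDiffWithinAt_ext_coord_change (I := I) (n := ∞) q₀ q
      (y := extChartAt I q q) (by simp [hq])
    rwa [I.range_eq_univ, contDiffWithinAt_univ] at h
  · filter_upwards [extChartAt_source_mem_nhds (I := I) q] with p hp
    exact congrArg (extChartAt I q₀) ((extChartAt I q).left_inv hp).symm

omit [I.Boundaryless] in
theorem tco_eq_of_transition {q₀ q : Q} {ψ : V → V}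
    (hψ : ContDiffAt ℝ ∞ ψ (extChartAt I q q))
    (h : ∀ᶠ p in 𝓝 q, extChartAt I q₀ p = ψ (extChartAt I q p)) :
    ∀ᶠ p in 𝓝 q, ∀ X : TangentBundle I Q, X.1 = p → tco I q₀ X =
      (ψ (tco I q X).1, fderiv ℝ ψ (tco I q X).1 (tco I q X).2) := by
  have h1 : ∀ᶠ u in 𝓝 (extChartAt I q q), ContDiffAt ℝ 1 ψ u :=
    (hψ.of_le (by exact_mod_cast le_top)).eventually (by simp)
  have h2 := (continuousAt_extChartAt (I := I) q).eventually h1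
  filter_upwards [h.eventually_nhds, h2, (chartAt H q).open_source.mem_nhds (mem_chart_source H q)]
    with p hp hp2 hps
  rintro X rfl
  exact Prod.ext hp.self_of_nhds (mfderiv_eq_of_coord hps hp
    (hp2.differentiableAt one_ne_zero).hasFDerivAt X.2)

/-- The flip is defined in the chart centred at the base point. If `ψ` is the transition to another
chart, the last component becomes `D²ψ(δq, q̇) + Dψ(δq̇)`, and exchanging `q̇` and `δq` leaves it
unchanged because `D²ψ` is symmetric. -/
theorem tco_tflip {q₀ : Q} (A : TangentBundle I.tangent (TangentBundle I Q))
    (hq : A.1.1 ∈ (chartAt H q₀).source) :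
    tco I.tangent (⟨q₀, 0⟩ : TangentBundle I Q) (tflip I A) =
      ((((tco I.tangent (⟨q₀, 0⟩ : TangentBundle I Q) A).1.1,
        (tco I.tangent (⟨q₀, 0⟩ : TangentBundle I Q) A).2.1)),
        ((tco I.tangent (⟨q₀, 0⟩ : TangentBundle I Q) A).1.2,
        (tco I.tangent (⟨q₀, 0⟩ : TangentBundle I Q) A).2.2)) := by
  obtain ⟨ψ, hψ, hψq⟩ := exists_transition (I := I) hq
  have key : ∀ C : TangentBundle I.tangent (TangentBundle I Q), C.1.1 = A.1.1 →
      tco I.tangent (⟨q₀, 0⟩ : TangentBundle I Q) C =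
        ((ψ (extChartAt I A.1.1 A.1.1), fderiv ℝ ψ (extChartAt I A.1.1 A.1.1) (raw I C.1)),
          (fderiv ℝ ψ (extChartAt I A.1.1 A.1.1) (raw I.tangent C).1,
            fderiv ℝ (fderiv ℝ ψ) (extChartAt I A.1.1 A.1.1) (raw I.tangent C).1 (raw I C.1)
            + fderiv ℝ ψ (extChartAt I A.1.1 A.1.1) (raw I.tangent C).2)) := by
    intro C hC
    -- The map `ψ'` is the tangent map of `ψ`, that is, the transition between charts of `T Q`. Its
    -- derivative produces the term with `D²ψ`.
    obtain ⟨ψ', hψ'⟩ : ∃ ψ' : V × V → V × V, ψ' = fun u => (ψ u.1, fderiv ℝ ψ u.1 u.2) := ⟨_, rfl⟩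
    have hCs : C.1.1 ∈ (chartAt H q₀).source := by rwa [hC]
    rw [← hC] at hψ hψq ⊢
    have hev := tco_eq_of_transition hψ hψq
    have e1 : ∀ᶠ X in 𝓝 C.1, X.1 ∈ (chartAt H q₀).source :=
      (FiberBundle.continuous_proj V (TangentSpace I (M := Q))).continuousAt.eventually
        ((chartAt H q₀).open_source.mem_nhds hCs)
    have e2 : ∀ᶠ X in 𝓝 C.1, X.1 ∈ (chartAt H C.1.1).source :=
      (FiberBundle.continuous_proj V (TangentSpace I (M := Q))).continuousAt.eventually
        ((chartAt H C.1.1).open_source.mem_nhds (mem_chart_source H C.1.1))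
    have e3 := (FiberBundle.continuous_proj V (TangentSpace I (M := Q))).continuousAt.eventually hev
    have e4 : (extChartAt I.tangent (⟨q₀, 0⟩ : TangentBundle I Q) : TangentBundle I Q → V × V)
        =ᶠ[𝓝 C.1] fun X => ψ' (extChartAt I.tangent C.1 X) := by
      filter_upwards [e1, e2, e3] with X h1 h2 h3
      rw [extChartAt_tangent (by exact h1), extChartAt_tangent h2, hψ']
      exact h3 X rfl
    obtain ⟨v, hv⟩ : ∃ v : V, v = raw I C.1 := ⟨_, rfl⟩
    have hC1 : extChartAt I.tangent C.1 C.1 = (extChartAt I C.1.1 C.1.1, v) :=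
      (extChartAt_tangent (mem_chart_source H C.1.1)).trans ((tco_self C.1).trans (by rw [hv]))
    have d1 : HasFDerivAt ψ (fderiv ℝ ψ (extChartAt I C.1.1 C.1.1)) (extChartAt I C.1.1 C.1.1) :=
      (hψ.differentiableAt (by simp)).hasFDerivAt
    have d2 : HasFDerivAt (fderiv ℝ ψ) (fderiv ℝ (fderiv ℝ ψ) (extChartAt I C.1.1 C.1.1))
        (extChartAt I C.1.1 C.1.1) :=
      ((hψ.fderiv_right (m := 1) (one_add_one_eq_two.trans_le ENat.LEInfty.out)).differentiableAt
        one_ne_zero).hasFDerivAt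
    set a : V × V := (extChartAt I C.1.1 C.1.1, v) with ha
    have d3 : HasFDerivAt (Prod.fst : V × V → V) (ContinuousLinearMap.fst ℝ V V) a := hasFDerivAt_fst
    have d4 : HasFDerivAt (Prod.snd : V × V → V) (ContinuousLinearMap.snd ℝ V V) a := hasFDerivAt_snd
    have d5 := (HasFDerivAt.comp a (f := Prod.fst) (by exact d1) d3).prodMk
      ((HasFDerivAt.comp a (f := Prod.fst) (by exact d2) d3).clm_apply d4)
    obtain ⟨g', hg', hval⟩ : ∃ g' : V × V →L[ℝ] V × V, HasFDerivAt ψ' g' a ∧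
        ∀ w, g' w = (fderiv ℝ ψ a.1 w.1, fderiv ℝ (fderiv ℝ ψ) a.1 w.1 a.2 + fderiv ℝ ψ a.1 w.2) :=
      ⟨_, by rw [hψ']; exact d5, fun w => Prod.ext rfl (add_comm _ _)⟩
    rw [← hC1] at hg'
    have hm := mfderiv_eq_of_coord (I := I.tangent) (mem_chart_source _ C.1) e4 hg' C.2
    have hz := tco_snd_self (I := I.tangent) C.2
    refine Prod.ext ?_ ?_
    · refine e4.self_of_nhds.trans ((congrArg ψ' hC1).trans ?_)
      rw [hψ', ha, hv]
    · refine hm.trans ((congrArg _ hz).trans ((hval _).trans ?_))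
      rw [ha, hv]; rfl
  rw [key A rfl, key (tflip I A) rfl]
  have hs : IsSymmSndFDerivAt ℝ ψ (extChartAt I A.1.1 A.1.1) :=
    hψ.isSymmSndFDerivAt (by simpa using ENat.LEInfty.out)
  refine Prod.ext rfl (Prod.ext rfl ?_)
  exact congrArg (· + _) (hs _ _)

end Flip

/-! ### Coordinates on vector bundles -/

section BundleCoordinates

variable {B : Type*} [NormedAddCommGroup B] [NormedSpace ℝ B]
  {F : Type*} [NormedAddCommGroup F] [NormedSpace ℝ F]
  {M : Type*} [TopologicalSpace M] [ChartedSpace B M]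
  {E : M → Type*} [TopologicalSpace (TotalSpace F E)]
  [∀ x, AddCommGroup (E x)] [∀ x, Module ℝ (E x)] [∀ x, TopologicalSpace (E x)]
  [FiberBundle F E] [VectorBundle ℝ F E]

variable (B F E) in
/-- The domain in `M` of the coordinates on `E` at `x₀`. -/
def dom (x₀ : M) : Set M := (chartAt B x₀).source ∩ (trivializationAt F E x₀).baseSet

variable (B F E) in
theorem isOpen_dom (x₀ : M) : IsOpen (dom B F E x₀) :=
  (chartAt B x₀).open_source.inter (trivializationAt F E x₀).open_baseSet

variable (B F E) in
theorem mem_dom_self (x₀ : M) : x₀ ∈ dom B F E x₀ :=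
  ⟨mem_chart_source B x₀, FiberBundle.mem_baseSet_trivializationAt F E x₀⟩

theorem mem_source_iff {e₀ e : TotalSpace F E} :
    e ∈ (chartAt (ModelProd B F) e₀).source ↔ e.1 ∈ dom B F E e₀.1 := by
  have h : e ∈ (chartAt (ModelProd B F) e₀).source ↔
      e ∈ (extChartAt (𝓘(ℝ, B).prod 𝓘(ℝ, F)) e₀).source := by rw [extChartAt_source]
  rw [h, FiberBundle.extChartAt, PartialEquiv.trans_source]
  constructor
  · rintro ⟨h1, h2⟩
    have h1' := (trivializationAt F E e₀.1).mem_source.1 h1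
    have h2' : (trivializationAt F E e₀.1 e).1 ∈ (extChartAt 𝓘(ℝ, B) e₀.1).source := h2.1
    rw [Trivialization.coe_fst _ h1, extChartAt_source] at h2'
    exact ⟨h2', h1'⟩
  · rintro ⟨h1, h2⟩
    have h1' := (trivializationAt F E e₀.1).mem_source.2 h2
    refine ⟨h1', ?_, mem_univ _⟩
    change (trivializationAt F E e₀.1 e).1 ∈ (extChartAt 𝓘(ℝ, B) e₀.1).source
    rwa [Trivialization.coe_fst _ h1', extChartAt_source]

theorem extChartAt_totalSpace {e₀ e : TotalSpace F E} (h : e.1 ∈ dom B F E e₀.1) :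
    extChartAt (𝓘(ℝ, B).prod 𝓘(ℝ, F)) e₀ e =
      (extChartAt 𝓘(ℝ, B) e₀.1 e.1, (trivializationAt F E e₀.1 e).2) := by
  rw [FiberBundle.extChartAt]
  refine Prod.ext ?_ rfl
  exact congrArg (extChartAt 𝓘(ℝ, B) e₀.1)
    (Trivialization.coe_fst _ ((trivializationAt F E e₀.1).mem_source.2 h.2))

/-- The preferred chart of `E` at `e` depends only on the base point of `e`. -/
theorem extChartAt_totalSpace_congr {e₀ e₁ : TotalSpace F E} (h : e₀.1 = e₁.1) :
    extChartAt (𝓘(ℝ, B).prod 𝓘(ℝ, F)) e₀ = extChartAt (𝓘(ℝ, B).prod 𝓘(ℝ, F)) e₁ := by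
  rw [FiberBundle.extChartAt, FiberBundle.extChartAt, h]

variable (F E) in
/-- The coordinates at `x₀` of points of `E`. -/
abbrev origin (x₀ : M) : TotalSpace F E := ⟨x₀, 0⟩

theorem tco_congr {e₀ e₁ : TotalSpace F E} (h : e₀.1 = e₁.1) (X : TE B F E) :
    tco (𝓘(ℝ, B).prod 𝓘(ℝ, F)) e₀ X = tco (𝓘(ℝ, B).prod 𝓘(ℝ, F)) e₁ X := by
  unfold tco; rw [extChartAt_totalSpace_congr h]

variable [IsManifold 𝓘(ℝ, B) ∞ M] [ContMDiffVectorBundle ∞ F E 𝓘(ℝ, B)]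

theorem tco_center (X : TE B F E) :
    tco (𝓘(ℝ, B).prod 𝓘(ℝ, F)) (origin F E X.1.1) X =
      ((extChartAt 𝓘(ℝ, B) X.1.1 X.1.1, (trivializationAt F E X.1.1 X.1).2),
        raw (𝓘(ℝ, B).prod 𝓘(ℝ, F)) X) := by
  refine (tco_congr (e₀ := origin F E X.1.1) (e₁ := X.1) rfl X).trans ((tco_self X).trans ?_)
  rw [extChartAt_totalSpace (mem_dom_self B F E _)]

theorem eventually_mem_dom {x₀ : M} {e : TotalSpace F E} (h : e.1 ∈ dom B F E x₀) :
    ∀ᶠ p in 𝓝 e, p.1 ∈ dom B F E x₀ :=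
  (FiberBundle.continuous_proj F E).continuousAt.eventually ((isOpen_dom B F E x₀).mem_nhds h)

theorem mem_source_origin {x₀ : M} {e : TotalSpace F E} (h : e.1 ∈ dom B F E x₀) :
    e ∈ (chartAt (ModelProd B F) (origin F E x₀)).source := mem_source_iff.2 h

/-- The expression in coordinates of a section. -/
def secCo (x₀ : M) (S : ∀ x, E x) (u : B) : F :=
  (trivializationAt F E x₀ ⟨(extChartAt 𝓘(ℝ, B) x₀).symm u,
    S ((extChartAt 𝓘(ℝ, B) x₀).symm u)⟩).2

theorem secCo_apply {x₀ x : M} (hx : x ∈ dom B F E x₀) (S : ∀ x, E x) :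
    secCo (B := B) (F := F) x₀ S (extChartAt 𝓘(ℝ, B) x₀ x) = (trivializationAt F E x₀ ⟨x, S x⟩).2 := by
  rw [secCo, (extChartAt 𝓘(ℝ, B) x₀).left_inv (by rw [extChartAt_source]; exact hx.1)]

theorem contMDiffAt_triv_section {x₀ x : M} (hx : x ∈ dom B F E x₀) {S : ∀ x, E x} {n : ℕ∞}
    (hS : ContMDiffAt 𝓘(ℝ, B) (𝓘(ℝ, B).prod 𝓘(ℝ, F)) n (fun y => TotalSpace.mk' F y (S y)) x) :
    ContMDiffAt 𝓘(ℝ, B) 𝓘(ℝ, F) n (fun y => (trivializationAt F E x₀ ⟨y, S y⟩).2) x := by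
  have : ContMDiffVectorBundle n F E 𝓘(ℝ, B) := ContMDiffVectorBundle.of_le (n := ∞) (by exact_mod_cast le_top)
  exact ((trivializationAt F E x₀).contMDiffAt_section_iff hx.2).1 hS

theorem contDiffAt_secCo {x₀ x : M} (hx : x ∈ dom B F E x₀) {S : ∀ x, E x} {n : ℕ∞}
    (hS : ContMDiffAt 𝓘(ℝ, B) (𝓘(ℝ, B).prod 𝓘(ℝ, F)) n (fun y => TotalSpace.mk' F y (S y)) x) :
    ContDiffAt ℝ n (secCo (B := B) (F := F) x₀ S) (extChartAt 𝓘(ℝ, B) x₀ x) := by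
  have h1 := contMDiffAt_triv_section hx hS
  have hxs : x ∈ (extChartAt 𝓘(ℝ, B) x₀).source := by rw [extChartAt_source]; exact hx.1
  have h2 : ContMDiffAt 𝓘(ℝ, B) 𝓘(ℝ, B) n (extChartAt 𝓘(ℝ, B) x₀).symm
      (extChartAt 𝓘(ℝ, B) x₀ x) := by
    have : IsManifold 𝓘(ℝ, B) n M := IsManifold.of_le (n := ∞) (by exact_mod_cast le_top)
    exact (contMDiffOn_extChartAt_symm (n := n) x₀).contMDiffAt
      ((isOpen_extChartAt_target x₀).mem_nhds ((extChartAt 𝓘(ℝ, B) x₀).map_source hxs))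
  rw [← (extChartAt 𝓘(ℝ, B) x₀).left_inv hxs] at h1
  exact (h1.comp (extChartAt 𝓘(ℝ, B) x₀ x) h2).contDiffAt

/-- The coordinates of the image of a tangent vector of `M` under a section. -/
theorem tco_section {x₀ x : M} (hx : x ∈ dom B F E x₀) {S : ∀ x, E x}
    (hS : ContMDiffAt 𝓘(ℝ, B) (𝓘(ℝ, B).prod 𝓘(ℝ, F)) ∞ (fun y => TotalSpace.mk' F y (S y)) x)
    (w : TangentSpace 𝓘(ℝ, B) x) :
    tco (𝓘(ℝ, B).prod 𝓘(ℝ, F)) (origin F E x₀) (⟨⟨x, S x⟩,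
        mfderiv 𝓘(ℝ, B) (𝓘(ℝ, B).prod 𝓘(ℝ, F)) (fun y => TotalSpace.mk' F y (S y)) x w⟩ : TE B F E) =
      ((extChartAt 𝓘(ℝ, B) x₀ x, secCo (B := B) (F := F) x₀ S (extChartAt 𝓘(ℝ, B) x₀ x)),
        ((tco 𝓘(ℝ, B) x₀ (⟨x, w⟩ : TangentBundle 𝓘(ℝ, B) M)).2,
          fderiv ℝ (secCo (B := B) (F := F) x₀ S) (extChartAt 𝓘(ℝ, B) x₀ x)
            (tco 𝓘(ℝ, B) x₀ (⟨x, w⟩ : TangentBundle 𝓘(ℝ, B) M)).2)) := by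
  have hd := ((contDiffAt_secCo hx hS).differentiableAt (by simp)).hasFDerivAt
  refine tco_mfderiv (f := fun y => TotalSpace.mk' F y (S y))
    (g := fun u => (u, secCo (B := B) (F := F) x₀ S u)) hx.1 (mem_source_origin hx)
    (hS.mdifferentiableAt (by simp)) ?_ ((hasFDerivAt_id _).prodMk hd) w
  filter_upwards [(isOpen_dom B F E x₀).mem_nhds hx] with y hy
  refine (extChartAt_totalSpace (e₀ := origin F E x₀) hy).trans ?_
  rw [secCo_apply hy]

theorem tco_Tτ {x₀ : M} (X : TE B F E) (hx : X.1.1 ∈ dom B F E x₀) :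
    tco 𝓘(ℝ, B) x₀ (Tτ X) = ((tco (𝓘(ℝ, B).prod 𝓘(ℝ, F)) (origin F E x₀) X).1.1,
      (tco (𝓘(ℝ, B).prod 𝓘(ℝ, F)) (origin F E x₀) X).2.1) := by
  refine (tco_mfderiv (f := π F E) (g := Prod.fst) (q₀ := origin F E x₀)
    (mem_source_origin hx) hx.1
    ((contMDiff_proj E (n := 1)).mdifferentiable one_ne_zero X.1) ?_ hasFDerivAt_fst X.2)
  filter_upwards [eventually_mem_dom hx] with p hp
  rw [extChartAt_totalSpace hp]

theorem tco_nullVec {x₀ : M} (v : TangentBundle 𝓘(ℝ, B) M) (hx : v.1 ∈ dom B F E x₀) :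
    tco (𝓘(ℝ, B).prod 𝓘(ℝ, F)) (origin F E x₀) (nullVec v : TE B F E) =
      ((extChartAt 𝓘(ℝ, B) x₀ v.1, 0), ((tco 𝓘(ℝ, B) x₀ v).2, 0)) := by
  refine tco_mfderiv (f := zeroSection F E)
    (g := fun u => (u, (0 : F))) (g' := (ContinuousLinearMap.id ℝ B).prod 0) hx.1
    (mem_source_origin (e := zeroSection F E v.1) hx)
    ((contMDiff_zeroSection ℝ E (n := 1)).mdifferentiable one_ne_zero v.1) ?_
    ((hasFDerivAt_id _).prodMk (hasFDerivAt_const _ _)) v.2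
  filter_upwards [(isOpen_dom B F E x₀).mem_nhds hx] with y hy
  refine (extChartAt_totalSpace (e₀ := origin F E x₀) hy).trans ?_
  exact Prod.ext rfl ((trivializationAt F E x₀).zeroSection ℝ hy.2 ▸ rfl)

theorem triv_add {x₀ x : M} (hx : x ∈ dom B F E x₀) (a b : E x) :
    (trivializationAt F E x₀ ⟨x, a + b⟩).2 =
      (trivializationAt F E x₀ ⟨x, a⟩).2 + (trivializationAt F E x₀ ⟨x, b⟩).2 :=
  ((trivializationAt F E x₀).linear ℝ hx.2).1 a b

theorem triv_smul {x₀ x : M} (hx : x ∈ dom B F E x₀) (c : ℝ) (b : E x) :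
    (trivializationAt F E x₀ ⟨x, c • b⟩).2 = c • (trivializationAt F E x₀ ⟨x, b⟩).2 :=
  ((trivializationAt F E x₀).linear ℝ hx.2).2 c b

/-- `vertLift` is written in the centred chart. Its vector is the velocity of the line `s ↦ y + s v`
in the fibre, and that line is affine in every trivialisation, so the same formula holds in all
charts. -/
theorem tco_vertLift {x₀ : M} (e : TotalSpace F E) (v : E e.1) (hx : e.1 ∈ dom B F E x₀) :
    tco (𝓘(ℝ, B).prod 𝓘(ℝ, F)) (origin F E x₀) (⟨e, vertLift B e v⟩ : TE B F E) =
      ((extChartAt 𝓘(ℝ, B) x₀ e.1, (trivializationAt F E x₀ e).2),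
        (0, (trivializationAt F E x₀ ⟨e.1, v⟩).2)) := by
  obtain ⟨x, y⟩ := e
  obtain ⟨c, hc⟩ : ∃ c : ℝ → TotalSpace F E, c = fun s => ⟨x, y + s • v⟩ := ⟨_, rfl⟩
  have hc0 : c 0 = ⟨x, y⟩ := by simp [hc]
  have key : ∀ x₁, x ∈ dom B F E x₁ → (fun s => extChartAt (𝓘(ℝ, B).prod 𝓘(ℝ, F))
      (origin F E x₁) (c s)) = fun s => (extChartAt 𝓘(ℝ, B) x₁ x,
        (trivializationAt F E x₁ ⟨x, y⟩).2 + s • (trivializationAt F E x₁ ⟨x, v⟩).2) := by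
    intro x₁ h₁
    funext s
    rw [hc]
    refine (extChartAt_totalSpace (e₀ := origin F E x₁) (e := ⟨x, y + s • v⟩) h₁).trans ?_
    rw [triv_add h₁, triv_smul h₁]
  have hs : MDifferentiableAt 𝓘(ℝ, ℝ) (𝓘(ℝ, B).prod 𝓘(ℝ, F)) c 0 := by
    have : ContMDiffAt 𝓘(ℝ, ℝ) (𝓘(ℝ, B).prod 𝓘(ℝ, F)) 1 c 0 := by
      rw [contMDiffAt_totalSpace, hc]
      refine ⟨contMDiffAt_const, ContDiffAt.contMDiffAt ?_⟩
      simp only [triv_add (mem_dom_self B F E x), triv_smul (mem_dom_self B F E x)]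
      fun_prop
    exact this.mdifferentiableAt one_ne_zero
  have key2 : ∀ x₁, x ∈ dom B F E x₁ → tco (𝓘(ℝ, B).prod 𝓘(ℝ, F)) (origin F E x₁)
      (⟨c 0, mfderiv 𝓘(ℝ, ℝ) (𝓘(ℝ, B).prod 𝓘(ℝ, F)) c 0 (1 : ℝ)⟩ : TE B F E) =
        ((extChartAt 𝓘(ℝ, B) x₁ x, (trivializationAt F E x₁ ⟨x, y⟩).2),
          (0, (trivializationAt F E x₁ ⟨x, v⟩).2)) := by
    intro x₁ h₁
    have hcs : c 0 ∈ (chartAt (ModelProd B F) (origin F E x₁)).source := by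
      rw [hc0]; exact mem_source_origin h₁
    refine (tco_velocity hs hcs).trans ?_
    have hk := key x₁ h₁
    refine Prod.ext ?_ ?_
    · refine (congrFun hk 0).trans ?_
      simp
    · have hd : HasDerivAt (fun s : ℝ => (extChartAt 𝓘(ℝ, B) x₁ x,
        (trivializationAt F E x₁ ⟨x, y⟩).2 + s • (trivializationAt F E x₁ ⟨x, v⟩).2))
        (0, (1 : ℝ) • (trivializationAt F E x₁ ⟨x, v⟩).2) 0 :=
        (hasDerivAt_const _ _).prodMk (((hasDerivAt_id (0 : ℝ)).smul_const _).const_add _)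
      refine (congrArg (fun f => deriv f 0) hk).trans ?_
      rw [hd.deriv, one_smul]
  -- The velocity is recognised as the vertical lift in the chart centred at `x`; afterwards `key2`
  -- reads it in the chart at `x₀`.
  have h0 : (⟨c 0, mfderiv 𝓘(ℝ, ℝ) (𝓘(ℝ, B).prod 𝓘(ℝ, F)) c 0 (1 : ℝ)⟩ : TE B F E) =
      ⟨⟨x, y⟩, vertLift B ⟨x, y⟩ v⟩ := by
    refine tco_inj (q₀ := origin F E x) ?_ (mem_source_origin (mem_dom_self B F E x)) ?_
    · change c 0 ∈ _
      rw [hc0]; exact mem_source_origin (mem_dom_self B F E x)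
    · have h1 := tco_center (⟨⟨x, y⟩, vertLift B ⟨x, y⟩ v⟩ : TE B F E)
      have h2 : raw (𝓘(ℝ, B).prod 𝓘(ℝ, F)) (⟨⟨x, y⟩, vertLift B ⟨x, y⟩ v⟩ : TE B F E) =
          (0, (trivializationAt F E x).continuousLinearMapAt ℝ x v) := rfl
      rw [Trivialization.continuousLinearMapAt_apply, Trivialization.linearMapAt_apply,
        if_pos (mem_dom_self B F E x).2] at h2
      rw [h2] at h1
      exact (key2 x (mem_dom_self B F E x)).trans h1.symm
  rw [← h0]
  exact key2 x₀ hx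

end BundleCoordinates

/-! ### The dual bundle and the pairings -/

section DualCoordinates

variable {B : Type*} [NormedAddCommGroup B] [NormedSpace ℝ B]
  {F : Type*} [NormedAddCommGroup F] [NormedSpace ℝ F]
  {M : Type*} [TopologicalSpace M] [ChartedSpace B M]
  {E : M → Type*} [TopologicalSpace (TotalSpace F E)]
  [∀ x, AddCommGroup (E x)] [∀ x, Module ℝ (E x)] [∀ x, TopologicalSpace (E x)]
  [FiberBundle F E] [VectorBundle ℝ F E]

/-- The local section of `E` which is constant in the coordinates at `x₀`. -/
def locSec (x₀ : M) (v : F) (x : M) : E x := (trivializationAt F E x₀).symmL ℝ x v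

theorem triv_locSec {x₀ x : M} (hx : x ∈ dom B F E x₀) (v : F) :
    (trivializationAt F E x₀ ⟨x, (locSec x₀ v x : E x)⟩).2 = v := by
  rw [locSec, (trivializationAt F E x₀).symmL_apply hx.2]
  exact congrArg Prod.snd ((trivializationAt F E x₀).apply_mk_symm hx.2 v)

theorem locSec_triv {x₀ x : M} (hx : x ∈ dom B F E x₀) (v : E x) :
    locSec x₀ (trivializationAt F E x₀ ⟨x, v⟩).2 x = v := by
  rw [locSec, (trivializationAt F E x₀).symmL_apply hx.2]
  exact (trivializationAt F E x₀).symm_apply_apply_mk hx.2 v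

theorem triv_inj {x₀ x : M} (hx : x ∈ dom B F E x₀) {v w : E x}
    (h : (trivializationAt F E x₀ ⟨x, v⟩).2 = (trivializationAt F E x₀ ⟨x, w⟩).2) : v = w := by
  rw [← locSec_triv hx v, ← locSec_triv hx w, h]

theorem tco_add {V : Type*} [NormedAddCommGroup V] [NormedSpace ℝ V]
    {H : Type*} [TopologicalSpace H] {I : ModelWithCorners ℝ V H}
    {Q : Type*} [TopologicalSpace Q] [ChartedSpace H Q] (q₀ : Q) {q : Q} (v w : TangentSpace I q) :
    (tco I q₀ (⟨q, v + w⟩ : TangentBundle I Q)).2 =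
      (tco I q₀ (⟨q, v⟩ : TangentBundle I Q)).2 + (tco I q₀ (⟨q, w⟩ : TangentBundle I Q)).2 :=
  map_add (mfderiv I 𝓘(ℝ, V) (extChartAt I q₀) q) v w

section

variable [IsManifold 𝓘(ℝ, B) ∞ M] [ContMDiffVectorBundle ∞ F E 𝓘(ℝ, B)]

theorem contMDiffAt_locSec {x₀ x : M} (hx : x ∈ dom B F E x₀) (v : F) :
    ContMDiffAt 𝓘(ℝ, B) (𝓘(ℝ, B).prod 𝓘(ℝ, F)) ∞
      (fun y => TotalSpace.mk' F y (locSec x₀ v y : E y)) x := by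
  refine ((trivializationAt F E x₀).contMDiffAt_section_iff hx.2).2 ?_
  refine (contMDiffAt_const (c := v)).congr_of_eventuallyEq ?_
  filter_upwards [(isOpen_dom B F E x₀).mem_nhds hx] with y hy
  exact triv_locSec hy v

theorem secCo_eventuallyEq_const {x₀ x : M} (hx : x ∈ dom B F E x₀) {S : ∀ x, E x} {v : F}
    (hS : ∀ᶠ y in 𝓝 x, (trivializationAt F E x₀ ⟨y, S y⟩).2 = v) :
    secCo (B := B) x₀ S =ᶠ[𝓝 (extChartAt 𝓘(ℝ, B) x₀ x)] fun _ => v := by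
  have hxs : x ∈ (extChartAt 𝓘(ℝ, B) x₀).source := by rw [extChartAt_source]; exact hx.1
  have h := (continuousAt_extChartAt_symm' (I := 𝓘(ℝ, B)) hxs)
  rw [ContinuousAt, (extChartAt 𝓘(ℝ, B) x₀).left_inv hxs] at h
  exact h.eventually hS

/-- A vector tangent to `E` is the sum of a vector tangent to a section and a vertical one. -/
theorem exists_decomposition {x : M} {S : ∀ x, E x}
    (hS : ContMDiffAt 𝓘(ℝ, B) (𝓘(ℝ, B).prod 𝓘(ℝ, F)) ∞ (fun y => TotalSpace.mk' F y (S y)) x)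
    (X : TangentSpace (𝓘(ℝ, B).prod 𝓘(ℝ, F)) (⟨x, S x⟩ : TotalSpace F E)) :
    ∃ v : E x, X = mfderiv 𝓘(ℝ, B) (𝓘(ℝ, B).prod 𝓘(ℝ, F)) (fun y => TotalSpace.mk' F y (S y)) x
      (Tτ (⟨⟨x, S x⟩, X⟩ : TE B F E)).2 + vertLift B (⟨x, S x⟩ : TotalSpace F E) v := by
  have hx := mem_dom_self B F E x
  have h1 := tco_section hx hS (Tτ (⟨⟨x, S x⟩, X⟩ : TE B F E)).2
  have h3 := tco_Tτ (x₀ := x) (⟨⟨x, S x⟩, X⟩ : TE B F E) hx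
  refine ⟨locSec x ((tco (𝓘(ℝ, B).prod 𝓘(ℝ, F)) (origin F E x) (⟨⟨x, S x⟩, X⟩ : TE B F E)).2.2 -
    fderiv ℝ (secCo (B := B) (F := F) x S) (extChartAt 𝓘(ℝ, B) x x)
      (tco 𝓘(ℝ, B) x (Tτ (⟨⟨x, S x⟩, X⟩ : TE B F E))).2) x, ?_⟩
  refine tco_snd_inj (q₀ := origin F E x) (mem_source_origin hx) ?_
  refine Eq.trans ?_ (tco_add _ _ _).symm
  have h2 := fun v => congrArg Prod.snd (tco_vertLift (x₀ := x) (⟨x, S x⟩ : TotalSpace F E) v hx)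
  rw [h2, triv_locSec hx]
  have h1' := congrArg Prod.snd h1
  refine Eq.trans ?_ (congrArg (· + _) h1').symm
  refine Prod.ext ?_ ?_
  · refine (congrArg Prod.snd h3).symm.trans ?_
    exact (add_zero _).symm
  · exact (add_sub_cancel _ _).symm

end

variable [∀ x, IsTopologicalAddGroup (E x)] [∀ x, ContinuousSMul ℝ (E x)]

theorem dom_dual (x₀ : M) : dom B (F →L[ℝ] ℝ) (DualFib E) x₀ = dom B F E x₀ := by
  simp only [dom]
  rw [hom_trivializationAt_baseSet]
  simp

/-- The trivialisation of `E*` is the contragredient of that of `E`, so coordinates of covectors and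
vectors pair to the intrinsic value. -/
theorem dual_triv_apply {x₀ x : M} (hx : x ∈ dom B F E x₀) (z : DualFib E x) (v : E x) :
    (trivializationAt (F →L[ℝ] ℝ) (DualFib E) x₀ ⟨x, z⟩).2 (trivializationAt F E x₀ ⟨x, v⟩).2
      = (z v : ℝ) := by
  have h := hom_trivializationAt_apply (σ := RingHom.id ℝ) (F₁ := F) (E₁ := E) (F₂ := ℝ)
    (E₂ := Bundle.Trivial M ℝ) x₀ ⟨x, z⟩
  have h2 : (trivializationAt (F →L[ℝ] ℝ) (DualFib E) x₀ ⟨x, z⟩).2 =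
    ContinuousLinearMap.inCoordinates F E ℝ (Bundle.Trivial M ℝ) x₀ x x₀ x z := congrArg Prod.snd h
  have h3 := ContinuousLinearMap.inCoordinates_eq (F := F) (E := E) (F' := ℝ)
    (E' := Bundle.Trivial M ℝ) (x₀ := x₀) (x := x) (y₀ := x₀) (y := x) (ϕ := z) hx.2 (mem_univ x)
  have h4 := (trivializationAt F E x₀).symm_apply_apply_mk hx.2 v
  rw [h2, h3]
  exact congrArg z h4

section

variable [IsManifold 𝓘(ℝ, B) ∞ M] [ContMDiffVectorBundle ∞ F E 𝓘(ℝ, B)]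

/-- The derivative of the linear function on `E*` defined by a section. -/
theorem mfderiv_ι {x₀ : M} {S : ∀ x, E x} (z : DualTot F E) (hx : z.1 ∈ dom B F E x₀)
    (hS : ContMDiffAt 𝓘(ℝ, B) (𝓘(ℝ, B).prod 𝓘(ℝ, F)) ∞ (fun y => TotalSpace.mk' F y (S y)) z.1)
    (Φ : TangentSpace (𝓘(ℝ, B).prod 𝓘(ℝ, F →L[ℝ] ℝ)) z) :
    (mfderiv (𝓘(ℝ, B).prod 𝓘(ℝ, F →L[ℝ] ℝ)) 𝓘(ℝ, ℝ) (ι S) z Φ : ℝ) =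
      (tco (𝓘(ℝ, B).prod 𝓘(ℝ, F →L[ℝ] ℝ)) (origin (F →L[ℝ] ℝ) (DualFib E) x₀)
        (⟨z, Φ⟩ : TDual B F E)).2.2 (trivializationAt F E x₀ ⟨z.1, S z.1⟩).2 +
      (trivializationAt (F →L[ℝ] ℝ) (DualFib E) x₀ z).2
        (fderiv ℝ (secCo (B := B) x₀ S) (extChartAt 𝓘(ℝ, B) x₀ z.1)
          (tco (𝓘(ℝ, B).prod 𝓘(ℝ, F →L[ℝ] ℝ)) (origin (F →L[ℝ] ℝ) (DualFib E) x₀)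
            (⟨z, Φ⟩ : TDual B F E)).2.1) := by
  have hx' : z.1 ∈ dom B (F →L[ℝ] ℝ) (DualFib E) x₀ := by rwa [dom_dual]
  have hd := ((contDiffAt_secCo hx hS).differentiableAt (by simp)).hasFDerivAt
  have hco := extChartAt_totalSpace (e₀ := origin (F →L[ℝ] ℝ) (DualFib E) x₀) (e := z) hx'
  obtain ⟨a, ha⟩ : ∃ a : B × (F →L[ℝ] ℝ), a = (extChartAt 𝓘(ℝ, B) x₀ z.1,
    (trivializationAt (F →L[ℝ] ℝ) (DualFib E) x₀ z).2) := ⟨_, rfl⟩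
  have hd' : HasFDerivAt (secCo (B := B) (F := F) x₀ S)
    (fderiv ℝ (secCo (B := B) x₀ S) (extChartAt 𝓘(ℝ, B) x₀ z.1)) a.1 := by rw [ha]; exact hd
  have hg : HasFDerivAt (fun p : B × (F →L[ℝ] ℝ) => p.2 (secCo (B := B) x₀ S p.1)) _ a :=
    (hasFDerivAt_snd).clm_apply (HasFDerivAt.comp a (f := Prod.fst) hd' hasFDerivAt_fst)
  have hae : a = extChartAt (𝓘(ℝ, B).prod 𝓘(ℝ, F →L[ℝ] ℝ))
    (origin (F →L[ℝ] ℝ) (DualFib E) x₀) z := ha.trans hco.symm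
  rw [hae] at hg
  have h1 := mfderiv_eq_of_coord (f := ι S) (mem_source_origin hx') ?_ hg Φ
  · refine h1.trans ?_
    rw [← hae]
    have hsec := secCo_apply hx S
    rw [← hsec]
    simp only [add_apply, ContinuousLinearMap.comp_apply,
      ContinuousLinearMap.flip_apply, ContinuousLinearMap.coe_snd', ContinuousLinearMap.coe_fst']
    rw [ha]
    exact add_comm _ _
  · filter_upwards [eventually_mem_dom hx'] with p hp
    have hp' : p.1 ∈ dom B F E x₀ := by rwa [dom_dual] at hp
    have hcp := extChartAt_totalSpace (e₀ := origin (F →L[ℝ] ℝ) (DualFib E) x₀) (e := p) hp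
    refine Eq.trans ?_ (congrArg (fun p : B × (F →L[ℝ] ℝ) =>
      p.2 (secCo (B := B) x₀ S p.1)) hcp).symm
    change p.2 (S p.1) = _
    rw [secCo_apply hp']
    exact (dual_triv_apply hp' p.2 (S p.1)).symm

theorem tco_Tπ {x₀ : M} (Φ : TDual B F E) (hx : Φ.1.1 ∈ dom B F E x₀) :
    tco 𝓘(ℝ, B) x₀ (Tπ Φ) =
      ((tco (𝓘(ℝ, B).prod 𝓘(ℝ, F →L[ℝ] ℝ)) (origin (F →L[ℝ] ℝ) (DualFib E) x₀) Φ).1.1,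
      (tco (𝓘(ℝ, B).prod 𝓘(ℝ, F →L[ℝ] ℝ)) (origin (F →L[ℝ] ℝ) (DualFib E) x₀) Φ).2.1) :=
  tco_Tτ (E := DualFib E) Φ (by rwa [dom_dual])

theorem tco_fst_apply {x₀ : M} (X : TE B F E) (hx : X.1.1 ∈ dom B F E x₀) :
    (tco (𝓘(ℝ, B).prod 𝓘(ℝ, F)) (origin F E x₀) X).1 =
      (extChartAt 𝓘(ℝ, B) x₀ X.1.1, (trivializationAt F E x₀ X.1).2) :=
  extChartAt_totalSpace (e₀ := origin F E x₀) hx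

/-- The pairing of `T E` and `T E*` in coordinates, in terms of a section through the point. -/
theorem pair_coord_eq {x₀ x : M} (hx : x ∈ dom B F E x₀) {S : ∀ x, E x}
    (hS : ContMDiffAt 𝓘(ℝ, B) (𝓘(ℝ, B).prod 𝓘(ℝ, F)) ∞ (fun y => TotalSpace.mk' F y (S y)) x)
    (w : TangentSpace 𝓘(ℝ, B) x) (v : E x)
    (z : DualFib E x) (Φ : TangentSpace (𝓘(ℝ, B).prod 𝓘(ℝ, F →L[ℝ] ℝ)) (⟨x, z⟩ : DualTot F E))
    (hΦ : (⟨x, w⟩ : TangentBundle 𝓘(ℝ, B) M) = Tπ (⟨⟨x, z⟩, Φ⟩ : TDual B F E))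
    (X : TE B F E) (hX : X = (⟨⟨x, S x⟩, mfderiv 𝓘(ℝ, B) (𝓘(ℝ, B).prod 𝓘(ℝ, F))
      (fun y => TotalSpace.mk' F y (S y)) x w + vertLift B (⟨x, S x⟩ : TotalSpace F E) v⟩ : TE B F E))
    (c d : ℝ) (hc : mfderiv (𝓘(ℝ, B).prod 𝓘(ℝ, F →L[ℝ] ℝ)) 𝓘(ℝ, ℝ) (ι S)
      (⟨x, z⟩ : DualTot F E) Φ = c) (hd : z v = d) :
    (tco (𝓘(ℝ, B).prod 𝓘(ℝ, F →L[ℝ] ℝ)) (origin (F →L[ℝ] ℝ) (DualFib E) x₀)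
        (⟨⟨x, z⟩, Φ⟩ : TDual B F E)).2.2 (tco (𝓘(ℝ, B).prod 𝓘(ℝ, F)) (origin F E x₀) X).1.2 +
      (tco (𝓘(ℝ, B).prod 𝓘(ℝ, F →L[ℝ] ℝ)) (origin (F →L[ℝ] ℝ) (DualFib E) x₀)
        (⟨⟨x, z⟩, Φ⟩ : TDual B F E)).1.2 (tco (𝓘(ℝ, B).prod 𝓘(ℝ, F)) (origin F E x₀) X).2.2 =
      c + d := by
  have h1 := hc.symm.trans ( mfderiv_ι (⟨x, z⟩ : DualTot F E) hx hS Φ)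
  have h2 := congrArg Prod.snd (tco_section hx hS w)
  have h3 := congrArg Prod.snd (tco_vertLift (x₀ := x₀) (⟨x, S x⟩ : TotalSpace F E) v hx)
  have h4 := tco_add (I := 𝓘(ℝ, B).prod 𝓘(ℝ, F)) (origin F E x₀)
    (mfderiv 𝓘(ℝ, B) (𝓘(ℝ, B).prod 𝓘(ℝ, F)) (fun y => TotalSpace.mk' F y (S y)) x w)
    (vertLift B (⟨x, S x⟩ : TotalSpace F E) v)
  have h5 := h4.trans (congrArg₂ (· + ·) h2 h3)
  have h6 : (tco (𝓘(ℝ, B).prod 𝓘(ℝ, F)) (origin F E x₀) X).2.2 =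
      fderiv ℝ (secCo (B := B) x₀ S) (extChartAt 𝓘(ℝ, B) x₀ x)
        (tco 𝓘(ℝ, B) x₀ (⟨x, w⟩ : TangentBundle 𝓘(ℝ, B) M)).2 +
        (trivializationAt F E x₀ ⟨x, v⟩).2 := by
    rw [hX]; exact congrArg Prod.snd h5
  have h7 : (tco (𝓘(ℝ, B).prod 𝓘(ℝ, F)) (origin F E x₀) X).1.2 =
      (trivializationAt F E x₀ ⟨x, S x⟩).2 := by
    rw [hX]; exact congrArg Prod.snd (tco_fst_apply _ hx)
  have h8 : (tco (𝓘(ℝ, B).prod 𝓘(ℝ, F →L[ℝ] ℝ)) (origin (F →L[ℝ] ℝ) (DualFib E) x₀)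
        (⟨⟨x, z⟩, Φ⟩ : TDual B F E)).1.2 = (trivializationAt (F →L[ℝ] ℝ) (DualFib E) x₀ ⟨x, z⟩).2 :=
    congrArg Prod.snd (tco_fst_apply (E := DualFib E) (⟨⟨x, z⟩, Φ⟩ : TDual B F E) (by rwa [dom_dual]))
  have h9 := congrArg Prod.snd (tco_Tπ (⟨⟨x, z⟩, Φ⟩ : TDual B F E) hx)
  rw [← hΦ] at h9
  rw [h6, h7, h8, map_add, dual_triv_apply hx, h9, ← add_assoc]
  exact congrArg₂ (· + ·) h1.symm hd

/-- The pairing `⟨X, Φ⟩_{Tτ}` is given by the same expression in all coordinates. -/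
theorem pairT_eq (x₀ : M) (X : TE B F E) (Φ : TDual B F E) (hx : X.1.1 ∈ dom B F E x₀)
    (h : Tτ X = Tπ Φ) : pairT X Φ =
      (tco (𝓘(ℝ, B).prod 𝓘(ℝ, F →L[ℝ] ℝ)) (origin (F →L[ℝ] ℝ) (DualFib E) x₀) Φ).2.2
        (tco (𝓘(ℝ, B).prod 𝓘(ℝ, F)) (origin F E x₀) X).1.2 +
      (tco (𝓘(ℝ, B).prod 𝓘(ℝ, F →L[ℝ] ℝ)) (origin (F →L[ℝ] ℝ) (DualFib E) x₀) Φ).1.2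
        (tco (𝓘(ℝ, B).prod 𝓘(ℝ, F)) (origin F E x₀) X).2.2 := by
  obtain ⟨⟨x, a⟩, X⟩ := X
  obtain ⟨⟨x', z⟩, Φ⟩ := Φ
  obtain rfl : x = x' := congrArg TotalSpace.proj h
  have hxx := mem_dom_self B F E x
  obtain ⟨S, hSx, hS⟩ : ∃ S : ∀ x, E x, S x = a ∧ ContMDiffAt 𝓘(ℝ, B) (𝓘(ℝ, B).prod 𝓘(ℝ, F)) ∞
      (fun y => TotalSpace.mk' F y (S y)) x :=
    ⟨_, locSec_triv hxx a, contMDiffAt_locSec hxx _⟩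
  subst hSx
  obtain ⟨v, hv⟩ := exists_decomposition hS X
  have hX := congrArg (fun X => (⟨⟨x, S x⟩, X⟩ : TE B F E)) hv
  -- The value given by `pair_coord_eq`, namely `dι_S(Φ) + ⟨z, v⟩`, contains no chart. Taking it at
  -- `x₀` and at the centre `x` compares the expression at `x₀` with the definition of `pairT`.
  have key := fun x₁ h₁ => pair_coord_eq (x₀ := x₁) h₁ hS _ v z Φ h _ hX _ _ rfl rfl
  rw [key x₀ hx, ← key x hxx]
  have c1 := tco_center (⟨⟨x, S x⟩, X⟩ : TE B F E)
  have c2 := tco_center (E := DualFib E) (⟨⟨x, z⟩, Φ⟩ : TDual B F E)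
  have c1' : tco (𝓘(ℝ, B).prod 𝓘(ℝ, F)) (origin F E x) (⟨⟨x, S x⟩, X⟩ : TE B F E) = _ := c1
  have c2' : tco (𝓘(ℝ, B).prod 𝓘(ℝ, F →L[ℝ] ℝ)) (origin (F →L[ℝ] ℝ) (DualFib E) x)
    (⟨⟨x, z⟩, Φ⟩ : TDual B F E) = _ := c2
  rw [c1', c2']
  rfl

end

end DualCoordinates

/-! ### Global sections and locality of the bracket -/

section GlobalSections

variable {B : Type*} [NormedAddCommGroup B] [NormedSpace ℝ B]
  {F : Type*} [NormedAddCommGroup F] [NormedSpace ℝ F]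
  {M : Type*} [TopologicalSpace M] [ChartedSpace B M]
  {E : M → Type*} [TopologicalSpace (TotalSpace F E)]
  [∀ x, AddCommGroup (E x)] [∀ x, Module ℝ (E x)] [∀ x, TopologicalSpace (E x)]
  [FiberBundle F E] [VectorBundle ℝ F E]
  [IsManifold 𝓘(ℝ, B) ∞ M] [ContMDiffVectorBundle ∞ F E 𝓘(ℝ, B)]
  [FiniteDimensional ℝ B] [T2Space M]

variable (B) in
theorem exists_bump {x : M} {U : Set M} (hU : U ∈ 𝓝 x) :
    ∃ ψ : M → ℝ, ContMDiff 𝓘(ℝ, B) 𝓘(ℝ, ℝ) ∞ ψ ∧ (∀ᶠ y in 𝓝 x, ψ y = 1) ∧ tsupport ψ ⊆ U := by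
  obtain ⟨f, -, hf⟩ := (SmoothBumpFunction.nhds_basis_tsupport (I := 𝓘(ℝ, B)) x).mem_iff.1 hU
  exact ⟨f, f.contMDiff, f.eventuallyEq_one, hf⟩

/-- The product of a smooth function and a smooth section. -/
def smulSec (f : M → ℝ) (hf : ContMDiff 𝓘(ℝ, B) 𝓘(ℝ, ℝ) ∞ f) (S : Cₛ^∞⟮𝓘(ℝ, B); F, E⟯) :
    Cₛ^∞⟮𝓘(ℝ, B); F, E⟯ :=
  ⟨fun x => f x • S x, hf.smul_section S.contMDiff⟩

theorem sum_apply' {ι : Type*} (s : Finset ι) (f : ι → Cₛ^∞⟮𝓘(ℝ, B); F, E⟯) (x : M) :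
    (∑ i ∈ s, f i) x = ∑ i ∈ s, f i x := by
  have h := map_sum (ContMDiffSection.coeAddHom 𝓘(ℝ, B) F ∞ E) f s
  exact (congrFun h x).trans (Finset.sum_apply _ _ _)

-- The constant local sections are cut off by a bump function, which makes them global. They
-- represent constants only where the bump is `1`, hence a neighbourhood smaller than the coordinate
-- domain. Linearity in the constant is kept so that their brackets form a bilinear map.
variable (B F E) in
theorem exists_frame (x₀ : M) : ∃ (S : F →ₗ[ℝ] Cₛ^∞⟮𝓘(ℝ, B); F, E⟯) (N : Set M), IsOpen N ∧
    x₀ ∈ N ∧ N ⊆ dom B F E x₀ ∧ ∀ v, ∀ y ∈ N, (trivializationAt F E x₀ ⟨y, S v y⟩).2 = v := by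
  obtain ⟨ψ, hψ, hψ1, hψs⟩ :=
    exists_bump B ((isOpen_dom B F E x₀).mem_nhds (mem_dom_self B F E x₀))
  have hsm : ∀ v, ContMDiff 𝓘(ℝ, B) (𝓘(ℝ, B).prod 𝓘(ℝ, F)) ∞
      (fun y => TotalSpace.mk' F y (ψ y • (trivializationAt F E x₀).symmL ℝ y v)) := by
    intro v
    refine ContMDiffOn.smul_section_of_tsupport (u := dom B F E x₀) hψ.contMDiffOn
      (isOpen_dom B F E x₀) hψs (fun x hx => ?_)
    exact (contMDiffAt_locSec hx v).contMDiffWithinAt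
  obtain ⟨N, hN, hNo, hxN⟩ := mem_nhds_iff.1 (Filter.inter_mem hψ1
    ((isOpen_dom B F E x₀).mem_nhds (mem_dom_self B F E x₀)))
  refine ⟨{ toFun := fun v => ⟨_, hsm v⟩, map_add' := ?_, map_smul' := ?_ }, N, hNo, hxN,
    fun y hy => (hN hy).2, ?_⟩
  · intro v w
    ext y
    simp only [ContMDiffSection.coe_add, Pi.add_apply, ContMDiffSection.coeFn_mk, map_add, smul_add]
  · intro c v
    ext y
    simp only [ContMDiffSection.coe_smul, Pi.smul_apply, ContMDiffSection.coeFn_mk, map_smul,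
      RingHom.id_apply, smul_comm c]
  · intro v y hy
    have h1 : ψ y = 1 := (hN hy).1
    change (trivializationAt F E x₀ ⟨y, ψ y • (trivializationAt F E x₀).symmL ℝ y v⟩).2 = v
    rw [h1, one_smul]
    exact triv_locSec (hN hy).2 v

variable (B F E) in
/-- A linear family of global sections of `E`, constant in the coordinates at `x₀` near `x₀`. -/
def frame (x₀ : M) : F →ₗ[ℝ] Cₛ^∞⟮𝓘(ℝ, B); F, E⟯ := (exists_frame B F E x₀).choose

variable (B F E) in
/-- A neighbourhood of `x₀` on which the sections `frame x₀ v` are constant in coordinates. -/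
def fdom (x₀ : M) : Set M := (exists_frame B F E x₀).choose_spec.choose

variable (B F E) in
theorem isOpen_fdom (x₀ : M) : IsOpen (fdom B F E x₀) :=
  (exists_frame B F E x₀).choose_spec.choose_spec.1

variable (B F E) in
theorem mem_fdom_self (x₀ : M) : x₀ ∈ fdom B F E x₀ :=
  (exists_frame B F E x₀).choose_spec.choose_spec.2.1

theorem fdom_subset {x₀ x : M} (hx : x ∈ fdom B F E x₀) : x ∈ dom B F E x₀ :=
  (exists_frame B F E x₀).choose_spec.choose_spec.2.2.1 hx

theorem triv_frame {x₀ x : M} (hx : x ∈ fdom B F E x₀) (v : F) :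
    (trivializationAt F E x₀ ⟨x, frame B F E x₀ v x⟩).2 = v :=
  (exists_frame B F E x₀).choose_spec.choose_spec.2.2.2 v x hx

theorem frame_triv {x₀ x : M} (hx : x ∈ fdom B F E x₀) (v : E x) :
    frame B F E x₀ (trivializationAt F E x₀ ⟨x, v⟩).2 x = v :=
  triv_inj (fdom_subset hx) (triv_frame hx _)

theorem secCo_frame {x₀ x : M} (hx : x ∈ fdom B F E x₀) (v : F) :
    secCo (B := B) (F := F) x₀ (frame B F E x₀ v : ∀ x, E x) =ᶠ[𝓝 (extChartAt 𝓘(ℝ, B) x₀ x)] fun _ => v :=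
  secCo_eventuallyEq_const (fdom_subset hx)
    (Filter.eventually_of_mem ((isOpen_fdom B F E x₀).mem_nhds hx) fun _ hy => triv_frame hy v)

theorem fderiv_secCo_frame {x₀ x : M} (hx : x ∈ fdom B F E x₀) (v : F) :
    fderiv ℝ (secCo (B := B) (F := F) x₀ (frame B F E x₀ v : ∀ x, E x)) (extChartAt 𝓘(ℝ, B) x₀ x) = 0 := by
  rw [(secCo_frame hx v).fderiv_eq, (hasFDerivAt_const v _).fderiv]

namespace SkewAlgebroid

variable (𝔞 : SkewAlgebroid B F E)

/-- Locality from the Leibniz rule: choose a bump `ψ` equal to `1` near `x` and supported where `Y`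
vanishes. Then `Y = (1 - ψ)Y`, and both terms of the Leibniz rule vanish at `x`. -/
theorem bracket_eq_zero {X Y : Cₛ^∞⟮𝓘(ℝ, B); F, E⟯} {x : M} (h : ∀ᶠ y in 𝓝 x, Y y = 0) :
    𝔞.bracket X Y x = 0 := by
  obtain ⟨ψ, hψ, hψ1, hψs⟩ := exists_bump B h
  have hf : ContMDiff 𝓘(ℝ, B) 𝓘(ℝ, ℝ) ∞ (fun y => 1 - ψ y) := contMDiff_const.sub hψ
  have hZ : ∀ y, Y y = (1 - ψ y) • Y y := by
    intro y
    by_cases hy : y ∈ tsupport ψ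
    · have : Y y = 0 := hψs hy
      rw [this, smul_zero]
    · rw [image_eq_zero_of_notMem_tsupport hy, sub_zero, one_smul]
  have h2 := 𝔞.leibniz X Y Y _ hf hZ x
  rw [h2, hψ1.self_of_nhds, h.self_of_nhds, sub_self, zero_smul, smul_zero, add_zero]

theorem bracket_congr {X Y Y' : Cₛ^∞⟮𝓘(ℝ, B); F, E⟯} {x : M} (h : ∀ᶠ y in 𝓝 x, Y y = Y' y) :
    𝔞.bracket X Y x = 𝔞.bracket X Y' x := by
  have h1 : 𝔞.bracket X (Y - Y') x = 0 := 𝔞.bracket_eq_zero (by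
    filter_upwards [h] with y hy
    change Y y - Y' y = 0
    rw [hy, sub_self])
  rw [map_sub] at h1
  exact sub_eq_zero.1 h1

/-- The anchor in coordinates. -/
def anc (x₀ : M) {x : M} (v : E x) : B := (tco 𝓘(ℝ, B) x₀ (𝔞.ρ ⟨x, v⟩)).2

/-- Near `x` the section `Y` is a finite combination of frame sections. By locality and the Leibniz
rule, differentiating its coefficients along `ρ(X)` gives the derivative term, and the rest depends
on `Y` only through its value at `x`. -/
theorem triv_bracket_right [FiniteDimensional ℝ F] {x₀ x : M} (hx : x ∈ fdom B F E x₀)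
    (X Y : Cₛ^∞⟮𝓘(ℝ, B); F, E⟯) :
    (trivializationAt F E x₀ ⟨x, 𝔞.bracket X Y x⟩).2 =
      fderiv ℝ (secCo (B := B) x₀ (Y : ∀ x, E x)) (extChartAt 𝓘(ℝ, B) x₀ x) (𝔞.anc x₀ (X x)) +
      (trivializationAt F E x₀ ⟨x, 𝔞.bracket X
        (frame B F E x₀ (trivializationAt F E x₀ ⟨x, Y x⟩).2) x⟩).2 := by
  have hxd := fdom_subset hx
  set b := Module.finBasis ℝ F
  obtain ⟨ψ, hψ, hψ1, hψs⟩ := exists_bump B ((isOpen_dom B F E x₀).mem_nhds hxd)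
  obtain ⟨c, hc⟩ : ∃ c : Fin (Module.finrank ℝ F) → (F →L[ℝ] ℝ),
      ∀ j v, c j v = b.repr v j := ⟨fun j => LinearMap.toContinuousLinearMap (b.coord j), fun _ _ => rfl⟩
  have hbc : ∀ v, ∑ j, c j v • b j = v := fun v => by simp only [hc]; exact b.sum_repr v
  -- The coefficients are cut off by `ψ` because the Leibniz rule requires globally smooth
  -- functions.
  obtain ⟨f, hf⟩ : ∃ f : Fin (Module.finrank ℝ F) → M → ℝ,
      f = fun j y => ψ y • c j (trivializationAt F E x₀ ⟨y, Y y⟩).2 := ⟨_, rfl⟩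
  have hfs : ∀ j, ContMDiff 𝓘(ℝ, B) 𝓘(ℝ, ℝ) ∞ (f j) := by
    intro j
    refine contMDiff_of_tsupport fun y hy => ?_
    have hy' : y ∈ dom B F E x₀ := hψs (by
      rw [hf] at hy; exact tsupport_smul_subset_left ψ _ hy)
    have h1 := contMDiffAt_triv_section hy' (Y.contMDiff y)
    rw [hf]
    exact (hψ y).smul (((c j).contDiff (n := ∞)).contMDiff.contMDiffAt.comp y h1)
  have hYloc : ∀ᶠ y in 𝓝 x, Y y = (∑ j, smulSec (f j) (hfs j) (frame B F E x₀ (b j))) y := by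
    filter_upwards [hψ1, (isOpen_fdom B F E x₀).mem_nhds hx] with y h1 h2
    have h3 : (∑ j, smulSec (f j) (hfs j) (frame B F E x₀ (b j))) y =
        frame B F E x₀ (∑ j, f j y • b j) y := by
      rw [map_sum, sum_apply', sum_apply']
      refine Finset.sum_congr rfl fun j _ => ?_
      rw [map_smul]; rfl
    rw [h3]
    simp only [hf, h1, one_smul, hbc]
    exact (frame_triv h2 _).symm
  have hsum : ∀ s : Fin (Module.finrank ℝ F) → E x, (trivializationAt F E x₀ ⟨x, ∑ j, s j⟩).2 =
      ∑ j, (trivializationAt F E x₀ ⟨x, s j⟩).2 := fun s =>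
    map_sum ((trivializationAt F E x₀).linear ℝ hxd.2).mk' s Finset.univ
  have hfx : ∀ j, f j x = c j (trivializationAt F E x₀ ⟨x, Y x⟩).2 := fun j => by
    simp only [hf, hψ1.self_of_nhds, one_smul]
  have hdf : ∀ j, dT 𝓘(ℝ, B) (f j) ⟨x, 𝔞.anchor x (X x)⟩ =
      c j (fderiv ℝ (secCo (B := B) x₀ (Y : ∀ x, E x)) (extChartAt 𝓘(ℝ, B) x₀ x)
        (𝔞.anc x₀ (X x))) := by
    intro j
    have hd := ((contDiffAt_secCo hxd (Y.contMDiff x)).differentiableAt (by simp)).hasFDerivAt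
    refine mfderiv_eq_of_coord (f := f j) hxd.1 ?_ ((c j).hasFDerivAt.comp _ hd)
      (𝔞.anchor x (X x))
    filter_upwards [hψ1, (isOpen_fdom B F E x₀).mem_nhds hx] with y h1 h2
    simp only [hf, h1, one_smul, Function.comp_apply, secCo_apply (fdom_subset h2)]
  rw [𝔞.bracket_congr hYloc, map_sum, sum_apply', hsum]
  have hterm : ∀ j, (trivializationAt F E x₀ ⟨x, 𝔞.bracket X
      (smulSec (f j) (hfs j) (frame B F E x₀ (b j))) x⟩).2 =
      c j (trivializationAt F E x₀ ⟨x, Y x⟩).2 •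
        (trivializationAt F E x₀ ⟨x, 𝔞.bracket X (frame B F E x₀ (b j)) x⟩).2 +
      c j (fderiv ℝ (secCo (B := B) x₀ (Y : ∀ x, E x)) (extChartAt 𝓘(ℝ, B) x₀ x)
        (𝔞.anc x₀ (X x))) • b j := by
    intro j
    rw [𝔞.leibniz X (frame B F E x₀ (b j)) _ _ (hfs j) (fun _ => rfl) x, triv_add hxd,
      triv_smul hxd, triv_smul hxd, triv_frame hx, hfx, hdf]
  rw [Finset.sum_congr rfl fun j _ => hterm j, Finset.sum_add_distrib, hbc, add_comm]
  congr 1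
  have h5 : 𝔞.bracket X (frame B F E x₀ (trivializationAt F E x₀ ⟨x, Y x⟩).2) x =
      ∑ j, c j (trivializationAt F E x₀ ⟨x, Y x⟩).2 • 𝔞.bracket X (frame B F E x₀ (b j)) x := by
    conv_lhs => rw [← hbc (trivializationAt F E x₀ ⟨x, Y x⟩).2, map_sum, map_sum, sum_apply']
    refine Finset.sum_congr rfl fun j _ => ?_
    rw [map_smul, map_smul]; rfl
  rw [h5, hsum]
  exact Finset.sum_congr rfl fun j _ => (triv_smul hxd _ _).symm

/-- The one-sided formula is used in each argument, with skew-symmetry in between: `[X, Y] = DY(ρX)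
- DX(ρY) + ĉ(X, Y)`. -/
theorem triv_bracket [FiniteDimensional ℝ F] {x₀ x : M} (hx : x ∈ fdom B F E x₀)
    (X Y : Cₛ^∞⟮𝓘(ℝ, B); F, E⟯) :
    (trivializationAt F E x₀ ⟨x, 𝔞.bracket X Y x⟩).2 =
      fderiv ℝ (secCo (B := B) x₀ (Y : ∀ x, E x)) (extChartAt 𝓘(ℝ, B) x₀ x) (𝔞.anc x₀ (X x)) -
      fderiv ℝ (secCo (B := B) x₀ (X : ∀ x, E x)) (extChartAt 𝓘(ℝ, B) x₀ x) (𝔞.anc x₀ (Y x)) +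
      (trivializationAt F E x₀ ⟨x, 𝔞.bracket
        (frame B F E x₀ (trivializationAt F E x₀ ⟨x, X x⟩).2)
        (frame B F E x₀ (trivializationAt F E x₀ ⟨x, Y x⟩).2) x⟩).2 := by
  have hneg : ∀ v : E x, (trivializationAt F E x₀ ⟨x, -v⟩).2 = -(trivializationAt F E x₀ ⟨x, v⟩).2 :=
    fun v => map_neg ((trivializationAt F E x₀).linear ℝ (fdom_subset hx).2).mk' v
  have hsk : ∀ X Y, (trivializationAt F E x₀ ⟨x, 𝔞.bracket X Y x⟩).2 =
      -(trivializationAt F E x₀ ⟨x, 𝔞.bracket Y X x⟩).2 := by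
    intro X Y
    rw [𝔞.skew X Y, ← hneg]; rfl
  rw [𝔞.triv_bracket_right hx X Y, hsk, 𝔞.triv_bracket_right hx _ X, frame_triv hx, neg_add,
    ← hsk]
  abel

end SkewAlgebroid

end GlobalSections

/-! ### The algebroid in coordinates -/

section LocalAlgebroid

variable {B : Type*} [NormedAddCommGroup B] [NormedSpace ℝ B]
  {F : Type*} [NormedAddCommGroup F] [NormedSpace ℝ F]
  {M : Type*} [TopologicalSpace M] [ChartedSpace B M]
  {E : M → Type*} [TopologicalSpace (TotalSpace F E)]
  [∀ x, AddCommGroup (E x)] [∀ x, Module ℝ (E x)] [∀ x, TopologicalSpace (E x)]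
  [FiberBundle F E] [VectorBundle ℝ F E]
  [IsManifold 𝓘(ℝ, B) ∞ M] [ContMDiffVectorBundle ∞ F E 𝓘(ℝ, B)]
  [FiniteDimensional ℝ B] [T2Space M] [FiniteDimensional ℝ F]

variable (B F E) in
/-- The image of `fdom x₀` in coordinates. -/
def fimg (x₀ : M) : Set B :=
  (extChartAt 𝓘(ℝ, B) x₀).target ∩ (extChartAt 𝓘(ℝ, B) x₀).symm ⁻¹' fdom B F E x₀

variable (B F E) in
theorem isOpen_fimg (x₀ : M) : IsOpen (fimg B F E x₀) :=
  (continuousOn_extChartAt_symm x₀).isOpen_inter_preimage (isOpen_extChartAt_target x₀)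
    (isOpen_fdom B F E x₀)

theorem mem_fimg {x₀ x : M} (hx : x ∈ fdom B F E x₀) :
    extChartAt 𝓘(ℝ, B) x₀ x ∈ fimg B F E x₀ := by
  have hs : x ∈ (extChartAt 𝓘(ℝ, B) x₀).source := by
    rw [extChartAt_source]; exact (fdom_subset hx).1
  refine ⟨(extChartAt 𝓘(ℝ, B) x₀).map_source hs, ?_⟩
  rw [mem_preimage, (extChartAt 𝓘(ℝ, B) x₀).left_inv hs]
  exact hx

/-- A map which is smooth on `fdom x₀` is smooth in coordinates. -/
theorem contDiffOn_fimg {W : Type*} [NormedAddCommGroup W] [NormedSpace ℝ W] {x₀ : M} {f : M → W}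
    (hf : ∀ x ∈ fdom B F E x₀, ContMDiffAt 𝓘(ℝ, B) 𝓘(ℝ, W) ∞ f x) :
    ContDiffOn ℝ ∞ (fun u => f ((extChartAt 𝓘(ℝ, B) x₀).symm u)) (fimg B F E x₀) := by
  intro u hu
  have h2 : ContMDiffAt 𝓘(ℝ, B) 𝓘(ℝ, B) ∞ (extChartAt 𝓘(ℝ, B) x₀).symm u :=
    (contMDiffOn_extChartAt_symm (n := ∞) x₀).contMDiffAt
      ((isOpen_extChartAt_target x₀).mem_nhds hu.1)
  exact ((hf _ hu.2).comp u h2).contDiffAt.contDiffWithinAt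

namespace SkewAlgebroid

variable (𝔞 : SkewAlgebroid B F E)

theorem anc_add (x₀ : M) {x : M} (v w : E x) : 𝔞.anc x₀ (v + w) = 𝔞.anc x₀ v + 𝔞.anc x₀ w :=
  (congrArg (fun a : TangentSpace 𝓘(ℝ, B) x => (tco 𝓘(ℝ, B) x₀ (⟨x, a⟩ : TangentBundle 𝓘(ℝ, B) M)).2)
    (map_add (𝔞.anchor x) v w)).trans (tco_add x₀ _ _)

theorem anc_smul (x₀ : M) {x : M} (c : ℝ) (v : E x) : 𝔞.anc x₀ (c • v) = c • 𝔞.anc x₀ v :=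
  (congrArg (fun a : TangentSpace 𝓘(ℝ, B) x => (tco 𝓘(ℝ, B) x₀ (⟨x, a⟩ : TangentBundle 𝓘(ℝ, B) M)).2)
    (map_smul (𝔞.anchor x) c v)).trans
      (map_smul (mfderiv 𝓘(ℝ, B) 𝓘(ℝ, B) (extChartAt 𝓘(ℝ, B) x₀) x) c (𝔞.anchor x v))

/-- The anchor in coordinates, `u ↦ ρ̂(u)`. -/
def anchorCo (x₀ : M) (u : B) : F →L[ℝ] B :=
  LinearMap.toContinuousLinearMap
    { toFun := fun v => 𝔞.anc x₀ (locSec x₀ v ((extChartAt 𝓘(ℝ, B) x₀).symm u) : E _)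
      map_add' := fun v w => by
        rw [locSec, map_add]; exact 𝔞.anc_add _ _ _
      map_smul' := fun c v => by
        rw [locSec, map_smul]; exact 𝔞.anc_smul _ _ _ }

theorem anchorCo_apply {x₀ x : M} (hx : x ∈ dom B F E x₀) (v : E x) :
    𝔞.anchorCo x₀ (extChartAt 𝓘(ℝ, B) x₀ x) (trivializationAt F E x₀ ⟨x, v⟩).2 = 𝔞.anc x₀ v := by
  change 𝔞.anc x₀ (locSec x₀ _ ((extChartAt 𝓘(ℝ, B) x₀).symm (extChartAt 𝓘(ℝ, B) x₀ x)) : E _) = _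
  rw [(extChartAt 𝓘(ℝ, B) x₀).left_inv (by rw [extChartAt_source]; exact hx.1), locSec_triv hx]

/-- The bracket of sections which are constant in coordinates, `u ↦ ĉ(u)`. -/
def bracketCo (x₀ : M) (u : B) : F →L[ℝ] F →L[ℝ] F :=
  LinearMap.toContinuousBilinearMap
    (LinearMap.mk₂ ℝ (fun v w => (trivializationAt F E x₀).linearMapAt ℝ
        ((extChartAt 𝓘(ℝ, B) x₀).symm u)
        (𝔞.bracket (frame B F E x₀ v) (frame B F E x₀ w) ((extChartAt 𝓘(ℝ, B) x₀).symm u)))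
      (fun v v' w => by
        rw [map_add, map_add]; exact map_add _ _ _)
      (fun c v w => by
        rw [map_smul, map_smul]; exact map_smul _ _ _)
      (fun v w w' => by
        rw [map_add, map_add]; exact map_add _ _ _)
      (fun c v w => by
        rw [map_smul, map_smul]; exact map_smul _ _ _))

theorem bracketCo_apply {x₀ x : M} (hx : x ∈ dom B F E x₀) (v w : F) :
    𝔞.bracketCo x₀ (extChartAt 𝓘(ℝ, B) x₀ x) v w =
      (trivializationAt F E x₀ ⟨x, 𝔞.bracket (frame B F E x₀ v) (frame B F E x₀ w) x⟩).2 := by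
  change (trivializationAt F E x₀).linearMapAt ℝ
    ((extChartAt 𝓘(ℝ, B) x₀).symm (extChartAt 𝓘(ℝ, B) x₀ x)) _ = _
  rw [(extChartAt 𝓘(ℝ, B) x₀).left_inv (by rw [extChartAt_source]; exact hx.1),
    Trivialization.linearMapAt_apply, if_pos hx.2]

theorem contDiffOn_anchorCo (x₀ : M) : ContDiffOn ℝ ∞ (𝔞.anchorCo x₀) (fimg B F E x₀) := by
  rw [contDiffOn_clm_apply]
  intro v
  refine contDiffOn_fimg (f := fun x => 𝔞.anc x₀ (locSec x₀ v x : E x)) fun x hx => ?_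
  have hxd := fdom_subset hx
  have h1 : ContMDiffAt 𝓘(ℝ, B) 𝓘(ℝ, B).tangent ∞
      (fun y => 𝔞.ρ ⟨y, (locSec x₀ v y : E y)⟩) x :=
    (𝔞.smooth_anchor.contMDiffAt).comp x (contMDiffAt_locSec hxd v)
  have h2 : ContMDiffAt 𝓘(ℝ, B).tangent 𝓘(ℝ, B × B) ∞
      (extChartAt 𝓘(ℝ, B).tangent (⟨x₀, 0⟩ : TangentBundle 𝓘(ℝ, B) M))
      (𝔞.ρ ⟨x, (locSec x₀ v x : E x)⟩) :=
    contMDiffAt_extChartAt' ((TangentBundle.mem_chart_source_iff _ _).2 hxd.1)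
  have h3 := (contDiff_snd (𝕜 := ℝ) (E := B) (F := B) (n := ∞)).contMDiff.contMDiffAt.comp x
    (h2.comp x h1)
  refine h3.congr_of_eventuallyEq ?_
  filter_upwards [(isOpen_dom B F E x₀).mem_nhds hxd] with y hy
  exact (congrArg Prod.snd (extChartAt_tangent (X₀ := (⟨x₀, 0⟩ : TangentBundle 𝓘(ℝ, B) M))
    (X := 𝔞.ρ ⟨y, (locSec x₀ v y : E y)⟩) hy.1)).symm

theorem contDiffOn_bracketCo (x₀ : M) : ContDiffOn ℝ ∞ (𝔞.bracketCo x₀) (fimg B F E x₀) := by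
  rw [contDiffOn_clm_apply]
  intro v
  rw [contDiffOn_clm_apply]
  intro w
  refine (contDiffOn_fimg (f := fun x => (trivializationAt F E x₀
    ⟨x, 𝔞.bracket (frame B F E x₀ v) (frame B F E x₀ w) x⟩).2) fun x hx =>
      contMDiffAt_triv_section (fdom_subset hx) (ContMDiffSection.contMDiff _ x)).congr ?_
  intro u hu
  have h := 𝔞.bracketCo_apply (fdom_subset hu.2) v w
  rwa [(extChartAt 𝓘(ℝ, B) x₀).right_inv hu.1] at h

attribute [irreducible] anchorCo bracketCo

end SkewAlgebroid

end LocalAlgebroid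

/-! ### The morphism `ε` and the relation `κ` in coordinates -/

section EpsKappa

variable {B : Type*} [NormedAddCommGroup B] [NormedSpace ℝ B]
  {F : Type*} [NormedAddCommGroup F] [NormedSpace ℝ F]
  {M : Type*} [TopologicalSpace M] [ChartedSpace B M]
  {E : M → Type*} [TopologicalSpace (TotalSpace F E)]
  [∀ x, AddCommGroup (E x)] [∀ x, Module ℝ (E x)] [∀ x, TopologicalSpace (E x)]
  [FiberBundle F E] [VectorBundle ℝ F E]

/-- The coordinates at `x₀` of a vector of `T E`. -/
abbrev cE (x₀ : M) (X : TE B F E) : (B × F) × (B × F) :=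
  tco (𝓘(ℝ, B).prod 𝓘(ℝ, F)) (origin F E x₀) X

variable [∀ x, IsTopologicalAddGroup (E x)] [∀ x, ContinuousSMul ℝ (E x)]

/-- The coordinates at `x₀` of a vector of `T E*`. -/
abbrev cD (x₀ : M) (Φ : TDual B F E) : (B × (F →L[ℝ] ℝ)) × (B × (F →L[ℝ] ℝ)) :=
  tco (𝓘(ℝ, B).prod 𝓘(ℝ, F →L[ℝ] ℝ)) (origin (F →L[ℝ] ℝ) (DualFib E) x₀) Φ

variable [IsManifold 𝓘(ℝ, B) ∞ M] [ContMDiffVectorBundle ∞ F E 𝓘(ℝ, B)]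

theorem exists_covector_coord {x₀ : M} {e : TotalSpace F E} (he : e.1 ∈ dom B F E x₀)
    (A : TangentSpace (𝓘(ℝ, B).prod 𝓘(ℝ, F)) e →L[ℝ] ℝ) :
    ∃ a : B × F →L[ℝ] ℝ, ∀ V, A V = a (cE x₀ (⟨e, V⟩ : TE B F E)).2 := by
  have hinv := isInvertible_mfderiv_extChartAt (I := 𝓘(ℝ, B).prod 𝓘(ℝ, F))
    (x := origin F E x₀) (y := e) (by rw [extChartAt_source]; exact mem_source_origin he)
  obtain ⟨φ, hφ⟩ := hinv
  refine ⟨ContinuousLinearMap.comp A (φ.symm.toContinuousLinearMap), fun V => ?_⟩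
  have h1 : (cE x₀ (⟨e, V⟩ : TE B F E)).2 = φ V := congrArg (fun f => f V) hφ.symm
  rw [h1]
  exact congrArg A (φ.symm_apply_apply V).symm

theorem exists_covector_of_coord {x₀ : M} {e : TotalSpace F E}
    (a : B × F →L[ℝ] ℝ) :
    ∃ A : TangentSpace (𝓘(ℝ, B).prod 𝓘(ℝ, F)) e →L[ℝ] ℝ,
      ∀ V, A V = a (cE x₀ (⟨e, V⟩ : TE B F E)).2 :=
  ⟨ContinuousLinearMap.comp a
    (mfderiv (𝓘(ℝ, B).prod 𝓘(ℝ, F)) 𝓘(ℝ, B × F)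
      (extChartAt (𝓘(ℝ, B).prod 𝓘(ℝ, F)) (origin F E x₀)) e), fun _ => rfl⟩

/-- The restriction of a covector to vertical vectors, in coordinates. -/
theorem dual_triv_covProj {x₀ : M} {e : TotalSpace F E} (he : e.1 ∈ dom B F E x₀)
    {A : TangentSpace (𝓘(ℝ, B).prod 𝓘(ℝ, F)) e →L[ℝ] ℝ} {a : B × F →L[ℝ] ℝ}
    (ha : ∀ V, A V = a (cE x₀ (⟨e, V⟩ : TE B F E)).2) :
    (trivializationAt (F →L[ℝ] ℝ) (DualFib E) x₀ ⟨e.1, covProj e A⟩).2 =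
      a.comp (ContinuousLinearMap.inr ℝ B F) := by
  ext v
  have h1 := dual_triv_apply he (covProj e A) (locSec x₀ v e.1)
  rw [triv_locSec he] at h1
  have h2 := ha (vertLift B e (locSec x₀ v e.1))
  have h3 := congrArg Prod.snd (tco_vertLift (x₀ := x₀) e (locSec x₀ v e.1) he)
  rw [triv_locSec he] at h3
  exact h1.trans (h2.trans (congrArg a h3))

variable [FiniteDimensional ℝ B] [T2Space M] [FiniteDimensional ℝ F]

namespace SkewAlgebroid

variable (𝔞 : SkewAlgebroid B F E)

/-- The morphism `ε` in coordinates: the covector `(p, z)` at `(u, y)` is mapped to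
`(u, z, ρ̂ y, ż)` with `ż = z ∘ ĉ(y, ·) + p ∘ ρ̂`. -/
def epsCo (x₀ : M) (u : B) (y : F) (a : B × F →L[ℝ] ℝ) : B × (F →L[ℝ] ℝ) :=
  (𝔞.anchorCo x₀ u y, (a.comp (ContinuousLinearMap.inr ℝ B F)).comp (𝔞.bracketCo x₀ u y) +
    (a.comp (ContinuousLinearMap.inl ℝ B F)).comp (𝔞.anchorCo x₀ u))

theorem covector_section {x₀ : M} {e : TotalSpace F E} (he : e.1 ∈ dom B F E x₀)
    {A : TangentSpace (𝓘(ℝ, B).prod 𝓘(ℝ, F)) e →L[ℝ] ℝ} {a : B × F →L[ℝ] ℝ}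
    (ha : ∀ V, A V = a (cE x₀ (⟨e, V⟩ : TE B F E)).2)
    (S : Cₛ^∞⟮𝓘(ℝ, B); F, E⟯) (hSe : S e.1 = e.2) (w : TangentSpace 𝓘(ℝ, B) e.1) :
    A (mfderiv 𝓘(ℝ, B) (𝓘(ℝ, B).prod 𝓘(ℝ, F)) (fun y => TotalSpace.mk' F y (S y)) e.1 w) =
      a ((tco 𝓘(ℝ, B) x₀ (⟨e.1, w⟩ : TangentBundle 𝓘(ℝ, B) M)).2,
          fderiv ℝ (secCo (B := B) x₀ (S : ∀ x, E x)) (extChartAt 𝓘(ℝ, B) x₀ e.1)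
            (tco 𝓘(ℝ, B) x₀ (⟨e.1, w⟩ : TangentBundle 𝓘(ℝ, B) M)).2) := by
  obtain ⟨x, y⟩ := e
  obtain rfl : S x = y := hSe
  have h := congrArg Prod.snd (tco_section he (S.contMDiff x) w)
  exact (ha _).trans (congrArg a h)

/-- The bracket contributes `-DX(ρY)` and `TX(ρY)` contributes `+DX(ρY)`. The cancellation shows
that the prescription for `ε` depends on `X` only through its value `e`, and the remainder has the
shape of `dι_Y` on the vector `epsCo`. -/
theorem epsCo_eq {x₀ : M} {e : TotalSpace F E} (he : e.1 ∈ fdom B F E x₀)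
    {A : TangentSpace (𝓘(ℝ, B).prod 𝓘(ℝ, F)) e →L[ℝ] ℝ} {a : B × F →L[ℝ] ℝ}
    (ha : ∀ V, A V = a (cE x₀ (⟨e, V⟩ : TE B F E)).2)
    (X Y : Cₛ^∞⟮𝓘(ℝ, B); F, E⟯) (hX : X e.1 = e.2) :
    (covProj e A (𝔞.bracket X Y e.1) : ℝ) +
        A (mfderiv 𝓘(ℝ, B) (𝓘(ℝ, B).prod 𝓘(ℝ, F)) (fun y => TotalSpace.mk' F y (X y)) e.1
          (𝔞.anchor e.1 (Y e.1))) =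
      (𝔞.epsCo x₀ (extChartAt 𝓘(ℝ, B) x₀ e.1) (trivializationAt F E x₀ e).2 a).2
          (trivializationAt F E x₀ ⟨e.1, Y e.1⟩).2 +
        a (0, fderiv ℝ (secCo (B := B) x₀ (Y : ∀ x, E x)) (extChartAt 𝓘(ℝ, B) x₀ e.1)
          (𝔞.epsCo x₀ (extChartAt 𝓘(ℝ, B) x₀ e.1) (trivializationAt F E x₀ e).2 a).1) := by
  have hed := fdom_subset he
  have h1 := covector_section hed ha X hX (𝔞.anchor e.1 (Y e.1))
  have h2 := dual_triv_apply hed (covProj e A) (𝔞.bracket X Y e.1)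
  rw [dual_triv_covProj hed ha, 𝔞.triv_bracket he] at h2
  have h3 : (trivializationAt F E x₀ ⟨e.1, X e.1⟩).2 = (trivializationAt F E x₀ e).2 := by
    rw [hX]
  have h4 := 𝔞.anchorCo_apply hed (Y e.1)
  have h5 := 𝔞.anchorCo_apply hed (X e.1)
  have h6 := 𝔞.bracketCo_apply hed (trivializationAt F E x₀ e).2
    (trivializationAt F E x₀ ⟨e.1, Y e.1⟩).2
  rw [h3] at h5 h2
  rw [← h6, ← h5, ← h4] at h2
  refine (congrArg₂ (· + ·) h2.symm h1).trans ?_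
  have h7 : (tco 𝓘(ℝ, B) x₀ (⟨e.1, 𝔞.anchor e.1 (Y e.1)⟩ : TangentBundle 𝓘(ℝ, B) M)).2 =
    𝔞.anchorCo x₀ (extChartAt 𝓘(ℝ, B) x₀ e.1) (trivializationAt F E x₀ ⟨e.1, Y e.1⟩).2 := h4.symm
  rw [h7]
  simp only [epsCo, add_apply, ContinuousLinearMap.comp_apply, ContinuousLinearMap.inr_apply,
    ContinuousLinearMap.inl_apply]
  simp only [← map_add, Prod.mk_add_mk]
  congr 1
  refine Prod.ext ?_ ?_ <;> simp only <;> abel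

/-- For the forward direction the conditions are tested on frame sections `Y`: their coordinate
derivatives vanish, which isolates the fibre component of `V`. For the converse, `mfderiv_ι` and
`epsCo_eq` give the same value for arbitrary `X` and `Y`. -/
theorem isEps_iff {x₀ : M} {e : TotalSpace F E} (he : e.1 ∈ fdom B F E x₀)
    {A : TangentSpace (𝓘(ℝ, B).prod 𝓘(ℝ, F)) e →L[ℝ] ℝ} {a : B × F →L[ℝ] ℝ}
    (ha : ∀ V, A V = a (cE x₀ (⟨e, V⟩ : TE B F E)).2)
    (V : TangentSpace (𝓘(ℝ, B).prod 𝓘(ℝ, F →L[ℝ] ℝ)) (⟨e.1, covProj e A⟩ : DualTot F E)) :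
    𝔞.IsEps e A V ↔ (cD x₀ (⟨⟨e.1, covProj e A⟩, V⟩ : TDual B F E)).2 =
      𝔞.epsCo x₀ (extChartAt 𝓘(ℝ, B) x₀ e.1) (trivializationAt F E x₀ e).2 a := by
  have hed := fdom_subset he
  have h0 := tco_Tπ (x₀ := x₀) (⟨⟨e.1, covProj e A⟩, V⟩ : TDual B F E) hed
  have h1 := congrArg Prod.snd h0
  have h3 := fun Y : Cₛ^∞⟮𝓘(ℝ, B); F, E⟯ => mfderiv_ι (S := (Y : ∀ x, E x))
    (⟨e.1, covProj e A⟩ : DualTot F E) hed (Y.contMDiff e.1) V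
  have hz : (trivializationAt (F →L[ℝ] ℝ) (DualFib E) x₀ ⟨e.1, covProj e A⟩).2 =
    a.comp (ContinuousLinearMap.inr ℝ B F) := dual_triv_covProj hed ha
  constructor
  · intro hV
    rw [hV.1] at h1
    have h2 := hV.2 (frame B F E x₀ (trivializationAt F E x₀ e).2)
    refine Prod.ext ?_ ?_
    · exact h1.symm.trans (𝔞.anchorCo_apply hed e.2).symm
    · ext v
      have h4 := (h3 (frame B F E x₀ v)).symm.trans ((h2 _ (frame_triv he e.2)).trans
        (𝔞.epsCo_eq he ha _ _ (frame_triv he e.2)))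
      rw [fderiv_secCo_frame he, triv_frame he] at h4
      have h5 : a ((0 : B), (0 : F)) = 0 := map_zero a
      have h6 := fun (p q r : ℝ) (h : q = 0) (h' : p + 0 = r + q) => show p = r by linarith
      exact h6 _ _ _ h5 (by simpa using! h4)
  · intro hV
    refine ⟨?_, fun X Y hX => ?_⟩
    · refine tco_inj (q₀ := x₀) hed.1 hed.1 (h0.trans ?_)
      refine Prod.ext ?_ ?_
      · have h5 := tco_fst_apply (x₀ := x₀) (E := DualFib E)
          (⟨⟨e.1, covProj e A⟩, V⟩ : TDual B F E) (by rwa [dom_dual])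
        exact (Prod.ext_iff.1 h5).1
      · exact (congrArg Prod.fst hV).trans (𝔞.anchorCo_apply hed e.2)
    · refine (h3 Y).trans (Eq.trans ?_ (𝔞.epsCo_eq he ha X Y hX).symm)
      have hV' : (tco (𝓘(ℝ, B).prod 𝓘(ℝ, F →L[ℝ] ℝ)) (origin (F →L[ℝ] ℝ) (DualFib E) x₀)
        (⟨⟨e.1, covProj e A⟩, V⟩ : TDual B F E)).2 = _ := hV
      rw [hz, hV']
      rfl

theorem existsUnique_isEps (e : TotalSpace F E)
    (A : TangentSpace (𝓘(ℝ, B).prod 𝓘(ℝ, F)) e →L[ℝ] ℝ) : ∃! V, 𝔞.IsEps e A V := by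
  have he := mem_fdom_self B F E e.1
  have hed := fdom_subset he
  have hed' : e.1 ∈ dom B (F →L[ℝ] ℝ) (DualFib E) e.1 := by rwa [dom_dual]
  obtain ⟨a, ha⟩ := exists_covector_coord hed A
  obtain ⟨V, hV⟩ := exists_tco_snd (I := 𝓘(ℝ, B).prod 𝓘(ℝ, F →L[ℝ] ℝ))
    (q := (⟨e.1, covProj e A⟩ : DualTot F E))
    (mem_source_origin (x₀ := e.1) hed')
    (𝔞.epsCo e.1 (extChartAt 𝓘(ℝ, B) e.1 e.1) (trivializationAt F E e.1 e).2 a)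
  refine ⟨V, (𝔞.isEps_iff he ha V).2 hV, fun V' hV' => ?_⟩
  exact tco_snd_inj (q₀ := origin (F →L[ℝ] ℝ) (DualFib E) e.1)
    (mem_source_origin hed') (((𝔞.isEps_iff he ha V').1 hV').trans hV.symm)

/-- The morphism `ε` in coordinates. -/
theorem cD_ε {x₀ : M} {e : TotalSpace F E} (he : e.1 ∈ fdom B F E x₀)
    {A : TangentSpace (𝓘(ℝ, B).prod 𝓘(ℝ, F)) e →L[ℝ] ℝ} {a : B × F →L[ℝ] ℝ}
    (ha : ∀ V, A V = a (cE x₀ (⟨e, V⟩ : TE B F E)).2) :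
    cD x₀ (𝔞.ε e A) = ((extChartAt 𝓘(ℝ, B) x₀ e.1, a.comp (ContinuousLinearMap.inr ℝ B F)),
      𝔞.epsCo x₀ (extChartAt 𝓘(ℝ, B) x₀ e.1) (trivializationAt F E x₀ e).2 a) := by
  have hed := fdom_subset he
  have hed' : e.1 ∈ dom B (F →L[ℝ] ℝ) (DualFib E) x₀ := by rwa [dom_dual]
  refine Prod.ext ?_ ?_
  · refine (tco_fst_apply (E := DualFib E) (𝔞.ε e A) hed').trans ?_
    exact Prod.ext rfl (dual_triv_covProj hed ha)
  · exact (𝔞.isEps_iff he ha _).1 (Classical.epsilon_spec (𝔞.existsUnique_isEps e A).exists)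

theorem Tπ_ε (e : TotalSpace F E) (A : TangentSpace (𝓘(ℝ, B).prod 𝓘(ℝ, F)) e →L[ℝ] ℝ) :
    Tπ (𝔞.ε e A) = 𝔞.ρ e :=
  (Classical.epsilon_spec (𝔞.existsUnique_isEps e A).exists).1

/-- The relation `κ` in coordinates. -/
theorem kappa_iff {x₀ : M} {X Y : TE B F E} (hX : X.1.1 ∈ fdom B F E x₀)
    (hY : Y.1.1 ∈ fdom B F E x₀) :
    𝔞.Kappa X Y ↔ (cE x₀ X).1.1 = (cE x₀ Y).1.1 ∧
      (cE x₀ X).2.1 = 𝔞.anchorCo x₀ (cE x₀ Y).1.1 (cE x₀ Y).1.2 ∧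
      (cE x₀ Y).2.1 = 𝔞.anchorCo x₀ (cE x₀ Y).1.1 (cE x₀ X).1.2 ∧
      (cE x₀ Y).2.2 = (cE x₀ X).2.2 +
        𝔞.bracketCo x₀ (cE x₀ Y).1.1 (cE x₀ Y).1.2 (cE x₀ X).1.2 := by
  have hXd := fdom_subset hX
  have hYd := fdom_subset hY
  have hX1 := tco_fst_apply (x₀ := x₀) X hXd
  have hY1 := tco_fst_apply (x₀ := x₀) Y hYd
  have hbase : 𝔞.ρ Y.1 = Tτ X ↔ (cE x₀ X).1.1 = (cE x₀ Y).1.1 ∧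
      (cE x₀ X).2.1 = 𝔞.anchorCo x₀ (cE x₀ Y).1.1 (cE x₀ Y).1.2 := by
    have h1 := tco_Tτ (x₀ := x₀) X hXd
    have h2 : tco 𝓘(ℝ, B) x₀ (𝔞.ρ Y.1) = ((cE x₀ Y).1.1,
        𝔞.anchorCo x₀ (cE x₀ Y).1.1 (cE x₀ Y).1.2) := by
      have h3 := 𝔞.anchorCo_apply hYd Y.1.2
      rw [hY1]
      exact Prod.ext rfl h3.symm
    constructor
    · intro h
      rw [h, h1] at h2
      have h3 := congrArg Prod.fst h2
      have h4 := congrArg Prod.snd h2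
      exact ⟨h3, h4⟩
    · rintro ⟨h3, h4⟩
      refine tco_inj (q₀ := x₀) hYd.1 hXd.1 (h2.trans (Eq.trans ?_ h1.symm))
      exact Prod.ext h3.symm h4.symm
  unfold Kappa
  rw [hbase, and_assoc]
  refine and_congr_right fun h1 => and_congr_right fun h2 => ?_
  have hT := hbase.2 ⟨h1, h2⟩
  -- Both sides of the duality equation are values of the same covector `a`: on the vector
  -- prescribed by the coordinate equations and on the fibre part of `Y`. Since covectors separate
  -- points, quantifying over `A` turns the equation into equality of these vectors.
  have hp : ∀ (A : TangentSpace (𝓘(ℝ, B).prod 𝓘(ℝ, F)) Y.1 →L[ℝ] ℝ) (a : B × F →L[ℝ] ℝ),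
      (∀ V, A V = a (cE x₀ (⟨Y.1, V⟩ : TE B F E)).2) →
      (pairT X (𝔞.ε Y.1 A) = A Y.2 ↔
        a (𝔞.anchorCo x₀ (cE x₀ Y).1.1 (cE x₀ X).1.2, (cE x₀ X).2.2 +
        𝔞.bracketCo x₀ (cE x₀ Y).1.1 (cE x₀ Y).1.2 (cE x₀ X).1.2) = a (cE x₀ Y).2) := by
    intro A a ha
    have h3 := pairT_eq x₀ X (𝔞.ε Y.1 A) hXd (by rw [𝔞.Tπ_ε, hT])
    have h4 : tco (𝓘(ℝ, B).prod 𝓘(ℝ, F →L[ℝ] ℝ)) (origin (F →L[ℝ] ℝ) (DualFib E) x₀)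
      (𝔞.ε Y.1 A) = _ := 𝔞.cD_ε hY ha
    have h5 := congrArg Prod.fst hY1
    have h6 := congrArg Prod.snd hY1
    dsimp only at h5 h6
    rw [h4, ← h5, ← h6] at h3
    rw [h3, ha Y.2]
    have h7 : (𝔞.epsCo x₀ (cE x₀ Y).1.1 (cE x₀ Y).1.2 a).2 (cE x₀ X).1.2 +
        (a.comp (ContinuousLinearMap.inr ℝ B F)) (cE x₀ X).2.2 =
        a (𝔞.anchorCo x₀ (cE x₀ Y).1.1 (cE x₀ X).1.2, (cE x₀ X).2.2 +
        𝔞.bracketCo x₀ (cE x₀ Y).1.1 (cE x₀ Y).1.2 (cE x₀ X).1.2) := by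
      simp only [epsCo, add_apply, ContinuousLinearMap.comp_apply, ContinuousLinearMap.inr_apply,
        ContinuousLinearMap.inl_apply]
      simp only [← map_add, Prod.mk_add_mk]
      congr 1
      refine Prod.ext ?_ ?_ <;> simp only <;> abel
    exact Eq.congr h7 rfl
  constructor
  · intro h
    have h8 : (𝔞.anchorCo x₀ (cE x₀ Y).1.1 (cE x₀ X).1.2, (cE x₀ X).2.2 +
        𝔞.bracketCo x₀ (cE x₀ Y).1.1 (cE x₀ Y).1.2 (cE x₀ X).1.2) = (cE x₀ Y).2 := by
      rw [SeparatingDual.eq_iff_forall_dual_eq (R := ℝ)]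
      intro a
      obtain ⟨A, hA⟩ := exists_covector_of_coord (x₀ := x₀) (e := Y.1) a
      exact (hp A a hA).1 (h A)
    exact ⟨(congrArg Prod.fst h8).symm, (congrArg Prod.snd h8).symm⟩
  · rintro ⟨h3, h4⟩ A
    obtain ⟨a, ha⟩ := exists_covector_coord hYd A
    refine (hp A a ha).2 (congrArg a ?_)
    exact Prod.ext h3.symm h4.symm

end SkewAlgebroid

end EpsKappa

/-! ### The tangent relation `T κ` in coordinates -/

theorem hasDerivWithinAt_clm_comp_apply {V G Y : Type*} [NormedAddCommGroup V] [NormedSpace ℝ V]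
    [NormedAddCommGroup G] [NormedSpace ℝ G] [NormedAddCommGroup Y] [NormedSpace ℝ Y]
    {c : V → G →L[ℝ] Y} {c' : V →L[ℝ] G →L[ℝ] Y}
    {S : Set ℝ} {s : ℝ} {u : ℝ → V} {y : ℝ → G} {u' : V} {y' : G}
    (hc : HasFDerivAt c c' (u s)) (hu : HasDerivWithinAt u u' S s)
    (hy : HasDerivWithinAt y y' S s) :
    HasDerivWithinAt (fun s => c (u s) (y s)) (c' u' (y s) + c (u s) y') S s :=
  (hc.comp_hasDerivWithinAt s hu).clm_apply hy

theorem hasDerivWithinAt_comp_apply₂ {V G : Type*} [NormedAddCommGroup V] [NormedSpace ℝ V]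
    [NormedAddCommGroup G] [NormedSpace ℝ G] {c : V → G →L[ℝ] G →L[ℝ] G}
    {c' : V →L[ℝ] G →L[ℝ] G →L[ℝ] G} {S : Set ℝ} {s : ℝ} {u : ℝ → V} {y a : ℝ → G} {u' : V}
    {y' a' : G} (hc : HasFDerivAt c c' (u s)) (hu : HasDerivWithinAt u u' S s)
    (hy : HasDerivWithinAt y y' S s) (ha : HasDerivWithinAt a a' S s) :
    HasDerivWithinAt (fun s => c (u s) (y s) (a s))
      (c' u' (y s) (a s) + c (u s) y' (a s) + c (u s) (y s) a') S s := by
  have h3 := (hasDerivWithinAt_clm_comp_apply (Y := G →L[ℝ] G) hc hu hy).clm_apply ha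
  simpa only [add_apply] using h3

section TangentKappa

variable {B : Type*} [NormedAddCommGroup B] [NormedSpace ℝ B]
  {F : Type*} [NormedAddCommGroup F] [NormedSpace ℝ F]
  {M : Type*} [TopologicalSpace M] [ChartedSpace B M]
  {E : M → Type*} [TopologicalSpace (TotalSpace F E)]
  [∀ x, AddCommGroup (E x)] [∀ x, Module ℝ (E x)] [∀ x, TopologicalSpace (E x)]
  [FiberBundle F E] [VectorBundle ℝ F E]
  [∀ x, IsTopologicalAddGroup (E x)] [∀ x, ContinuousSMul ℝ (E x)]
  [IsManifold 𝓘(ℝ, B) ∞ M] [ContMDiffVectorBundle ∞ F E 𝓘(ℝ, B)]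
  [FiniteDimensional ℝ B] [T2Space M] [FiniteDimensional ℝ F]

/-- The coordinates at `x₀` of a vector of `T T E`. -/
abbrev cTE (x₀ : M) (A : TTE B F E) : ((B × F) × (B × F)) × ((B × F) × (B × F)) :=
  tco (𝓘(ℝ, B).prod 𝓘(ℝ, F)).tangent (⟨origin F E x₀, 0⟩ : TE B F E) A

theorem mem_source_TE {x₀ : M} {X : TE B F E} (h : X.1.1 ∈ dom B F E x₀) :
    X ∈ (chartAt (ModelProd (ModelProd B F) (B × F)) (⟨origin F E x₀, 0⟩ : TE B F E)).source :=
  (TangentBundle.mem_chart_source_iff _ _).2 (mem_source_origin h)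

theorem extChartAt_TE {x₀ : M} {X : TE B F E} (h : X.1.1 ∈ dom B F E x₀) :
    extChartAt (𝓘(ℝ, B).prod 𝓘(ℝ, F)).tangent (⟨origin F E x₀, 0⟩ : TE B F E) X = cE x₀ X :=
  extChartAt_tangent (mem_source_origin h)

theorem cTE_fst {x₀ : M} {A : TTE B F E} (h : A.1.1.1 ∈ dom B F E x₀) :
    (cTE x₀ A).1 = cE x₀ A.1 := extChartAt_TE h

theorem continuous_base : Continuous (fun X : TE B F E => X.1.1) :=
  (FiberBundle.continuous_proj F E).comp
    (FiberBundle.continuous_proj (B × F) (TangentSpace (𝓘(ℝ, B).prod 𝓘(ℝ, F))))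

/-- The coordinates of the velocity of a curve in `T E`. -/
theorem cTE_velocity {x₀ : M} {X : ℝ → TE B F E} {s : ℝ}
    (hX : MDifferentiableAt 𝓘(ℝ, ℝ) (𝓘(ℝ, B).prod 𝓘(ℝ, F)).tangent X s)
    (h : (X s).1.1 ∈ dom B F E x₀) :
    cTE x₀ (⟨X s, mfderiv 𝓘(ℝ, ℝ) (𝓘(ℝ, B).prod 𝓘(ℝ, F)).tangent X s (1 : ℝ)⟩ : TTE B F E) =
      (cE x₀ (X s), deriv (fun s => cE x₀ (X s)) s) := by
  refine (tco_velocity hX (mem_source_TE h)).trans ?_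
  refine Prod.ext (extChartAt_TE h) ?_
  refine Filter.EventuallyEq.deriv_eq ?_
  have hc := hX.continuousAt.eventually ((continuous_base (B := B) (F := F) (E := E)).continuousAt.eventually
    ((isOpen_dom B F E x₀).mem_nhds h))
  filter_upwards [hc] with r hr
  exact extChartAt_TE hr

theorem differentiableAt_cE {x₀ : M} {X : ℝ → TE B F E} {s : ℝ}
    (hX : MDifferentiableAt 𝓘(ℝ, ℝ) (𝓘(ℝ, B).prod 𝓘(ℝ, F)).tangent X s)
    (h : (X s).1.1 ∈ dom B F E x₀) : DifferentiableAt ℝ (fun s => cE x₀ (X s)) s := by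
  have h1 := (mdifferentiableAt_extChartAt (I := (𝓘(ℝ, B).prod 𝓘(ℝ, F)).tangent)
    (mem_source_TE h)).comp s hX
  refine (mdifferentiableAt_iff_differentiableAt.1 h1).congr_of_eventuallyEq ?_
  have hc := hX.continuousAt.eventually ((continuous_base (B := B) (F := F) (E := E)).continuousAt.eventually
    ((isOpen_dom B F E x₀).mem_nhds h))
  filter_upwards [hc] with r hr
  exact (extChartAt_TE hr).symm

/-- A smooth curve in coordinates comes from a smooth curve in `T E`. -/
theorem exists_curve_TE {x₀ : M} {X₀ : TE B F E} (h : X₀.1.1 ∈ fdom B F E x₀)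
    {c : ℝ → (B × F) × (B × F)} (hc : ContDiffAt ℝ ∞ c 0) (h0 : c 0 = cE x₀ X₀) :
    ∃ X : ℝ → TE B F E, ContMDiffAt 𝓘(ℝ, ℝ) (𝓘(ℝ, B).prod 𝓘(ℝ, F)).tangent ∞ X 0 ∧
      X 0 = X₀ ∧ ∀ᶠ s in 𝓝 (0 : ℝ), (X s).1.1 ∈ fdom B F E x₀ ∧ cE x₀ (X s) = c s := by
  have hd := fdom_subset h
  set φ := extChartAt (𝓘(ℝ, B).prod 𝓘(ℝ, F)).tangent (⟨origin F E x₀, 0⟩ : TE B F E) with hφ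
  have hs : X₀ ∈ φ.source := by
    rw [hφ, extChartAt_source]; exact mem_source_TE hd
  have h0' : c 0 = φ X₀ := h0.trans (extChartAt_TE hd).symm
  have ht : φ.target ∈ 𝓝 (c 0) := by
    rw [h0']; exact (isOpen_extChartAt_target _).mem_nhds (φ.map_source hs)
  have h1 : ContMDiffAt 𝓘(ℝ, (B × F) × (B × F)) (𝓘(ℝ, B).prod 𝓘(ℝ, F)).tangent ∞ φ.symm (c 0) :=
    (contMDiffOn_extChartAt_symm (n := ∞) _).contMDiffAt ht
  have h2 := h1.comp (0 : ℝ) hc.contMDiffAt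
  have hX0 : φ.symm (c 0) = X₀ := by rw [h0', φ.left_inv hs]
  refine ⟨fun s => φ.symm (c s), h2, hX0, ?_⟩
  have hb := h2.continuousAt.eventually ((continuous_base (B := B) (F := F) (E := E)).continuousAt.eventually
    ((isOpen_fdom B F E x₀).mem_nhds (by
      change (φ.symm (c 0)).1.1 ∈ _
      rw [hX0]; exact h)))
  filter_upwards [hb, hc.continuousAt.eventually ht] with s h3 h4
  exact ⟨h3, (extChartAt_TE (fdom_subset h3)).symm.trans (φ.right_inv h4)⟩

namespace SkewAlgebroid

variable (𝔞 : SkewAlgebroid B F E)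


/-- The derivative of the anchor in coordinates. -/
def dAnchorCo (x₀ : M) (u : B) : B →L[ℝ] F →L[ℝ] B := fderiv ℝ (𝔞.anchorCo x₀) u

/-- The derivative of the bracket in coordinates. -/
def dBracketCo (x₀ : M) (u : B) : B →L[ℝ] F →L[ℝ] F →L[ℝ] F := fderiv ℝ (𝔞.bracketCo x₀) u

theorem hasFDerivAt_anchorCo {x₀ : M} {u : B} (hu : u ∈ fimg B F E x₀) :
    HasFDerivAt (𝔞.anchorCo x₀) (𝔞.dAnchorCo x₀ u) u :=
  (((𝔞.contDiffOn_anchorCo x₀).contDiffAt ((isOpen_fimg B F E x₀).mem_nhds hu)).differentiableAt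
    (by simp)).hasFDerivAt

theorem hasFDerivAt_bracketCo {x₀ : M} {u : B} (hu : u ∈ fimg B F E x₀) :
    HasFDerivAt (𝔞.bracketCo x₀) (𝔞.dBracketCo x₀ u) u :=
  (((𝔞.contDiffOn_bracketCo x₀).contDiffAt ((isOpen_fimg B F E x₀).mem_nhds hu)).differentiableAt
    (by simp)).hasFDerivAt

/-- The velocity of `ρ̂(u) y` along `(u, y)`. -/
def anchorVel (x₀ : M) (u u' : B) (y y' : F) : B :=
  𝔞.dAnchorCo x₀ u u' y + 𝔞.anchorCo x₀ u y'

/-- The velocity of `ĉ(u)(y, a)` along `(u, y, a)`. -/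
def bracketVel (x₀ : M) (u u' : B) (y y' a a' : F) : F :=
  𝔞.dBracketCo x₀ u u' y a + 𝔞.bracketCo x₀ u y' a + 𝔞.bracketCo x₀ u y a'

theorem hasDerivWithinAt_anchorCo {x₀ : M} {S : Set ℝ} {s : ℝ} {u : ℝ → B} {y : ℝ → F} {u' : B}
    {y' : F} (hs : u s ∈ fimg B F E x₀) (hu : HasDerivWithinAt u u' S s)
    (hy : HasDerivWithinAt y y' S s) :
    HasDerivWithinAt (fun s => 𝔞.anchorCo x₀ (u s) (y s)) (𝔞.anchorVel x₀ (u s) u' (y s) y') S s :=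
  ((𝔞.hasFDerivAt_anchorCo hs).comp_hasDerivWithinAt s hu).clm_apply hy

theorem hasDerivWithinAt_bracketCo {x₀ : M} {S : Set ℝ} {s : ℝ} {u : ℝ → B} {y a : ℝ → F} {u' : B}
    {y' a' : F} (hs : u s ∈ fimg B F E x₀) (hu : HasDerivWithinAt u u' S s)
    (hy : HasDerivWithinAt y y' S s) (ha : HasDerivWithinAt a a' S s) :
    HasDerivWithinAt (fun s => 𝔞.bracketCo x₀ (u s) (y s) (a s))
      (𝔞.bracketVel x₀ (u s) u' (y s) y' (a s) a') S s :=
  hasDerivWithinAt_comp_apply₂ (𝔞.hasFDerivAt_bracketCo hs) hu hy ha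

/-- The equations of `T κ` in coordinates. -/
structure TKappaCo (x₀ : M) (U W : ((B × F) × (B × F)) × ((B × F) × (B × F))) : Prop where
  base : U.1.1.1 = W.1.1.1
  anchored : U.1.2.1 = 𝔞.anchorCo x₀ W.1.1.1 W.1.1.2
  anchor : W.1.2.1 = 𝔞.anchorCo x₀ W.1.1.1 U.1.1.2
  vert : W.1.2.2 = U.1.2.2 + 𝔞.bracketCo x₀ W.1.1.1 W.1.1.2 U.1.1.2
  base' : U.2.1.1 = W.2.1.1
  anchored' : U.2.2.1 = 𝔞.anchorVel x₀ W.1.1.1 W.2.1.1 W.1.1.2 W.2.1.2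
  anchor' : W.2.2.1 = 𝔞.anchorVel x₀ W.1.1.1 W.2.1.1 U.1.1.2 U.2.1.2
  vert' : W.2.2.2 = U.2.2.2 + 𝔞.bracketVel x₀ W.1.1.1 W.2.1.1 W.1.1.2 W.2.1.2 U.1.1.2 U.2.1.2

/-- The four coordinate equations of `κ` hold along the two curves near `0`; evaluating and
differentiating them at `0` gives the eight equations. -/
theorem tKappaCo_of_tKappa {x₀ : M} {U W : TTE B F E} (hU : U.1.1.1 ∈ fdom B F E x₀)
    (hW : W.1.1.1 ∈ fdom B F E x₀) (h : 𝔞.TKappa U W) : 𝔞.TKappaCo x₀ (cTE x₀ U) (cTE x₀ W) := by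
  obtain ⟨X, Y, hX, hY, hXY, rfl, rfl⟩ := h
  have hX' := hX.mdifferentiableAt (by simp)
  have hY' := hY.mdifferentiableAt (by simp)
  have dX := (differentiableAt_cE hX' (fdom_subset hU)).hasDerivAt
  have dY := (differentiableAt_cE hY' (fdom_subset hW)).hasDerivAt
  rw [cTE_velocity hX' (fdom_subset hU), cTE_velocity hY' (fdom_subset hW)]
  have hev : ∀ {X : ℝ → TE B F E}, ContinuousAt X 0 → (X 0).1.1 ∈ fdom B F E x₀ →
      ∀ᶠ s in 𝓝 (0 : ℝ), (X s).1.1 ∈ fdom B F E x₀ := fun hc h =>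
    hc.eventually ((continuous_base (B := B) (F := F) (E := E)).continuousAt.eventually
      ((isOpen_fdom B F E x₀).mem_nhds h))
  have hk : ∀ᶠ s in 𝓝 (0 : ℝ), (cE x₀ (X s)).1.1 = (cE x₀ (Y s)).1.1 ∧
      (cE x₀ (X s)).2.1 = 𝔞.anchorCo x₀ (cE x₀ (Y s)).1.1 (cE x₀ (Y s)).1.2 ∧
      (cE x₀ (Y s)).2.1 = 𝔞.anchorCo x₀ (cE x₀ (Y s)).1.1 (cE x₀ (X s)).1.2 ∧
      (cE x₀ (Y s)).2.2 = (cE x₀ (X s)).2.2 +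
        𝔞.bracketCo x₀ (cE x₀ (Y s)).1.1 (cE x₀ (Y s)).1.2 (cE x₀ (X s)).1.2 := by
    filter_upwards [hXY, hev hX.continuousAt hU, hev hY.continuousAt hW] with s h1 h2 h3
    exact (𝔞.kappa_iff h2 h3).1 h1
  have hu : (cE x₀ (Y 0)).1.1 ∈ fimg B F E x₀ := by
    have h1 := congrArg Prod.fst (tco_fst_apply (X := Y 0) (fdom_subset hW))
    exact h1 ▸ mem_fimg hW
  have dXw := dX.hasDerivWithinAt (s := univ)
  have dYw := dY.hasDerivWithinAt (s := univ)
  have k0 := hk.self_of_nhds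
  have e2 := 𝔞.hasDerivWithinAt_anchorCo hu dYw.fst.fst dYw.fst.snd
  have e3 := 𝔞.hasDerivWithinAt_anchorCo hu dYw.fst.fst dXw.fst.snd
  have e4 := (show HasDerivWithinAt _ (deriv (fun s => cE x₀ (X s)) 0).2.2 _ _ from
    dXw.snd.snd).fun_add (𝔞.hasDerivWithinAt_bracketCo hu dYw.fst.fst dYw.fst.snd dXw.fst.snd)
  refine ⟨k0.1, k0.2.1, k0.2.2.1, k0.2.2.2, ?_, ?_, ?_, ?_⟩
  · exact (hasDerivWithinAt_univ.1 dXw.fst.fst).unique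
      ((hasDerivWithinAt_univ.1 dYw.fst.fst).congr_of_eventuallyEq (hk.mono fun s h => h.1))
  · exact (hasDerivWithinAt_univ.1 dXw.snd.fst).unique
      ((hasDerivWithinAt_univ.1 e2).congr_of_eventuallyEq (hk.mono fun s h => h.2.1))
  · exact (hasDerivWithinAt_univ.1 dYw.snd.fst).unique
      ((hasDerivWithinAt_univ.1 e3).congr_of_eventuallyEq (hk.mono fun s h => h.2.2.1))
  · exact (hasDerivWithinAt_univ.1 dYw.snd.snd).unique
      ((hasDerivWithinAt_univ.1 e4).congr_of_eventuallyEq (hk.mono fun s h => h.2.2.2))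

/-- `κ` is parametrised by the free coordinates `u`, `a`, `b` of the first vector and `y` of the
second. Letting these move along straight lines and computing the other coordinates from the
equations of `κ` produces curves in `κ` with the prescribed velocities. -/
theorem tKappa_of_tKappaCo {x₀ : M} {U W : TTE B F E} (hU : U.1.1.1 ∈ fdom B F E x₀)
    (hW : W.1.1.1 ∈ fdom B F E x₀) (h : 𝔞.TKappaCo x₀ (cTE x₀ U) (cTE x₀ W)) : 𝔞.TKappa U W := by
  obtain ⟨⟨⟨⟨u, a⟩, ⟨p, b⟩⟩, ⟨⟨u', a'⟩, ⟨p', b'⟩⟩⟩, hU'⟩ : ∃ c, c = cTE x₀ U := ⟨_, rfl⟩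
  obtain ⟨⟨⟨⟨u₂, y⟩, ⟨q, w⟩⟩, ⟨⟨u₂', y'⟩, ⟨q', w'⟩⟩⟩, hW'⟩ : ∃ c, c = cTE x₀ W := ⟨_, rfl⟩
  rw [← hU', ← hW'] at h
  obtain ⟨h1, h2, h3, h4, h5, h6, h7, h8⟩ := h
  simp only at h1 h2 h3 h4 h5 h6 h7 h8
  -- The eight equations are solved for the dependent coordinates; what stays free is `u`, `a`, `b`,
  -- `y` and their velocities.
  subst h1 h2 h3 h4 h5 h6 h7 h8
  have cU1 := (cTE_fst (fdom_subset hU)).symm.trans (congrArg Prod.fst hU').symm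
  have cW1 := (cTE_fst (fdom_subset hW)).symm.trans (congrArg Prod.fst hW').symm
  have hu : u ∈ fimg B F E x₀ := by
    have h1 := congrArg Prod.fst (tco_fst_apply (X := W.1) (fdom_subset hW))
    have h2 : (cE x₀ W.1).1.1 = u := congrArg (fun c => c.1.1) cW1
    exact (h2.symm.trans h1) ▸ mem_fimg hW
  have hl : ContDiff ℝ ∞ (fun s : ℝ => u + s • u') := by fun_prop
  have hl' : HasDerivWithinAt (fun s : ℝ => u + s • u') u' univ 0 := by
    simpa using! (((hasDerivAt_id (0 : ℝ)).smul_const u').const_add u).hasDerivWithinAt (s := univ)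
  have lF : ∀ g g' : F, ContDiff ℝ ∞ (fun s : ℝ => g + s • g') := fun g g' => by fun_prop
  have lF' : ∀ g g' : F, HasDerivWithinAt (fun s : ℝ => g + s • g') g' univ 0 := fun g g' => by
    simpa using! (((hasDerivAt_id (0 : ℝ)).smul_const g').const_add g).hasDerivWithinAt (s := univ)
  have hu0 : u + (0 : ℝ) • u' ∈ fimg B F E x₀ := by simpa using hu
  have cA : ContDiffAt ℝ ∞ (fun s : ℝ => 𝔞.anchorCo x₀ (u + s • u')) 0 :=
    ((𝔞.contDiffOn_anchorCo x₀).contDiffAt ((isOpen_fimg B F E x₀).mem_nhds hu0)).comp (0 : ℝ)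
      hl.contDiffAt
  have cB : ContDiffAt ℝ ∞ (fun s : ℝ => 𝔞.bracketCo x₀ (u + s • u')) 0 :=
    ((𝔞.contDiffOn_bracketCo x₀).contDiffAt ((isOpen_fimg B F E x₀).mem_nhds hu0)).comp (0 : ℝ)
      hl.contDiffAt
  have dA := fun g g' : F => 𝔞.hasDerivWithinAt_anchorCo hu0 hl' (lF' g g')
  have dB := 𝔞.hasDerivWithinAt_bracketCo hu0 hl' (lF' y y') (lF' a a')
  simp only [zero_smul, add_zero] at dA dB
  obtain ⟨X, hX, hX0, hXs⟩ := exists_curve_TE hU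
    (c := fun s => ((u + s • u', a + s • a'), (𝔞.anchorCo x₀ (u + s • u') (y + s • y'), b + s • b')))
    ((hl.contDiffAt.prodMk (lF a a').contDiffAt).prodMk
      ((cA.clm_apply (lF y y').contDiffAt).prodMk (lF b b').contDiffAt)) (by simpa using cU1.symm)
  obtain ⟨Y, hY, hY0, hYs⟩ := exists_curve_TE hW
    (c := fun s => ((u + s • u', y + s • y'), (𝔞.anchorCo x₀ (u + s • u') (a + s • a'),
      b + s • b' + 𝔞.bracketCo x₀ (u + s • u') (y + s • y') (a + s • a'))))
    ((hl.contDiffAt.prodMk (lF y y').contDiffAt).prodMk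
      ((cA.clm_apply (lF a a').contDiffAt).prodMk ((lF b b').contDiffAt.add
        ((cB.clm_apply (lF y y').contDiffAt).clm_apply (lF a a').contDiffAt))))
    (by simpa using cW1.symm)
  have hX' := hX.mdifferentiableAt (by simp)
  have hY' := hY.mdifferentiableAt (by simp)
  have hX1 : (X 0).1.1 ∈ dom B F E x₀ := by rw [hX0]; exact fdom_subset hU
  have hY1 : (Y 0).1.1 ∈ dom B F E x₀ := by rw [hY0]; exact fdom_subset hW
  refine ⟨X, Y, hX, hY, ?_, ?_, ?_⟩
  · filter_upwards [hXs, hYs] with s h1 h2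
    refine (𝔞.kappa_iff h1.1 h2.1).2 ?_
    rw [h1.2, h2.2]
    exact ⟨rfl, rfl, rfl, rfl⟩
  · refine tco_inj (mem_source_TE (fdom_subset hU)) (mem_source_TE hX1) ?_
    refine hU'.symm.trans (Eq.trans ?_ (cTE_velocity hX' hX1).symm)
    refine Prod.ext ((cTE_fst (fdom_subset hU)).symm.trans (congrArg Prod.fst hU').symm |>.symm.trans
      (by rw [hX0])) ?_
    refine Eq.trans ?_ (Filter.EventuallyEq.deriv_eq (hXs.mono fun s h => h.2)).symm
    exact (hasDerivWithinAt_univ.1 ((hl'.prodMk (lF' a a')).prodMk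
      ((dA y y').prodMk (lF' b b')))).deriv.symm
  · refine tco_inj (mem_source_TE (fdom_subset hW)) (mem_source_TE hY1) ?_
    refine hW'.symm.trans (Eq.trans ?_ (cTE_velocity hY' hY1).symm)
    refine Prod.ext (cW1.symm.trans (by rw [hY0])) ?_
    refine Eq.trans ?_ (Filter.EventuallyEq.deriv_eq (hYs.mono fun s h => h.2)).symm
    exact (hasDerivWithinAt_univ.1 ((hl'.prodMk (lF' y y')).prodMk
      ((dA a a').prodMk ((lF' b b').fun_add dB)))).deriv.symm

end SkewAlgebroid

end TangentKappa

/-! ### Curves in coordinates -/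

section CurveCoordinates

variable {V : Type*} [NormedAddCommGroup V] [NormedSpace ℝ V]
  {H : Type*} [TopologicalSpace H] {I : ModelWithCorners ℝ V H} [I.Boundaryless]
  {Q : Type*} [TopologicalSpace Q] [ChartedSpace H Q] [IsManifold I ∞ Q]
  {S : Set ℝ} {s : ℝ} {q₀ : Q} {n : ℕ∞}

theorem contDiffWithinAt_chart {c : ℝ → Q} (hc : ContMDiffWithinAt 𝓘(ℝ, ℝ) I n c S s)
    (hq : c s ∈ (chartAt H q₀).source) :
    ContDiffWithinAt ℝ n (fun r => extChartAt I q₀ (c r)) S s := by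
  have h1 : ContMDiffAt I 𝓘(ℝ, V) n (extChartAt I q₀) (c s) :=
    (contMDiffAt_extChartAt' (n := ∞) hq).of_le (by exact_mod_cast le_top)
  exact (h1.comp_contMDiffWithinAt s hc).contDiffWithinAt

theorem contMDiffWithinAt_of_chart {c : ℝ → Q}
    (hev : ∀ᶠ r in 𝓝[S] s, c r ∈ (chartAt H q₀).source) (hq : c s ∈ (chartAt H q₀).source)
    (hc : ContDiffWithinAt ℝ n (fun r => extChartAt I q₀ (c r)) S s) :
    ContMDiffWithinAt 𝓘(ℝ, ℝ) I n c S s := by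
  have hq' : c s ∈ (extChartAt I q₀).source := by rwa [extChartAt_source]
  have h1 : ContMDiffAt 𝓘(ℝ, V) I n (extChartAt I q₀).symm (extChartAt I q₀ (c s)) :=
    ((contMDiffOn_extChartAt_symm (n := ∞) q₀).contMDiffAt
      ((isOpen_extChartAt_target q₀).mem_nhds ((extChartAt I q₀).map_source hq'))).of_le
      (by exact_mod_cast le_top)
  refine (h1.comp_contMDiffWithinAt s hc.contMDiffWithinAt).congr_of_eventuallyEq ?_
    ((extChartAt I q₀).left_inv hq').symm
  filter_upwards [hev] with r hr
  exact ((extChartAt I q₀).left_inv (by rwa [extChartAt_source])).symm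

theorem mem_tangent_chart_source {X : TangentBundle I Q} (h : X.1 ∈ (chartAt H q₀).source) :
    X ∈ (chartAt (ModelProd H V) (⟨q₀, 0⟩ : TangentBundle I Q)).source :=
  (TangentBundle.mem_chart_source_iff _ _).2 h

theorem extChartAt_tangent_zero {X : TangentBundle I Q} (h : X.1 ∈ (chartAt H q₀).source) :
    extChartAt I.tangent (⟨q₀, 0⟩ : TangentBundle I Q) X = tco I q₀ X :=
  extChartAt_tangent (by exact h)

theorem eventually_base_mem {X : ℝ → TangentBundle I Q} (hX : ContinuousWithinAt X S s)
    {U : Set Q} (hU : IsOpen U) (h : (X s).1 ∈ U) : ∀ᶠ r in 𝓝[S] s, (X r).1 ∈ U :=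
  hX.eventually ((FiberBundle.continuous_proj V (TangentSpace I (M := Q))).continuousAt.eventually
    (hU.mem_nhds h))

theorem contDiffWithinAt_tco {X : ℝ → TangentBundle I Q}
    (hX : ContMDiffWithinAt 𝓘(ℝ, ℝ) I.tangent n X S s) (hq : (X s).1 ∈ (chartAt H q₀).source) :
    ContDiffWithinAt ℝ n (fun r => tco I q₀ (X r)) S s := by
  refine (contDiffWithinAt_chart hX (mem_tangent_chart_source hq)).congr_of_eventuallyEq ?_
    (extChartAt_tangent_zero hq).symm
  filter_upwards [eventually_base_mem hX.continuousWithinAt (chartAt H q₀).open_source hq] with r hr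
  exact (extChartAt_tangent_zero hr).symm

theorem contMDiffWithinAt_of_tco {X : ℝ → TangentBundle I Q}
    (hev : ∀ᶠ r in 𝓝[S] s, (X r).1 ∈ (chartAt H q₀).source) (hq : (X s).1 ∈ (chartAt H q₀).source)
    (hX : ContDiffWithinAt ℝ n (fun r => tco I q₀ (X r)) S s) :
    ContMDiffWithinAt 𝓘(ℝ, ℝ) I.tangent n X S s := by
  refine contMDiffWithinAt_of_chart (hev.mono fun r hr => mem_tangent_chart_source hr)
    (mem_tangent_chart_source hq) (hX.congr_of_eventuallyEq ?_ (extChartAt_tangent_zero hq))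
  filter_upwards [hev] with r hr
  exact extChartAt_tangent_zero hr

/-- The coordinates of the velocity of a curve in `T Q`. -/
theorem tco_prolong_tangent {t₀ t₁ : ℝ} {X : ℝ → TangentBundle I Q} (ht : t₀ < t₁)
    (hs : s ∈ Icc t₀ t₁)
    (hX : ContMDiffWithinAt 𝓘(ℝ, ℝ) I.tangent 1 X (Icc t₀ t₁) s)
    (hq : (X s).1 ∈ (chartAt H q₀).source) :
    tco I.tangent (⟨q₀, 0⟩ : TangentBundle I Q) (prolong I.tangent t₀ t₁ X s) =
      (tco I q₀ (X s), derivWithin (fun r => tco I q₀ (X r)) (Icc t₀ t₁) s) := by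
  refine (tco_prolong ht hs (hX.mdifferentiableWithinAt one_ne_zero)
    (mem_tangent_chart_source hq)).trans (Prod.ext (extChartAt_tangent_zero hq) ?_)
  refine Filter.EventuallyEq.derivWithin_eq ?_ (extChartAt_tangent_zero hq)
  filter_upwards [eventually_base_mem hX.continuousWithinAt (chartAt H q₀).open_source hq] with r hr
  exact extChartAt_tangent_zero hr

end CurveCoordinates

/-! ### Curves in `E` in coordinates -/

section BundleCurves

variable {B : Type*} [NormedAddCommGroup B] [NormedSpace ℝ B]
  {F : Type*} [NormedAddCommGroup F] [NormedSpace ℝ F]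
  {M : Type*} [TopologicalSpace M] [ChartedSpace B M]
  {E : M → Type*} [TopologicalSpace (TotalSpace F E)]
  [∀ x, AddCommGroup (E x)] [∀ x, Module ℝ (E x)] [∀ x, TopologicalSpace (E x)]
  [FiberBundle F E] [VectorBundle ℝ F E]
  [IsManifold 𝓘(ℝ, B) ∞ M] [ContMDiffVectorBundle ∞ F E 𝓘(ℝ, B)]
  {S : Set ℝ} {s : ℝ} {x₀ : M} {n : ℕ∞} {c : ℝ → TotalSpace F E}

variable (B) in
/-- The coordinates at `x₀` of a point of `E`. -/
def co (x₀ : M) (e : TotalSpace F E) : B × F :=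
  (extChartAt 𝓘(ℝ, B) x₀ e.1, (trivializationAt F E x₀ e).2)

theorem extChartAt_origin {e : TotalSpace F E} (h : e.1 ∈ dom B F E x₀) :
    extChartAt (𝓘(ℝ, B).prod 𝓘(ℝ, F)) (origin F E x₀) e = co B x₀ e :=
  extChartAt_totalSpace h

theorem eventually_mem_of_continuousWithinAt (hc : ContinuousWithinAt c S s) {U : Set M}
    (hU : IsOpen U) (h : (c s).1 ∈ U) : ∀ᶠ r in 𝓝[S] s, (c r).1 ∈ U :=
  hc.eventually ((FiberBundle.continuous_proj F E).continuousAt.eventually (hU.mem_nhds h))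

theorem contDiffWithinAt_co (hc : ContMDiffWithinAt 𝓘(ℝ, ℝ) (𝓘(ℝ, B).prod 𝓘(ℝ, F)) n c S s)
    (h : (c s).1 ∈ dom B F E x₀) : ContDiffWithinAt ℝ n (fun r => co B x₀ (c r)) S s := by
  refine (contDiffWithinAt_chart hc (mem_source_origin h)).congr_of_eventuallyEq ?_
    (extChartAt_origin h).symm
  filter_upwards [eventually_mem_of_continuousWithinAt hc.continuousWithinAt
    (isOpen_dom B F E x₀) h] with r hr
  exact (extChartAt_origin hr).symm

theorem tco_prolong_origin {t₀ t₁ : ℝ} (ht : t₀ < t₁) (hs : s ∈ Icc t₀ t₁)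
    (hc : ContMDiffWithinAt 𝓘(ℝ, ℝ) (𝓘(ℝ, B).prod 𝓘(ℝ, F)) 1 c (Icc t₀ t₁) s)
    (h : (c s).1 ∈ dom B F E x₀) :
    cE x₀ (prolong (𝓘(ℝ, B).prod 𝓘(ℝ, F)) t₀ t₁ c s) =
      (co B x₀ (c s), derivWithin (fun r => co B x₀ (c r)) (Icc t₀ t₁) s) := by
  refine (tco_prolong ht hs (hc.mdifferentiableWithinAt one_ne_zero)
    (mem_source_origin h)).trans (Prod.ext (extChartAt_origin h) ?_)
  refine Filter.EventuallyEq.derivWithin_eq ?_ (extChartAt_origin h)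
  filter_upwards [eventually_mem_of_continuousWithinAt hc.continuousWithinAt
    (isOpen_dom B F E x₀) h] with r hr
  exact extChartAt_origin hr

theorem cE_fst {X : TE B F E} (h : X.1.1 ∈ dom B F E x₀) : (cE x₀ X).1 = co B x₀ X.1 :=
  extChartAt_origin h

end BundleCurves

/-! ### The Legendre map and the Tulczyjew differential in coordinates -/

section MapCoordinates

variable {V : Type*} [NormedAddCommGroup V] [NormedSpace ℝ V]
  {H : Type*} [TopologicalSpace H] {I : ModelWithCorners ℝ V H}
  {Q : Type*} [TopologicalSpace Q] [ChartedSpace H Q] [IsManifold I ∞ Q]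
  {V' : Type*} [NormedAddCommGroup V'] [NormedSpace ℝ V']
  {H' : Type*} [TopologicalSpace H'] {I' : ModelWithCorners ℝ V' H'} [I'.Boundaryless]
  {Q' : Type*} [TopologicalSpace Q'] [ChartedSpace H' Q'] [IsManifold I' ∞ Q']

/-- Continuity of `f` is not assumed: once `f` stays in a chart domain near `q`, it is the inverse
chart after a smooth map. This suits maps given pointwise, such as `Λ_L`, whose values come from a
choice. -/
theorem contMDiffAt_of_coord {f : Q → Q'} {g : V → V'} {q₀ q : Q} {q₀' : Q'}
    (hq : q ∈ (chartAt H q₀).source) (hev : ∀ᶠ p in 𝓝 q, f p ∈ (chartAt H' q₀').source)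
    (hfg : (fun p => extChartAt I' q₀' (f p)) =ᶠ[𝓝 q] fun p => g (extChartAt I q₀ p))
    (hg : ContDiffAt ℝ ∞ g (extChartAt I q₀ q)) : ContMDiffAt I I' ∞ f q := by
  have hq' : f q ∈ (extChartAt I' q₀').source := by rw [extChartAt_source]; exact hev.self_of_nhds
  have h1 : ContMDiffAt 𝓘(ℝ, V') I' ∞ (extChartAt I' q₀').symm (extChartAt I' q₀' (f q)) :=
    (contMDiffOn_extChartAt_symm (n := ∞) q₀').contMDiffAt
      ((isOpen_extChartAt_target q₀').mem_nhds ((extChartAt I' q₀').map_source hq'))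
  have h2 : ContMDiffAt I 𝓘(ℝ, V') ∞ (fun p => g (extChartAt I q₀ p)) q :=
    hg.contMDiffAt.comp q (contMDiffAt_extChartAt' hq)
  refine (h1.comp q (h2.congr_of_eventuallyEq hfg)).congr_of_eventuallyEq ?_
  filter_upwards [hev] with p hp
  exact ((extChartAt I' q₀').left_inv (by rwa [extChartAt_source])).symm

end MapCoordinates

/-! ### Coordinate expressions of `L`, `λ_L`, `Λ_L` and their tangent maps -/

section Lagrangian

variable {B : Type*} [NormedAddCommGroup B] [NormedSpace ℝ B]
  {F : Type*} [NormedAddCommGroup F] [NormedSpace ℝ F]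
  {M : Type*} [TopologicalSpace M] [ChartedSpace B M]
  {E : M → Type*} [TopologicalSpace (TotalSpace F E)]
  [∀ x, AddCommGroup (E x)] [∀ x, Module ℝ (E x)] [∀ x, TopologicalSpace (E x)]
  [FiberBundle F E] [VectorBundle ℝ F E]
  [∀ x, IsTopologicalAddGroup (E x)] [∀ x, ContinuousSMul ℝ (E x)]
  [IsManifold 𝓘(ℝ, B) ∞ M] [ContMDiffVectorBundle ∞ F E 𝓘(ℝ, B)]
  [FiniteDimensional ℝ B] [T2Space M] [FiniteDimensional ℝ F]


/-- The expression of a Lagrangian in coordinates. -/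
def Lco (x₀ : M) (L : TotalSpace F E → ℝ) (p : B × F) : ℝ :=
  L ((extChartAt (𝓘(ℝ, B).prod 𝓘(ℝ, F)) (origin F E x₀)).symm p)

section

variable {L : TotalSpace F E → ℝ} {x₀ : M} {e : TotalSpace F E}

theorem contDiffAt_Lco (hL : ContMDiff (𝓘(ℝ, B).prod 𝓘(ℝ, F)) 𝓘(ℝ, ℝ) ∞ L)
    (he : e.1 ∈ dom B F E x₀) : ContDiffAt ℝ ∞ (Lco x₀ L) (co B x₀ e) := by
  rw [← extChartAt_origin he]
  have he' : e ∈ (extChartAt (𝓘(ℝ, B).prod 𝓘(ℝ, F)) (origin F E x₀)).source := by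
    rw [extChartAt_source]; exact mem_source_origin he
  have h1 : ContMDiffAt 𝓘(ℝ, B × F) (𝓘(ℝ, B).prod 𝓘(ℝ, F)) ∞
      (extChartAt (𝓘(ℝ, B).prod 𝓘(ℝ, F)) (origin F E x₀)).symm
      (extChartAt (𝓘(ℝ, B).prod 𝓘(ℝ, F)) (origin F E x₀) e) :=
    (contMDiffOn_extChartAt_symm (n := ∞) _).contMDiffAt
      ((isOpen_extChartAt_target _).mem_nhds (PartialEquiv.map_source _ he'))
  exact (hL.contMDiffAt.comp _ h1).contDiffAt

theorem eventually_Lco (he : e.1 ∈ dom B F E x₀) :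
    L =ᶠ[𝓝 e] fun p => Lco x₀ L (extChartAt (𝓘(ℝ, B).prod 𝓘(ℝ, F)) (origin F E x₀) p) := by
  filter_upwards [eventually_mem_dom he] with p hp
  exact congrArg L (PartialEquiv.left_inv _
    (by rw [extChartAt_source]; exact mem_source_origin hp)).symm

theorem mfderiv_Lco (hL : ContMDiff (𝓘(ℝ, B).prod 𝓘(ℝ, F)) 𝓘(ℝ, ℝ) ∞ L)
    (he : e.1 ∈ dom B F E x₀) (v : TangentSpace (𝓘(ℝ, B).prod 𝓘(ℝ, F)) e) :
    mfderiv (𝓘(ℝ, B).prod 𝓘(ℝ, F)) 𝓘(ℝ, ℝ) L e v =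
      fderiv ℝ (Lco x₀ L) (co B x₀ e) (cE x₀ (⟨e, v⟩ : TE B F E)).2 := by
  refine mfderiv_eq_of_coord (mem_source_origin he) (eventually_Lco he) ?_ v
  rw [extChartAt_origin he]
  exact ((contDiffAt_Lco hL he).differentiableAt (by simp)).hasFDerivAt

/-- The fibre part of the Legendre map in coordinates. -/
def legCo (x₀ : M) (L : TotalSpace F E → ℝ) (p : B × F) : F →L[ℝ] ℝ :=
  (fderiv ℝ (Lco x₀ L) p).comp (ContinuousLinearMap.inr ℝ B F)

theorem contDiffAt_fderiv_Lco (hL : ContMDiff (𝓘(ℝ, B).prod 𝓘(ℝ, F)) 𝓘(ℝ, ℝ) ∞ L)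
    (he : e.1 ∈ dom B F E x₀) : ContDiffAt ℝ ∞ (fderiv ℝ (Lco x₀ L)) (co B x₀ e) :=
  (contDiffAt_Lco hL he).fderiv_right (by simp)

theorem contDiffAt_legCo (hL : ContMDiff (𝓘(ℝ, B).prod 𝓘(ℝ, F)) 𝓘(ℝ, ℝ) ∞ L)
    (he : e.1 ∈ dom B F E x₀) : ContDiffAt ℝ ∞ (legCo x₀ L) (co B x₀ e) :=
  (contDiffAt_fderiv_Lco hL he).clm_comp contDiffAt_const

end

namespace SkewAlgebroid

variable (𝔞 : SkewAlgebroid B F E) {L : TotalSpace F E → ℝ} {x₀ : M} {e : TotalSpace F E}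

/-- The fibre part of the Tulczyjew differential in coordinates. -/
def forceCo (x₀ : M) (L : TotalSpace F E → ℝ) (p : B × F) : F →L[ℝ] ℝ :=
  (legCo x₀ L p).comp (𝔞.bracketCo x₀ p.1 p.2) +
    ((fderiv ℝ (Lco x₀ L) p).comp (ContinuousLinearMap.inl ℝ B F)).comp (𝔞.anchorCo x₀ p.1)

theorem co_legendre (hL : ContMDiff (𝓘(ℝ, B).prod 𝓘(ℝ, F)) 𝓘(ℝ, ℝ) ∞ L)
    (he : e.1 ∈ dom B F E x₀) :
    co B x₀ (𝔞.legendre L e) = (extChartAt 𝓘(ℝ, B) x₀ e.1, legCo x₀ L (co B x₀ e)) :=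
  Prod.ext rfl (dual_triv_covProj he (mfderiv_Lco hL he))

theorem cD_tulczyjew (hL : ContMDiff (𝓘(ℝ, B).prod 𝓘(ℝ, F)) 𝓘(ℝ, ℝ) ∞ L)
    (he : e.1 ∈ fdom B F E x₀) :
    cD x₀ (𝔞.tulczyjew L e) = ((extChartAt 𝓘(ℝ, B) x₀ e.1, legCo x₀ L (co B x₀ e)),
      (𝔞.anchorCo x₀ (co B x₀ e).1 (co B x₀ e).2, 𝔞.forceCo x₀ L (co B x₀ e))) :=
  𝔞.cD_ε he (mfderiv_Lco hL (fdom_subset he))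

theorem co_fst_mem_fimg (he : e.1 ∈ fdom B F E x₀) : (co B x₀ e).1 ∈ fimg B F E x₀ := mem_fimg he

theorem contDiffAt_anchorCo_fst (he : e.1 ∈ fdom B F E x₀) :
    ContDiffAt ℝ ∞ (fun p : B × F => 𝔞.anchorCo x₀ p.1) (co B x₀ e) :=
  ((𝔞.contDiffOn_anchorCo x₀).contDiffAt
    ((isOpen_fimg B F E x₀).mem_nhds (co_fst_mem_fimg he))).comp (co B x₀ e) contDiffAt_fst

theorem contDiffAt_bracketCo_fst (he : e.1 ∈ fdom B F E x₀) :
    ContDiffAt ℝ ∞ (fun p : B × F => 𝔞.bracketCo x₀ p.1) (co B x₀ e) :=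
  ((𝔞.contDiffOn_bracketCo x₀).contDiffAt
    ((isOpen_fimg B F E x₀).mem_nhds (co_fst_mem_fimg he))).comp (co B x₀ e) contDiffAt_fst

theorem contDiffAt_forceCo (hL : ContMDiff (𝓘(ℝ, B).prod 𝓘(ℝ, F)) 𝓘(ℝ, ℝ) ∞ L)
    (he : e.1 ∈ fdom B F E x₀) : ContDiffAt ℝ ∞ (𝔞.forceCo x₀ L) (co B x₀ e) :=
  ((contDiffAt_legCo hL (fdom_subset he)).clm_comp
    ((𝔞.contDiffAt_bracketCo_fst he).clm_apply contDiffAt_snd)).add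
  (((contDiffAt_fderiv_Lco hL (fdom_subset he)).clm_comp contDiffAt_const).clm_comp
    (𝔞.contDiffAt_anchorCo_fst he))

theorem contMDiffAt_legendre (hL : ContMDiff (𝓘(ℝ, B).prod 𝓘(ℝ, F)) 𝓘(ℝ, ℝ) ∞ L)
    (e : TotalSpace F E) :
    ContMDiffAt (𝓘(ℝ, B).prod 𝓘(ℝ, F)) (𝓘(ℝ, B).prod 𝓘(ℝ, F →L[ℝ] ℝ)) ∞ (𝔞.legendre L) e := by
  have he := mem_dom_self B F E e.1
  refine contMDiffAt_of_coord (q₀ := origin F E e.1)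
    (q₀' := origin (F →L[ℝ] ℝ) (DualFib E) e.1) (g := fun p => (p.1, legCo e.1 L p))
    (mem_source_origin he) ?_ ?_ ?_
  · filter_upwards [eventually_mem_dom he] with p hp
    exact mem_source_origin (by rw [dom_dual]; exact hp)
  · filter_upwards [eventually_mem_dom he] with p hp
    rw [extChartAt_origin hp]
    exact (extChartAt_origin (by rw [dom_dual]; exact hp)).trans (𝔞.co_legendre hL hp)
  · rw [extChartAt_origin he]
    exact contDiffAt_fst.prodMk (contDiffAt_legCo hL he)

/-- `mfderiv` is `0` by default where a map is not differentiable, so smoothness of `Λ_L` has to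
precede any computation of `T Λ_L`. It is visible only in coordinates, where `ε` is a polynomial
expression in smooth functions. -/
theorem contMDiffAt_tulczyjew (hL : ContMDiff (𝓘(ℝ, B).prod 𝓘(ℝ, F)) 𝓘(ℝ, ℝ) ∞ L)
    (e : TotalSpace F E) :
    ContMDiffAt (𝓘(ℝ, B).prod 𝓘(ℝ, F)) (𝓘(ℝ, B).prod 𝓘(ℝ, F →L[ℝ] ℝ)).tangent ∞
      (𝔞.tulczyjew L) e := by
  have he := mem_fdom_self B F E e.1
  have hd := fdom_subset he
  have hev : ∀ᶠ p in 𝓝 e, p.1 ∈ fdom B F E e.1 :=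
    (FiberBundle.continuous_proj F E).continuousAt.eventually ((isOpen_fdom B F E _).mem_nhds he)
  refine contMDiffAt_of_coord (q₀ := origin F E e.1)
    (q₀' := (⟨origin (F →L[ℝ] ℝ) (DualFib E) e.1, 0⟩ : TDual B F E))
    (g := fun p => ((p.1, legCo e.1 L p), (𝔞.anchorCo e.1 p.1 p.2, 𝔞.forceCo e.1 L p)))
    (mem_source_origin hd) ?_ ?_ ?_
  · filter_upwards [hev] with p hp
    exact mem_tangent_chart_source (mem_source_origin (by rw [dom_dual]; exact fdom_subset hp))
  · filter_upwards [hev] with p hp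
    rw [extChartAt_origin (fdom_subset hp)]
    exact (extChartAt_tangent_zero (mem_source_origin (by rw [dom_dual]; exact fdom_subset hp))).trans
      (𝔞.cD_tulczyjew hL hp)
  · rw [extChartAt_origin hd]
    exact (contDiffAt_fst.prodMk (contDiffAt_legCo hL hd)).prodMk
      (((𝔞.contDiffAt_anchorCo_fst he).clm_apply contDiffAt_snd).prodMk (𝔞.contDiffAt_forceCo hL he))

/-- The tangent map of the Legendre map in coordinates. -/
theorem cD_tangentMap_legendre (hL : ContMDiff (𝓘(ℝ, B).prod 𝓘(ℝ, F)) 𝓘(ℝ, ℝ) ∞ L)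
    {X : TE B F E} (hX : X.1.1 ∈ dom B F E x₀) :
    cD x₀ (tangentMap (𝓘(ℝ, B).prod 𝓘(ℝ, F)) (𝓘(ℝ, B).prod 𝓘(ℝ, F →L[ℝ] ℝ)) (𝔞.legendre L) X) =
      (((cE x₀ X).1.1, legCo x₀ L (cE x₀ X).1),
        ((cE x₀ X).2.1, fderiv ℝ (legCo x₀ L) (cE x₀ X).1 (cE x₀ X).2)) := by
  rw [cE_fst hX]
  refine (tco_mfderiv (f := 𝔞.legendre L) (g := fun p => (p.1, legCo x₀ L p))
    (q₀ := origin F E x₀) (q₀' := origin (F →L[ℝ] ℝ) (DualFib E) x₀)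
    (g' := (ContinuousLinearMap.fst ℝ B F).prod (fderiv ℝ (legCo x₀ L) (co B x₀ X.1)))
    (mem_source_origin hX) (mem_source_origin (by rw [dom_dual]; exact hX))
    ((𝔞.contMDiffAt_legendre hL X.1).mdifferentiableAt (by simp)) ?_ ?_ X.2).trans ?_
  · filter_upwards [eventually_mem_dom hX] with p hp
    rw [extChartAt_origin hp]
    exact (extChartAt_origin (by rw [dom_dual]; exact hp)).trans (𝔞.co_legendre hL hp)
  · rw [extChartAt_origin hX]
    exact hasFDerivAt_fst.prodMk
      (((contDiffAt_legCo hL hX).differentiableAt (by simp)).hasFDerivAt)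
  · rw [extChartAt_origin hX]; rfl

/-- The tangent map of the Tulczyjew differential in coordinates. -/
theorem tco_tangentMap_tulczyjew (hL : ContMDiff (𝓘(ℝ, B).prod 𝓘(ℝ, F)) 𝓘(ℝ, ℝ) ∞ L)
    {X : TE B F E} (hX : X.1.1 ∈ fdom B F E x₀) :
    tco (𝓘(ℝ, B).prod 𝓘(ℝ, F →L[ℝ] ℝ)).tangent
        (⟨origin (F →L[ℝ] ℝ) (DualFib E) x₀, 0⟩ : TDual B F E)
        (tangentMap (𝓘(ℝ, B).prod 𝓘(ℝ, F)) (𝓘(ℝ, B).prod 𝓘(ℝ, F →L[ℝ] ℝ)).tangent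
          (𝔞.tulczyjew L) X) =
      ((((cE x₀ X).1.1, legCo x₀ L (cE x₀ X).1),
        (𝔞.anchorCo x₀ (cE x₀ X).1.1 (cE x₀ X).1.2, 𝔞.forceCo x₀ L (cE x₀ X).1)),
      (((cE x₀ X).2.1, fderiv ℝ (legCo x₀ L) (cE x₀ X).1 (cE x₀ X).2),
        (𝔞.anchorVel x₀ (cE x₀ X).1.1 (cE x₀ X).2.1 (cE x₀ X).1.2 (cE x₀ X).2.2,
          fderiv ℝ (𝔞.forceCo x₀ L) (cE x₀ X).1 (cE x₀ X).2))) := by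
  have hd := fdom_subset hX
  have hev : ∀ᶠ p in 𝓝 X.1, p.1 ∈ fdom B F E x₀ :=
    (FiberBundle.continuous_proj F E).continuousAt.eventually ((isOpen_fdom B F E _).mem_nhds hX)
  have h1 := ((contDiffAt_legCo hL hd).differentiableAt (by simp)).hasFDerivAt
  have h2 := ((𝔞.contDiffAt_forceCo hL hX).differentiableAt (by simp)).hasFDerivAt
  have h3 : HasFDerivAt (fun p : B × F => 𝔞.anchorCo x₀ p.1)
      ((𝔞.dAnchorCo x₀ (co B x₀ X.1).1).comp (ContinuousLinearMap.fst ℝ B F)) (co B x₀ X.1) :=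
    (𝔞.hasFDerivAt_anchorCo (co_fst_mem_fimg hX)).comp (co B x₀ X.1) hasFDerivAt_fst
  obtain ⟨A', h4, hA'⟩ : ∃ A' : B × F →L[ℝ] B,
      HasFDerivAt (fun p : B × F => 𝔞.anchorCo x₀ p.1 p.2) A' (co B x₀ X.1) ∧ ∀ w : B × F,
        A' w = 𝔞.anchorVel x₀ (co B x₀ X.1).1 w.1 (co B x₀ X.1).2 w.2 :=
    ⟨_, h3.clm_apply (hasFDerivAt_snd (p := co B x₀ X.1)), fun w => add_comm _ _⟩
  rw [cE_fst hd]
  refine (tco_mfderiv (f := 𝔞.tulczyjew L)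
    (g := fun p => ((p.1, legCo x₀ L p), (𝔞.anchorCo x₀ p.1 p.2, 𝔞.forceCo x₀ L p)))
    (q₀ := origin F E x₀) (q₀' := (⟨origin (F →L[ℝ] ℝ) (DualFib E) x₀, 0⟩ : TDual B F E))
    (g' := ((ContinuousLinearMap.fst ℝ B F).prod (fderiv ℝ (legCo x₀ L) (co B x₀ X.1))).prod
      (A'.prod (fderiv ℝ (𝔞.forceCo x₀ L) (co B x₀ X.1))))
    (mem_source_origin hd)
    (mem_tangent_chart_source (mem_source_origin (by rw [dom_dual]; exact hd)))
    ((𝔞.contMDiffAt_tulczyjew hL X.1).mdifferentiableAt (by simp)) ?_ ?_ X.2).trans ?_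
  · filter_upwards [hev] with p hp
    rw [extChartAt_origin (fdom_subset hp)]
    exact (extChartAt_tangent_zero (mem_source_origin (by rw [dom_dual]; exact fdom_subset hp))).trans
      (𝔞.cD_tulczyjew hL hp)
  · rw [extChartAt_origin hd]
    exact (hasFDerivAt_fst.prodMk h1).prodMk (h4.prodMk h2)
  · rw [extChartAt_origin hd]
    refine Prod.ext rfl (Prod.ext rfl (Prod.ext (hA' _) rfl))

end SkewAlgebroid

end Lagrangian

/-! ### The almost-Lie condition in coordinates -/

section AlmostLie

variable {B : Type*} [NormedAddCommGroup B] [NormedSpace ℝ B]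
  {F : Type*} [NormedAddCommGroup F] [NormedSpace ℝ F]
  {M : Type*} [TopologicalSpace M] [ChartedSpace B M]
  {E : M → Type*} [TopologicalSpace (TotalSpace F E)]
  [∀ x, AddCommGroup (E x)] [∀ x, Module ℝ (E x)] [∀ x, TopologicalSpace (E x)]
  [FiberBundle F E] [VectorBundle ℝ F E]
  [∀ x, IsTopologicalAddGroup (E x)] [∀ x, ContinuousSMul ℝ (E x)]
  [IsManifold 𝓘(ℝ, B) ∞ M] [ContMDiffVectorBundle ∞ F E 𝓘(ℝ, B)]
  [FiniteDimensional ℝ B] [T2Space M] [FiniteDimensional ℝ F]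


/-- The bracket of vector fields on `M` is defined by pulling back along the inverse chart. The
derivatives of the chart and of its inverse are mutually inverse, so the pullback is the coordinate
expression of the field. -/
theorem mpullbackWithin_extChartAt_symm {x₀ : M} (X : ∀ x : M, TangentSpace 𝓘(ℝ, B) x) {u : B}
    (hu : u ∈ (extChartAt 𝓘(ℝ, B) x₀).target) :
    (VectorField.mpullbackWithin 𝓘(ℝ, B) 𝓘(ℝ, B) (extChartAt 𝓘(ℝ, B) x₀).symm X
      (range 𝓘(ℝ, B)) u : B) =
      (tco 𝓘(ℝ, B) x₀ (⟨(extChartAt 𝓘(ℝ, B) x₀).symm u, X ((extChartAt 𝓘(ℝ, B) x₀).symm u)⟩ :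
        TangentBundle 𝓘(ℝ, B) M)).2 := by
  have h1 := mfderivWithin_extChartAt_symm_comp_mfderiv_extChartAt (I := 𝓘(ℝ, B)) (x := x₀) hu
  have h2 := mfderiv_extChartAt_comp_mfderivWithin_extChartAt_symm (I := 𝓘(ℝ, B)) (x := x₀) hu
  refine congrArg (fun φ : TangentSpace 𝓘(ℝ, B) ((extChartAt 𝓘(ℝ, B) x₀).symm u) →L[ℝ] B =>
    φ (X ((extChartAt 𝓘(ℝ, B) x₀).symm u))) ?_
  exact ContinuousLinearMap.inverse_eq h1 h2

theorem mlieBracket_eq_lieBracket {x₀ : M} (X Y : ∀ x : M, TangentSpace 𝓘(ℝ, B) x) :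
    (VectorField.mlieBracket 𝓘(ℝ, B) X Y x₀ : B) =
      VectorField.lieBracket ℝ
        (fun u => (tco 𝓘(ℝ, B) x₀ (⟨(extChartAt 𝓘(ℝ, B) x₀).symm u,
          X ((extChartAt 𝓘(ℝ, B) x₀).symm u)⟩ : TangentBundle 𝓘(ℝ, B) M)).2)
        (fun u => (tco 𝓘(ℝ, B) x₀ (⟨(extChartAt 𝓘(ℝ, B) x₀).symm u,
          Y ((extChartAt 𝓘(ℝ, B) x₀).symm u)⟩ : TangentBundle 𝓘(ℝ, B) M)).2)
        (extChartAt 𝓘(ℝ, B) x₀ x₀) := by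
  -- The bracket computed in the chart is transported back by the inverse of the derivative of the
  -- chart, which is the identity at the centre.
  have h0 : ∀ w : B, ((mfderiv 𝓘(ℝ, B) 𝓘(ℝ, B) (extChartAt 𝓘(ℝ, B) x₀) x₀).inverse w : B) = w := by
    intro w
    have h1 : ∀ φ : B →L[ℝ] B, φ = ContinuousLinearMap.id ℝ B → φ.inverse w = w := by
      rintro φ rfl; rw [ContinuousLinearMap.inverse_id]; rfl
    exact h1 _ mfderiv_extChartAt_self
  have hr : (extChartAt 𝓘(ℝ, B) x₀).symm ⁻¹' univ ∩ range 𝓘(ℝ, B) = univ := by simp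
  have key : ∀ X : (∀ x : M, TangentSpace 𝓘(ℝ, B) x),
      (VectorField.mpullbackWithin 𝓘(ℝ, B) 𝓘(ℝ, B) (extChartAt 𝓘(ℝ, B) x₀).symm X
        (range 𝓘(ℝ, B)) : B → B) =ᶠ[𝓝 (extChartAt 𝓘(ℝ, B) x₀ x₀)]
      fun u => (tco 𝓘(ℝ, B) x₀ (⟨(extChartAt 𝓘(ℝ, B) x₀).symm u,
        X ((extChartAt 𝓘(ℝ, B) x₀).symm u)⟩ : TangentBundle 𝓘(ℝ, B) M)).2 := fun X => by
    filter_upwards [extChartAt_target_mem_nhds (I := 𝓘(ℝ, B)) x₀] with u hu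
    exact mpullbackWithin_extChartAt_symm X hu
  refine (h0 _).trans ?_
  rw [hr]
  have h1 : ∀ X Y : B → B, VectorField.lieBracketWithin ℝ X Y univ = VectorField.lieBracket ℝ X Y :=
    fun X Y => VectorField.lieBracketWithin_univ
  exact (congrFun (h1 _ _) _).trans ((key X).lieBracket_vectorField_eq (key Y))

namespace SkewAlgebroid

variable {𝔞 : SkewAlgebroid B F E}

/-- The almost-Lie condition for two frame sections: their anchors are the fields `u ↦ ρ̂(u)v` and
`u ↦ ρ̂(u)w` in coordinates, and the right-hand side is the Lie bracket of these. The identity at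
the centre of the chart suffices, since it is only used at a single time, in the chart centred
there. -/
theorem anchorCo_bracketCo (h𝔞 : 𝔞.IsAlmostLie) (x₀ : M) (v w : F) :
    𝔞.anchorCo x₀ (extChartAt 𝓘(ℝ, B) x₀ x₀)
        (𝔞.bracketCo x₀ (extChartAt 𝓘(ℝ, B) x₀ x₀) v w) =
      𝔞.dAnchorCo x₀ (extChartAt 𝓘(ℝ, B) x₀ x₀)
          (𝔞.anchorCo x₀ (extChartAt 𝓘(ℝ, B) x₀ x₀) v) w -
        𝔞.dAnchorCo x₀ (extChartAt 𝓘(ℝ, B) x₀ x₀)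
          (𝔞.anchorCo x₀ (extChartAt 𝓘(ℝ, B) x₀ x₀) w) v := by
  have hx := mem_fdom_self B F E x₀
  have hxd := fdom_subset hx
  have h1 := h𝔞 (frame B F E x₀ v) (frame B F E x₀ w) x₀
  have key : ∀ v : F, (fun u => (tco 𝓘(ℝ, B) x₀ (⟨(extChartAt 𝓘(ℝ, B) x₀).symm u,
      𝔞.anchor _ (frame B F E x₀ v ((extChartAt 𝓘(ℝ, B) x₀).symm u))⟩ :
        TangentBundle 𝓘(ℝ, B) M)).2) =ᶠ[𝓝 (extChartAt 𝓘(ℝ, B) x₀ x₀)]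
      fun u => 𝔞.anchorCo x₀ u v := by
    intro v
    filter_upwards [(isOpen_fimg B F E x₀).mem_nhds (mem_fimg hx)] with u hu
    have h2 := 𝔞.anchorCo_apply (fdom_subset hu.2)
      (frame B F E x₀ v ((extChartAt 𝓘(ℝ, B) x₀).symm u))
    rw [triv_frame hu.2, (extChartAt 𝓘(ℝ, B) x₀).right_inv hu.1] at h2
    exact h2.symm
  have hd : ∀ v : F, fderiv ℝ (fun u => 𝔞.anchorCo x₀ u v) (extChartAt 𝓘(ℝ, B) x₀ x₀) =
      (𝔞.dAnchorCo x₀ (extChartAt 𝓘(ℝ, B) x₀ x₀)).flip v := fun v => by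
    have h := (𝔞.hasFDerivAt_anchorCo (mem_fimg hx)).clm_apply
      (hasFDerivAt_const v (extChartAt 𝓘(ℝ, B) x₀ x₀))
    rw [h.fderiv]; ext w; simp
  rw [𝔞.bracketCo_apply hxd, 𝔞.anchorCo_apply hxd]
  have h3 : (𝔞.anc x₀ (𝔞.bracket (frame B F E x₀ v) (frame B F E x₀ w) x₀) : B) =
      VectorField.lieBracket ℝ (fun u => 𝔞.anchorCo x₀ u v) (fun u => 𝔞.anchorCo x₀ u w)
        (extChartAt 𝓘(ℝ, B) x₀ x₀) := by
    have h4 : (𝔞.anc x₀ (𝔞.bracket (frame B F E x₀ v) (frame B F E x₀ w) x₀) : B) = _ :=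
      (tco_snd_self (I := 𝓘(ℝ, B)) (𝔞.anchor x₀ _)).trans h1
    refine h4.trans ((mlieBracket_eq_lieBracket _ _).trans ?_)
    exact (key v).lieBracket_vectorField_eq (key w)
  rw [h3, VectorField.lieBracket, hd, hd]; rfl

end SkewAlgebroid

end AlmostLie

/-! ### The admissible variations in coordinates -/

theorem contDiffWithinAt_derivWithin {G : Type*} [NormedAddCommGroup G] [NormedSpace ℝ G]
    {c : ℝ → G} {t₀ t₁ s : ℝ} (ht : t₀ < t₁) (hs : s ∈ Icc t₀ t₁)
    (hc : ContDiffWithinAt ℝ 2 c (Icc t₀ t₁) s) :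
    ContDiffWithinAt ℝ 1 (derivWithin c (Icc t₀ t₁)) (Icc t₀ t₁) s := by
  have h := hc.fderivWithin_right (m := 1) (uniqueDiffOn_Icc ht) (by exact one_add_one_eq_two.le) hs
  exact h.clm_apply (contDiffWithinAt_const (c := (1 : ℝ)))

section Variations

variable {B : Type*} [NormedAddCommGroup B] [NormedSpace ℝ B]
  {F : Type*} [NormedAddCommGroup F] [NormedSpace ℝ F]
  {M : Type*} [TopologicalSpace M] [ChartedSpace B M]
  {E : M → Type*} [TopologicalSpace (TotalSpace F E)]
  [∀ x, AddCommGroup (E x)] [∀ x, Module ℝ (E x)] [∀ x, TopologicalSpace (E x)]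
  [FiberBundle F E] [VectorBundle ℝ F E]
  [∀ x, IsTopologicalAddGroup (E x)] [∀ x, ContinuousSMul ℝ (E x)]
  [IsManifold 𝓘(ℝ, B) ∞ M] [ContMDiffVectorBundle ∞ F E 𝓘(ℝ, B)]
  [FiniteDimensional ℝ B] [T2Space M] [FiniteDimensional ℝ F]


/-- The expression in coordinates of a section along a curve. -/
def alongCo (x₀ : M) (γ : ℝ → TotalSpace F E) (η : ∀ t, E (γ t).1) (s : ℝ) : F :=
  (trivializationAt F E x₀ ⟨(γ s).1, η s⟩).2

section

variable {t₀ t₁ s : ℝ} {k : ℕ∞} {γ : ℝ → TotalSpace F E} {η : ∀ t, E (γ t).1} {x₀ : M}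

theorem contDiffWithinAt_co_two (hk : 2 ≤ k)
    (hγ : ContMDiffOn 𝓘(ℝ, ℝ) (𝓘(ℝ, B).prod 𝓘(ℝ, F)) k γ (Icc t₀ t₁)) (hs : s ∈ Icc t₀ t₁)
    (hx : (γ s).1 ∈ dom B F E x₀) :
    ContDiffWithinAt ℝ 2 (fun r => co B x₀ (γ r)) (Icc t₀ t₁) s :=
  (contDiffWithinAt_co (hγ s hs) hx).of_le (by
    have : ((2 : ℕ∞) : WithTop ℕ∞) ≤ k := WithTop.coe_le_coe.2 hk
    exact this)

theorem contDiffWithinAt_alongCo (hk : 2 ≤ k)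
    (hη : ContMDiffOn 𝓘(ℝ, ℝ) (𝓘(ℝ, B).prod 𝓘(ℝ, F)) k
      (fun t => (⟨(γ t).1, η t⟩ : TotalSpace F E)) (Icc t₀ t₁)) (hs : s ∈ Icc t₀ t₁)
    (hx : (γ s).1 ∈ dom B F E x₀) :
    ContDiffWithinAt ℝ 2 (alongCo x₀ γ η) (Icc t₀ t₁) s :=
  (contDiff_snd (E := B) (F := F)).contDiffAt.comp_contDiffWithinAt s
    (contDiffWithinAt_co_two hk hη hs hx)

theorem eventually_mem_fdom
    (hγ : ContMDiffOn 𝓘(ℝ, ℝ) (𝓘(ℝ, B).prod 𝓘(ℝ, F)) k γ (Icc t₀ t₁)) (hs : s ∈ Icc t₀ t₁)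
    (hx : (γ s).1 ∈ fdom B F E x₀) :
    ∀ᶠ r in 𝓝[Icc t₀ t₁] s, r ∈ Icc t₀ t₁ ∧ (γ r).1 ∈ fdom B F E x₀ :=
  eventually_mem_nhdsWithin.and
    (eventually_mem_of_continuousWithinAt (hγ s hs).continuousWithinAt (isOpen_fdom B F E x₀) hx)

theorem one_le_of_two_le (hk : 2 ≤ k) : (1 : WithTop ℕ∞) ≤ k := by
  have h : ((1 : ℕ∞) : WithTop ℕ∞) ≤ k := WithTop.coe_le_coe.2 (one_le_two.trans hk)
  exact h

end

namespace SkewAlgebroid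

variable (𝔞 : SkewAlgebroid B F E) {L : TotalSpace F E → ℝ} {t₀ t₁ s : ℝ} {k : ℕ∞}
  {γ : ℝ → TotalSpace F E} {x₀ : M}

/-- The equations satisfied in coordinates by a solution of the Euler-Lagrange equation. -/
theorem hasDerivWithinAt_of_isELSolution (hL : ContMDiff (𝓘(ℝ, B).prod 𝓘(ℝ, F)) 𝓘(ℝ, ℝ) ∞ L)
    (ht : t₀ < t₁) (hk : 2 ≤ k)
    (hγ : ContMDiffOn 𝓘(ℝ, ℝ) (𝓘(ℝ, B).prod 𝓘(ℝ, F)) k γ (Icc t₀ t₁))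
    (hEL : 𝔞.IsELSolution L t₀ t₁ γ) (hs : s ∈ Icc t₀ t₁) (hx : (γ s).1 ∈ fdom B F E x₀) :
    HasDerivWithinAt (fun r => ((co B x₀ (γ r)).1, legCo x₀ L (co B x₀ (γ r))))
      (𝔞.anchorCo x₀ (co B x₀ (γ s)).1 (co B x₀ (γ s)).2, 𝔞.forceCo x₀ L (co B x₀ (γ s)))
      (Icc t₀ t₁) s := by
  have hxd := fdom_subset hx
  have hxd' : (𝔞.legendre L (γ s)).1 ∈ dom B (F →L[ℝ] ℝ) (DualFib E) x₀ := by
    rw [dom_dual]; exact hxd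
  have hγ1 := (hγ s hs).of_le (one_le_of_two_le hk)
  have h1 : ContMDiffWithinAt 𝓘(ℝ, ℝ) (𝓘(ℝ, B).prod 𝓘(ℝ, F →L[ℝ] ℝ)) 1
      (fun r => 𝔞.legendre L (γ r)) (Icc t₀ t₁) s :=
    ((𝔞.contMDiffAt_legendre hL (γ s)).of_le (by exact_mod_cast le_top)).comp_contMDiffWithinAt s hγ1
  have h2 := tco_prolong_origin (x₀ := x₀) ht hs h1 hxd'
  have h3 := congrArg (cD x₀) (hEL s hs)
  have h4 := congrArg Prod.snd (h2.symm.trans (h3.trans (𝔞.cD_tulczyjew hL hx)))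
  have h5 : ∀ᶠ r in 𝓝[Icc t₀ t₁] s, ((co B x₀ (γ r)).1, legCo x₀ L (co B x₀ (γ r))) =
      co B x₀ (𝔞.legendre L (γ r)) := by
    filter_upwards [eventually_mem_fdom hγ hs hx] with r hr
    exact (𝔞.co_legendre hL (fdom_subset hr.2)).symm
  have h6 := (((contDiffWithinAt_co (n := 1) h1 hxd').differentiableWithinAt
    (by simp)).hasDerivWithinAt)
  change derivWithin (fun r => co B x₀ (𝔞.legendre L (γ r))) (Icc t₀ t₁) s = _ at h4
  rw [h4] at h6
  exact h6.congr_of_eventuallyEq h5 (𝔞.co_legendre hL hxd).symm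

/-- The fibre part of the variation `δ_η γ` in coordinates. -/
def varCo (x₀ : M) (t₀ t₁ : ℝ) (γ : ℝ → TotalSpace F E) (η : ∀ t, E (γ t).1) (s : ℝ) : B × F :=
  (𝔞.anchorCo x₀ (co B x₀ (γ s)).1 (alongCo x₀ γ η s),
    derivWithin (alongCo x₀ γ η) (Icc t₀ t₁) s +
      𝔞.bracketCo x₀ (co B x₀ (γ s)).1 (co B x₀ (γ s)).2 (alongCo x₀ γ η s))

variable {𝔞} {η : ∀ t, E (γ t).1}

/-- Of the equations of `κ`, one constrains the data and not `V`: the base velocity must be the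
anchor of `γ(s)`. This is `hadm`, which the base part of the Euler-Lagrange equation supplies. The
remaining equations read off `V`. -/
theorem kappa_prolong_iff (ht : t₀ < t₁) (hk : 2 ≤ k)
    (hη : ContMDiffOn 𝓘(ℝ, ℝ) (𝓘(ℝ, B).prod 𝓘(ℝ, F)) k
      (fun t => (⟨(γ t).1, η t⟩ : TotalSpace F E)) (Icc t₀ t₁)) (hs : s ∈ Icc t₀ t₁)
    (hx : (γ s).1 ∈ fdom B F E x₀)
    (hadm : HasDerivWithinAt (fun r => (co B x₀ (γ r)).1)
      (𝔞.anchorCo x₀ (co B x₀ (γ s)).1 (co B x₀ (γ s)).2) (Icc t₀ t₁) s)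
    (V : TangentSpace (𝓘(ℝ, B).prod 𝓘(ℝ, F)) (γ s)) :
    𝔞.Kappa (prolong (𝓘(ℝ, B).prod 𝓘(ℝ, F)) t₀ t₁
      (fun s => (⟨(γ s).1, η s⟩ : TotalSpace F E)) s) ⟨γ s, V⟩ ↔
    (cE x₀ (⟨γ s, V⟩ : TE B F E)).2 = 𝔞.varCo x₀ t₀ t₁ γ η s := by
  have hxd := fdom_subset hx
  have hη1 := (hη s hs).of_le (one_le_of_two_le hk)
  have h1 := tco_prolong_origin (x₀ := x₀) ht hs hη1 hxd
  have h2 : HasDerivWithinAt (fun r => co B x₀ (⟨(γ r).1, η r⟩ : TotalSpace F E))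
      (𝔞.anchorCo x₀ (co B x₀ (γ s)).1 (co B x₀ (γ s)).2,
        derivWithin (alongCo x₀ γ η) (Icc t₀ t₁) s) (Icc t₀ t₁) s :=
    hadm.prodMk (((contDiffWithinAt_alongCo hk hη hs hxd).differentiableWithinAt
      two_ne_zero).hasDerivWithinAt)
  have h3 := h1.trans (congrArg (Prod.mk _) (h2.derivWithin (uniqueDiffOn_Icc ht s hs)))
  refine (𝔞.kappa_iff (x₀ := x₀) hx hx).trans ?_
  have h4 : (cE x₀ (⟨γ s, V⟩ : TE B F E)).1 = co B x₀ (γ s) := cE_fst hxd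
  rw [h3, h4]
  constructor
  · rintro ⟨-, -, h5, h6⟩
    exact Prod.ext h5 h6
  · intro h5
    exact ⟨rfl, rfl, (Prod.ext_iff.1 h5).1, (Prod.ext_iff.1 h5).2⟩

theorem existsUnique_kappa_prolong (hL : ContMDiff (𝓘(ℝ, B).prod 𝓘(ℝ, F)) 𝓘(ℝ, ℝ) ∞ L)
    (ht : t₀ < t₁) (hk : 2 ≤ k)
    (hγ : ContMDiffOn 𝓘(ℝ, ℝ) (𝓘(ℝ, B).prod 𝓘(ℝ, F)) k γ (Icc t₀ t₁))
    (hEL : 𝔞.IsELSolution L t₀ t₁ γ)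
    (hη : ContMDiffOn 𝓘(ℝ, ℝ) (𝓘(ℝ, B).prod 𝓘(ℝ, F)) k
      (fun t => (⟨(γ t).1, η t⟩ : TotalSpace F E)) (Icc t₀ t₁)) (hs : s ∈ Icc t₀ t₁) :
    ∃! V : TangentSpace (𝓘(ℝ, B).prod 𝓘(ℝ, F)) (γ s),
      𝔞.Kappa (prolong (𝓘(ℝ, B).prod 𝓘(ℝ, F)) t₀ t₁
        (fun s => (⟨(γ s).1, η s⟩ : TotalSpace F E)) s) ⟨γ s, V⟩ := by
  have hx := mem_fdom_self B F E (γ s).1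
  have hsrc := mem_source_origin (fdom_subset hx)
  have key := kappa_prolong_iff (𝔞 := 𝔞) ht hk hη hs hx
    (𝔞.hasDerivWithinAt_of_isELSolution hL ht hk hγ hEL hs hx).fst
  obtain ⟨V, hV⟩ := exists_tco_snd (I := 𝓘(ℝ, B).prod 𝓘(ℝ, F)) hsrc
    (𝔞.varCo (γ s).1 t₀ t₁ γ η s)
  refine ⟨V, (key V).2 hV, fun V' hV' => tco_snd_inj hsrc (((key V').1 hV').trans hV.symm)⟩

theorem cE_var (hL : ContMDiff (𝓘(ℝ, B).prod 𝓘(ℝ, F)) 𝓘(ℝ, ℝ) ∞ L)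
    (ht : t₀ < t₁) (hk : 2 ≤ k)
    (hγ : ContMDiffOn 𝓘(ℝ, ℝ) (𝓘(ℝ, B).prod 𝓘(ℝ, F)) k γ (Icc t₀ t₁))
    (hEL : 𝔞.IsELSolution L t₀ t₁ γ)
    (hη : ContMDiffOn 𝓘(ℝ, ℝ) (𝓘(ℝ, B).prod 𝓘(ℝ, F)) k
      (fun t => (⟨(γ t).1, η t⟩ : TotalSpace F E)) (Icc t₀ t₁)) (hs : s ∈ Icc t₀ t₁)
    (hx : (γ s).1 ∈ fdom B F E x₀) :
    cE x₀ (𝔞.var t₀ t₁ γ η s) = (co B x₀ (γ s), 𝔞.varCo x₀ t₀ t₁ γ η s) :=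
  Prod.ext (cE_fst (fdom_subset hx)) ((kappa_prolong_iff ht hk hη hs hx
    (𝔞.hasDerivWithinAt_of_isELSolution hL ht hk hγ hEL hs hx).fst _).1
    (Classical.epsilon_spec (existsUnique_kappa_prolong hL ht hk hγ hEL hη hs).exists))

/-- The variation contains the derivative of `η`, which costs one order. With `k ≥ 2` it is still
`C¹`, as needed to differentiate the varied momentum in time. -/
theorem contDiffWithinAt_varCo (ht : t₀ < t₁) (hk : 2 ≤ k)
    (hγ : ContMDiffOn 𝓘(ℝ, ℝ) (𝓘(ℝ, B).prod 𝓘(ℝ, F)) k γ (Icc t₀ t₁))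
    (hη : ContMDiffOn 𝓘(ℝ, ℝ) (𝓘(ℝ, B).prod 𝓘(ℝ, F)) k
      (fun t => (⟨(γ t).1, η t⟩ : TotalSpace F E)) (Icc t₀ t₁)) (hs : s ∈ Icc t₀ t₁)
    (hx : (γ s).1 ∈ fdom B F E x₀) :
    ContDiffWithinAt ℝ 1 (𝔞.varCo x₀ t₀ t₁ γ η) (Icc t₀ t₁) s := by
  have hxd := fdom_subset hx
  have h1 := contDiffWithinAt_co_two hk hγ hs hxd
  have h2 := contDiffWithinAt_alongCo hk hη hs hxd
  have h12 : (1 : WithTop ℕ∞) ≤ 2 := one_le_two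
  have h3 := contDiffWithinAt_derivWithin ht hs h2
  have hA := (((𝔞.contDiffAt_anchorCo_fst hx).of_le (m := 1)
    (by exact_mod_cast le_top)).comp_contDiffWithinAt s (h1.of_le h12))
  have hB := (((𝔞.contDiffAt_bracketCo_fst hx).of_le (m := 1)
    (by exact_mod_cast le_top)).comp_contDiffWithinAt s (h1.of_le h12))
  have h4 := contDiff_snd.contDiffAt.comp_contDiffWithinAt s (h1.of_le h12)
  exact (hA.clm_apply (h2.of_le h12)).prodMk
    (h3.add ((hB.clm_apply h4).clm_apply (h2.of_le h12)))

end SkewAlgebroid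

end Variations

/-! ### The second variation of a curve in coordinates -/

section SecondVariation

variable {B : Type*} [NormedAddCommGroup B] [NormedSpace ℝ B]
  {F : Type*} [NormedAddCommGroup F] [NormedSpace ℝ F]
  {M : Type*} [TopologicalSpace M] [ChartedSpace B M]
  {E : M → Type*} [TopologicalSpace (TotalSpace F E)]
  [∀ x, AddCommGroup (E x)] [∀ x, Module ℝ (E x)] [∀ x, TopologicalSpace (E x)]
  [FiberBundle F E] [VectorBundle ℝ F E]
  [∀ x, IsTopologicalAddGroup (E x)] [∀ x, ContinuousSMul ℝ (E x)]
  [IsManifold 𝓘(ℝ, B) ∞ M] [ContMDiffVectorBundle ∞ F E 𝓘(ℝ, B)]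
  [FiniteDimensional ℝ B] [T2Space M] [FiniteDimensional ℝ F]


/-- The expression in coordinates of the last component of a curve in `T E`. -/
def liftCo (x₀ : M) (Δξ : ℝ → TE B F E) (s : ℝ) : F := (cE x₀ (Δξ s)).2.2

namespace SkewAlgebroid

variable {𝔞 : SkewAlgebroid B F E} {L : TotalSpace F E → ℝ} {t₀ t₁ s : ℝ} {k : ℕ∞}
  {γ : ℝ → TotalSpace F E} {x₀ : M} {η ξ : ∀ t, E (γ t).1} {Δξ : ℝ → TE B F E}

theorem IsLiftedGenerator.base_mem (h : 𝔞.IsLiftedGenerator k t₀ t₁ γ η ξ Δξ)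
    (hs : s ∈ Icc t₀ t₁) {U : Set M} (hx : (γ s).1 ∈ U) : (Δξ s).1.1 ∈ U := by
  rw [h.base s hs]; exact hx

/-- The base condition and `Tτ ∘ Δξ = ρ(η)` fix all coordinates of a lifted generator except the
last one, `liftCo`; the choice of `Δξ` is the choice of this component. -/
theorem IsLiftedGenerator.cE_eq (h : 𝔞.IsLiftedGenerator k t₀ t₁ γ η ξ Δξ) (hs : s ∈ Icc t₀ t₁)
    (hx : (γ s).1 ∈ dom B F E x₀) :
    cE x₀ (Δξ s) = (((co B x₀ (γ s)).1, alongCo x₀ γ ξ s),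
      (𝔞.anchorCo x₀ (co B x₀ (γ s)).1 (alongCo x₀ γ η s), liftCo x₀ Δξ s)) := by
  have hx' := h.base_mem hs hx
  refine Prod.ext ((cE_fst hx').trans ?_) (Prod.ext ?_ rfl)
  · rw [h.base s hs]; rfl
  · have h1 := congrArg (tco 𝓘(ℝ, B) x₀) (h.anchored s hs)
    have h2 := congrArg Prod.snd ((tco_Tτ (Δξ s) hx').symm.trans h1)
    exact h2.trans (𝔞.anchorCo_apply hx (η s)).symm

theorem IsLiftedGenerator.contDiffWithinAt_cE (hk : 2 ≤ k)
    (h : 𝔞.IsLiftedGenerator k t₀ t₁ γ η ξ Δξ) (hs : s ∈ Icc t₀ t₁)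
    (hx : (γ s).1 ∈ dom B F E x₀) :
    ContDiffWithinAt ℝ 2 (fun r => cE x₀ (Δξ r)) (Icc t₀ t₁) s :=
  (contDiffWithinAt_tco (h.smooth s hs) (mem_source_origin (h.base_mem hs hx))).of_le (by
    have : ((2 : ℕ∞) : WithTop ℕ∞) ≤ k := WithTop.coe_le_coe.2 hk
    exact this)

theorem IsLiftedGenerator.contDiffWithinAt_liftCo (hk : 2 ≤ k)
    (h : 𝔞.IsLiftedGenerator k t₀ t₁ γ η ξ Δξ) (hs : s ∈ Icc t₀ t₁)
    (hx : (γ s).1 ∈ dom B F E x₀) :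
    ContDiffWithinAt ℝ 2 (liftCo x₀ Δξ) (Icc t₀ t₁) s :=
  ((contDiff_snd (E := B) (F := F)).comp
    (contDiff_snd (E := B × F) (F := B × F))).contDiffAt.comp_contDiffWithinAt s
      (h.contDiffWithinAt_cE hk hs hx)

/-- The coordinates of `κ_E ((Δξ)˙)`. -/
theorem IsLiftedGenerator.cTE_tflip_prolong (ht : t₀ < t₁) (hk : 2 ≤ k)
    (hγ : ContMDiffOn 𝓘(ℝ, ℝ) (𝓘(ℝ, B).prod 𝓘(ℝ, F)) k γ (Icc t₀ t₁))
    (hη : ContMDiffOn 𝓘(ℝ, ℝ) (𝓘(ℝ, B).prod 𝓘(ℝ, F)) k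
      (fun t => (⟨(γ t).1, η t⟩ : TotalSpace F E)) (Icc t₀ t₁))
    (hξ : ContMDiffOn 𝓘(ℝ, ℝ) (𝓘(ℝ, B).prod 𝓘(ℝ, F)) k
      (fun t => (⟨(γ t).1, ξ t⟩ : TotalSpace F E)) (Icc t₀ t₁))
    (h : 𝔞.IsLiftedGenerator k t₀ t₁ γ η ξ Δξ) (hs : s ∈ Icc t₀ t₁) (hx : (γ s).1 ∈ fdom B F E x₀)
    {x' : B} (hx' : HasDerivWithinAt (fun r => (co B x₀ (γ r)).1) x' (Icc t₀ t₁) s) :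
    cTE x₀ (tflip (𝓘(ℝ, B).prod 𝓘(ℝ, F))
      (prolong (𝓘(ℝ, B).prod 𝓘(ℝ, F)).tangent t₀ t₁ Δξ s)) =
    ((((co B x₀ (γ s)).1, alongCo x₀ γ ξ s), (x', derivWithin (alongCo x₀ γ ξ) (Icc t₀ t₁) s)),
      ((𝔞.anchorCo x₀ (co B x₀ (γ s)).1 (alongCo x₀ γ η s), liftCo x₀ Δξ s),
        (𝔞.anchorVel x₀ (co B x₀ (γ s)).1 x' (alongCo x₀ γ η s)
          (derivWithin (alongCo x₀ γ η) (Icc t₀ t₁) s),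
          derivWithin (liftCo x₀ Δξ) (Icc t₀ t₁) s))) := by
  have hxd := fdom_subset hx
  have hsrc := mem_source_origin (h.base_mem hs hxd)
  have dη := ((contDiffWithinAt_alongCo hk hη hs hxd).differentiableWithinAt
    two_ne_zero).hasDerivWithinAt
  have dξ := ((contDiffWithinAt_alongCo hk hξ hs hxd).differentiableWithinAt
    two_ne_zero).hasDerivWithinAt
  have dζ := ((h.contDiffWithinAt_liftCo hk hs hxd).differentiableWithinAt
    two_ne_zero).hasDerivWithinAt
  have hA := 𝔞.hasDerivWithinAt_anchorCo (co_fst_mem_fimg hx) hx' dη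
  have hD := (hx'.prodMk dξ).prodMk (hA.prodMk dζ)
  have h1 := tco_prolong_tangent ht hs ((h.smooth s hs).of_le (one_le_of_two_le hk)) hsrc
  have h2 : derivWithin (fun r => cE x₀ (Δξ r)) (Icc t₀ t₁) s = _ :=
    (hD.congr_of_eventuallyEq ((eventually_mem_fdom hγ hs hx).mono fun r hr =>
      h.cE_eq hr.1 (fdom_subset hr.2)) (h.cE_eq hs hxd)).derivWithin (uniqueDiffOn_Icc ht s hs)
  have h3 := h1.trans (congrArg₂ Prod.mk (h.cE_eq hs hxd) h2)
  refine (tco_tflip _ hsrc).trans ?_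
  rw [h3]

/-- The component over `T E` of `δ_{(Δξ, η)} γ` in coordinates. -/
def var₂Co (𝔞 : SkewAlgebroid B F E) (x₀ : M) (t₀ t₁ : ℝ) (γ : ℝ → TotalSpace F E)
    (η ξ : ∀ t, E (γ t).1) (Δξ : ℝ → TE B F E) (s : ℝ) : B × F :=
  (𝔞.anchorVel x₀ (co B x₀ (γ s)).1 (𝔞.varCo x₀ t₀ t₁ γ η s).1 (alongCo x₀ γ ξ s)
      (liftCo x₀ Δξ s),
    derivWithin (liftCo x₀ Δξ) (Icc t₀ t₁) s +
      𝔞.bracketVel x₀ (co B x₀ (γ s)).1 (𝔞.varCo x₀ t₀ t₁ γ η s).1 (co B x₀ (γ s)).2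
        (𝔞.varCo x₀ t₀ t₁ γ η s).2 (alongCo x₀ γ ξ s) (liftCo x₀ Δξ s))

/-- The commutation of the variation of the base with the time derivative. -/
theorem anchorVel_comm (h𝔞 : 𝔞.IsAlmostLie) (x₀ : M) (y η η' : F) :
    𝔞.anchorVel x₀ (extChartAt 𝓘(ℝ, B) x₀ x₀)
        (𝔞.anchorCo x₀ (extChartAt 𝓘(ℝ, B) x₀ x₀) y) η η' =
      𝔞.anchorVel x₀ (extChartAt 𝓘(ℝ, B) x₀ x₀)
        (𝔞.anchorCo x₀ (extChartAt 𝓘(ℝ, B) x₀ x₀) η) y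
        (η' + 𝔞.bracketCo x₀ (extChartAt 𝓘(ℝ, B) x₀ x₀) y η) := by
  -- After cancelling `ρ̂η'` the claim is `Dρ̂(ρ̂y)η = Dρ̂(ρ̂η)y + ρ̂ĉ(y, η)`, which is the
  -- almost-Lie identity.
  rw [anchorVel, anchorVel, map_add, anchorCo_bracketCo h𝔞]
  abel

/-- A curve `γ` solving the Euler-Lagrange equation for `L`, with sections `η`, `ξ` along it and a
lifted generator `Δξ`. -/
structure VariationData (𝔞 : SkewAlgebroid B F E) (L : TotalSpace F E → ℝ) (k : ℕ∞) (t₀ t₁ : ℝ)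
    (γ : ℝ → TotalSpace F E) (η ξ : ∀ t, E (γ t).1) (Δξ : ℝ → TE B F E) : Prop where
  almostLie : 𝔞.IsAlmostLie
  smooth : ContMDiff (𝓘(ℝ, B).prod 𝓘(ℝ, F)) 𝓘(ℝ, ℝ) ∞ L
  lt : t₀ < t₁
  two_le : 2 ≤ k
  curve : ContMDiffOn 𝓘(ℝ, ℝ) (𝓘(ℝ, B).prod 𝓘(ℝ, F)) k γ (Icc t₀ t₁)
  el : 𝔞.IsELSolution L t₀ t₁ γ
  eta : ContMDiffOn 𝓘(ℝ, ℝ) (𝓘(ℝ, B).prod 𝓘(ℝ, F)) k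
    (fun t => (⟨(γ t).1, η t⟩ : TotalSpace F E)) (Icc t₀ t₁)
  xi : ContMDiffOn 𝓘(ℝ, ℝ) (𝓘(ℝ, B).prod 𝓘(ℝ, F)) k
    (fun t => (⟨(γ t).1, ξ t⟩ : TotalSpace F E)) (Icc t₀ t₁)
  lift : 𝔞.IsLiftedGenerator k t₀ t₁ γ η ξ Δξ

namespace VariationData

variable (D : 𝔞.VariationData L k t₀ t₁ γ η ξ Δξ)
include D

theorem hasDerivWithinAt (hs : s ∈ Icc t₀ t₁) (hx : (γ s).1 ∈ fdom B F E x₀) :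
    HasDerivWithinAt (fun r => ((co B x₀ (γ r)).1, legCo x₀ L (co B x₀ (γ r))))
      (𝔞.anchorCo x₀ (co B x₀ (γ s)).1 (co B x₀ (γ s)).2, 𝔞.forceCo x₀ L (co B x₀ (γ s)))
      (Icc t₀ t₁) s :=
  𝔞.hasDerivWithinAt_of_isELSolution D.smooth D.lt D.two_le D.curve D.el hs hx

theorem cE_var_eta (hs : s ∈ Icc t₀ t₁) (hx : (γ s).1 ∈ fdom B F E x₀) :
    cE x₀ (𝔞.var t₀ t₁ γ η s) = (co B x₀ (γ s), 𝔞.varCo x₀ t₀ t₁ γ η s) :=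
  cE_var D.smooth D.lt D.two_le D.curve D.el D.eta hs hx

theorem cE_var_xi (hs : s ∈ Icc t₀ t₁) (hx : (γ s).1 ∈ fdom B F E x₀) :
    cE x₀ (𝔞.var t₀ t₁ γ ξ s) = (co B x₀ (γ s), 𝔞.varCo x₀ t₀ t₁ γ ξ s) :=
  cE_var D.smooth D.lt D.two_le D.curve D.el D.xi hs hx

theorem cTE_tflip (hs : s ∈ Icc t₀ t₁) (hx : (γ s).1 ∈ fdom B F E x₀)
    (W : TangentSpace (𝓘(ℝ, B).prod 𝓘(ℝ, F)).tangent (𝔞.var t₀ t₁ γ η s)) :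
    cTE x₀ (tflip (𝓘(ℝ, B).prod 𝓘(ℝ, F)) (⟨𝔞.var t₀ t₁ γ η s, W⟩ : TTE B F E)) =
      ((co B x₀ (γ s), (cTE x₀ (⟨𝔞.var t₀ t₁ γ η s, W⟩ : TTE B F E)).2.1),
        (𝔞.varCo x₀ t₀ t₁ γ η s, (cTE x₀ (⟨𝔞.var t₀ t₁ γ η s, W⟩ : TTE B F E)).2.2)) := by
  have hxd := fdom_subset hx
  refine (tco_tflip _ (mem_source_origin hxd)).trans ?_
  have h1 : (cTE x₀ (⟨𝔞.var t₀ t₁ γ η s, W⟩ : TTE B F E)).1 = _ :=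
    (cTE_fst hxd).trans (D.cE_var_eta hs hx)
  rw [h1]

theorem cTE_of_dTKappa (hs : s ∈ Icc t₀ t₁) (hx : (γ s).1 ∈ fdom B F E x₀)
    {W : TangentSpace (𝓘(ℝ, B).prod 𝓘(ℝ, F)).tangent (𝔞.var t₀ t₁ γ η s)}
    (hW : 𝔞.dTKappa (prolong (𝓘(ℝ, B).prod 𝓘(ℝ, F)).tangent t₀ t₁ Δξ s)
      ⟨𝔞.var t₀ t₁ γ η s, W⟩) :
    (cTE x₀ (⟨𝔞.var t₀ t₁ γ η s, W⟩ : TTE B F E)).2 =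
      (𝔞.varCo x₀ t₀ t₁ γ ξ s, 𝔞.var₂Co x₀ t₀ t₁ γ η ξ Δξ s) := by
  have h1 := 𝔞.tKappaCo_of_tKappa (x₀ := x₀) (D.lift.base_mem hs hx) hx hW
  rw [D.lift.cTE_tflip_prolong D.lt D.two_le D.curve D.eta D.xi hs hx
    (D.hasDerivWithinAt hs hx).fst, D.cTE_tflip hs hx] at h1
  exact Prod.ext (Prod.ext h1.anchor h1.vert) (Prod.ext h1.anchor' h1.vert')

/-- Four of the eight equations of the tangent relation give the unknown components of `W`, whence
uniqueness. The other four constrain the data, and existence amounts to checking them. -/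
theorem existsUnique_dTKappa (hs : s ∈ Icc t₀ t₁) :
    ∃! W : TangentSpace (𝓘(ℝ, B).prod 𝓘(ℝ, F)).tangent (𝔞.var t₀ t₁ γ η s),
      𝔞.dTKappa (prolong (𝓘(ℝ, B).prod 𝓘(ℝ, F)).tangent t₀ t₁ Δξ s)
        ⟨𝔞.var t₀ t₁ γ η s, W⟩ := by
  have hx := mem_fdom_self B F E (γ s).1
  have hsrc := mem_source_TE (X := 𝔞.var t₀ t₁ γ η s) (fdom_subset hx)
  obtain ⟨W, hW⟩ := exists_tco_snd (I := (𝓘(ℝ, B).prod 𝓘(ℝ, F)).tangent) hsrc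
    (𝔞.varCo (γ s).1 t₀ t₁ γ ξ s, 𝔞.var₂Co (γ s).1 t₀ t₁ γ η ξ Δξ s)
  refine ⟨W, ?_, fun W' hW' => tco_snd_inj hsrc ((D.cTE_of_dTKappa hs hx hW').trans hW.symm)⟩
  refine 𝔞.tKappa_of_tKappaCo (x₀ := (γ s).1) (D.lift.base_mem hs hx) hx ?_
  rw [D.lift.cTE_tflip_prolong D.lt D.two_le D.curve D.eta D.xi hs hx
    (D.hasDerivWithinAt hs hx).fst, D.cTE_tflip hs hx]
  change (cTE (γ s).1 (⟨𝔞.var t₀ t₁ γ η s, W⟩ : TTE B F E)).2 = _ at hW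
  rw [hW]
  -- The first `anchored` equation is definitional because the base velocity was already rewritten
  -- by the Euler-Lagrange equation. The constraint `anchored'`, commutation of `d/dt` and `δ_η` on
  -- the base, is where the almost-Lie hypothesis enters.
  exact ⟨rfl, rfl, rfl, rfl, rfl, anchorVel_comm D.almostLie _ _ _ _, rfl, rfl⟩

/-- The coordinates of `δ_{(Δξ, η)} γ`. -/
theorem cTE_var₂ (hs : s ∈ Icc t₀ t₁) (hx : (γ s).1 ∈ fdom B F E x₀) :
    cTE x₀ (𝔞.var₂ t₀ t₁ γ η Δξ s) = ((co B x₀ (γ s), 𝔞.varCo x₀ t₀ t₁ γ ξ s),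
      (𝔞.varCo x₀ t₀ t₁ γ η s, 𝔞.var₂Co x₀ t₀ t₁ γ η ξ Δξ s)) := by
  have h1 := D.cTE_of_dTKappa hs hx
    (Classical.epsilon_spec (D.existsUnique_dTKappa hs).exists)
  refine (D.cTE_tflip hs hx _).trans ?_
  rw [h1]

theorem var₂_fst (hs : s ∈ Icc t₀ t₁) :
    (𝔞.var₂ t₀ t₁ γ η Δξ s).1 = 𝔞.var t₀ t₁ γ ξ s := by
  have hx := mem_fdom_self B F E (γ s).1
  have hsrc := mem_source_origin (e := γ s) (fdom_subset hx)
  refine tco_inj hsrc hsrc ?_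
  have h1 := congrArg Prod.fst (D.cTE_var₂ hs hx)
  exact ((cTE_fst (A := 𝔞.var₂ t₀ t₁ γ η Δξ s) (fdom_subset hx)).symm.trans h1).trans
    (D.cE_var_xi hs hx).symm

theorem tangentMap_var₂ (hs : s ∈ Icc t₀ t₁) :
    tangentMap (𝓘(ℝ, B).prod 𝓘(ℝ, F)).tangent (𝓘(ℝ, B).prod 𝓘(ℝ, F))
      (fun X : TE B F E => X.1) (𝔞.var₂ t₀ t₁ γ η Δξ s) = 𝔞.var t₀ t₁ γ η s := by
  have hx := mem_fdom_self B F E (γ s).1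
  have hxd := fdom_subset hx
  have hsrc := mem_source_origin (e := γ s) hxd
  refine tco_inj hsrc hsrc ?_
  refine (tco_mfderiv (f := fun X : TE B F E => X.1) (g := Prod.fst)
    (q := (𝔞.var₂ t₀ t₁ γ η Δξ s).1)
    (q₀ := (⟨origin F E (γ s).1, 0⟩ : TE B F E)) (mem_source_TE hxd) hsrc
    ((contMDiff_proj (TangentSpace (𝓘(ℝ, B).prod 𝓘(ℝ, F))) (n := 1)).mdifferentiable
      one_ne_zero _) ?_ hasFDerivAt_fst _).trans ?_
  · filter_upwards [(continuous_base (B := B) (F := F) (E := E)).continuousAt.eventually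
      ((isOpen_dom B F E (γ s).1).mem_nhds hxd)] with X hX
    exact ((congrArg Prod.fst (extChartAt_TE hX)).trans rfl).symm
  · refine Eq.trans ?_ (D.cE_var_eta hs hx).symm
    have h1 := D.cTE_var₂ hs hx
    exact Prod.ext (congrArg (fun c => c.1.1) h1) (congrArg (fun c => c.2.1) h1)

end VariationData

end SkewAlgebroid

end SecondVariation

/-! ### The Jacobi defect -/

section Jacobi

variable {B : Type*} [NormedAddCommGroup B] [NormedSpace ℝ B]
  {F : Type*} [NormedAddCommGroup F] [NormedSpace ℝ F]
  {M : Type*} [TopologicalSpace M] [ChartedSpace B M]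
  {E : M → Type*} [TopologicalSpace (TotalSpace F E)]
  [∀ x, AddCommGroup (E x)] [∀ x, Module ℝ (E x)] [∀ x, TopologicalSpace (E x)]
  [FiberBundle F E] [VectorBundle ℝ F E]
  [∀ x, IsTopologicalAddGroup (E x)] [∀ x, ContinuousSMul ℝ (E x)]
  [IsManifold 𝓘(ℝ, B) ∞ M] [ContMDiffVectorBundle ∞ F E 𝓘(ℝ, B)]
  [FiniteDimensional ℝ B] [T2Space M] [FiniteDimensional ℝ F]


/-- At the centre of a chart the coordinates of a vector of `T T E` are its components. -/
theorem cTE_center_snd (A : TTE B F E) :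
    (cTE A.1.1.1 A).2 = raw (𝓘(ℝ, B).prod 𝓘(ℝ, F)).tangent A := by
  have hx := mem_dom_self B F E A.1.1.1
  refine Eq.trans ?_ (congrArg Prod.snd (tco_self A))
  have hev : extChartAt (𝓘(ℝ, B).prod 𝓘(ℝ, F)).tangent (⟨origin F E A.1.1.1, 0⟩ : TE B F E)
      =ᶠ[𝓝 A.1] extChartAt (𝓘(ℝ, B).prod 𝓘(ℝ, F)).tangent A.1 := by
    filter_upwards [(continuous_base (B := B) (F := F) (E := E)).continuousAt.eventually
      ((isOpen_dom B F E A.1.1.1).mem_nhds hx)] with X hX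
    rw [extChartAt_TE hX, extChartAt_tangent (mem_source_iff.2 hX)]
    exact tco_congr (e₀ := origin F E A.1.1.1) (e₁ := A.1.1) rfl X
  exact congrArg (fun φ : TangentSpace (𝓘(ℝ, B).prod 𝓘(ℝ, F)).tangent A.1 →L[ℝ]
    ((B × F) × (B × F)) => φ A.2)
    hev.mfderiv_eq

/-- The coordinates at `x₀` of a vector of `T T E*`. -/
abbrev cTD (x₀ : M) (A : TTDual B F E) :
    ((B × (F →L[ℝ] ℝ)) × (B × (F →L[ℝ] ℝ))) × ((B × (F →L[ℝ] ℝ)) × (B × (F →L[ℝ] ℝ))) :=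
  tco (𝓘(ℝ, B).prod 𝓘(ℝ, F →L[ℝ] ℝ)).tangent
    (⟨origin (F →L[ℝ] ℝ) (DualFib E) x₀, 0⟩ : TDual B F E) A

theorem cTD_fst {x₀ : M} {A : TTDual B F E} (h : A.1.1.1 ∈ dom B F E x₀) :
    (cTD x₀ A).1 = cD x₀ A.1 := by
  rw [← dom_dual] at h; exact cTE_fst h

/-- A vector of `T T E*` whose base components vanish is vertical. -/
theorem isVert_of_raw {W : TTDual B F E}
    (h₁ : (raw (𝓘(ℝ, B).prod 𝓘(ℝ, F →L[ℝ] ℝ)).tangent W).1.1 = 0)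
    (h₂ : (raw (𝓘(ℝ, B).prod 𝓘(ℝ, F →L[ℝ] ℝ)).tangent W).2.1 = 0) : IsVert W := by
  have hx := mem_dom_self B F E W.1.1.1
  have hx' : W.1.1.1 ∈ dom B (F →L[ℝ] ℝ) (DualFib E) W.1.1.1 := by rwa [dom_dual]
  have hev : ∀ᶠ Φ : TDual B F E in 𝓝 W.1, Φ.1.1 ∈ dom B F E W.1.1.1 :=
    (continuous_base (B := B) (F := F →L[ℝ] ℝ) (E := DualFib E)).continuousAt.eventually
      ((isOpen_dom B F E W.1.1.1).mem_nhds hx)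
  have hsrc := mem_tangent_chart_source (I := 𝓘(ℝ, B)) (X := Tπ W.1) (q₀ := W.1.1.1)
    (mem_chart_source B W.1.1.1)
  have hev1 : ∀ᶠ Φ : TDual B F E in 𝓝 W.1, (Tπ Φ : TangentBundle 𝓘(ℝ, B) M) ∈
      (chartAt (ModelProd B B) (⟨W.1.1.1, 0⟩ : TangentBundle 𝓘(ℝ, B) M)).source := by
    filter_upwards [hev] with Φ hΦ
    exact mem_tangent_chart_source (X := Tπ Φ) hΦ.1
  have hev2 : ∀ᶠ Φ : TDual B F E in 𝓝 W.1,
      extChartAt 𝓘(ℝ, B).tangent (⟨W.1.1.1, 0⟩ : TangentBundle 𝓘(ℝ, B) M) (Tπ Φ) =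
      (fun p : (B × (F →L[ℝ] ℝ)) × (B × (F →L[ℝ] ℝ)) => (p.1.1, p.2.1))
        (extChartAt (𝓘(ℝ, B).prod 𝓘(ℝ, F →L[ℝ] ℝ)).tangent
          (⟨origin (F →L[ℝ] ℝ) (DualFib E) W.1.1.1, 0⟩ : TDual B F E) Φ) := by
    filter_upwards [hev] with Φ hΦ
    rw [extChartAt_TE (E := DualFib E) (by rwa [dom_dual])]
    exact (extChartAt_tangent_zero (X := Tπ Φ) hΦ.1).trans (tco_Tπ Φ hΦ)
  have hC : ContMDiffAt (𝓘(ℝ, B).prod 𝓘(ℝ, F →L[ℝ] ℝ)).tangent 𝓘(ℝ, B).tangent ∞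
      (Tπ : TDual B F E → TangentBundle 𝓘(ℝ, B) M) W.1 :=
    contMDiffAt_of_coord
      (g := fun p : (B × (F →L[ℝ] ℝ)) × (B × (F →L[ℝ] ℝ)) => (p.1.1, p.2.1))
      (mem_source_TE (E := DualFib E) hx') hev1 hev2
      ((contDiff_fst.fst.prodMk contDiff_snd.fst).contDiffAt)
  have h3 := tco_mfderiv
    (g := fun p : (B × (F →L[ℝ] ℝ)) × (B × (F →L[ℝ] ℝ)) => (p.1.1, p.2.1)) (mem_source_TE (E := DualFib E) hx') hsrc
    (hC.mdifferentiableAt (by simp)) hev2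
    (g' := ((ContinuousLinearMap.fst ℝ B (F →L[ℝ] ℝ)).comp (ContinuousLinearMap.fst ℝ _ _)).prod
      ((ContinuousLinearMap.fst ℝ B (F →L[ℝ] ℝ)).comp (ContinuousLinearMap.snd ℝ _ _)))
    ((hasFDerivAt_fst.fst).prodMk (hasFDerivAt_snd.fst)) W.2
  refine tco_snd_inj hsrc ((congrArg Prod.snd h3).trans ?_)
  have h4 := cTE_center_snd (E := DualFib E) W
  refine Eq.trans ?_ (map_zero (mfderiv 𝓘(ℝ, B).tangent 𝓘(ℝ, B × B)
    (extChartAt 𝓘(ℝ, B).tangent (⟨W.1.1.1, 0⟩ : TangentBundle 𝓘(ℝ, B) M)) (Tπ W.1))).symm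
  exact Prod.ext ((congrArg (fun c => c.1.1) h4).trans h₁) ((congrArg (fun c => c.2.1) h4).trans h₂)

end Jacobi

/-! ### The Jacobi defect along a solution: verticality and pairing -/

section JacobiDefect

variable {B : Type*} [NormedAddCommGroup B] [NormedSpace ℝ B]
  {F : Type*} [NormedAddCommGroup F] [NormedSpace ℝ F]
  {M : Type*} [TopologicalSpace M] [ChartedSpace B M]
  {E : M → Type*} [TopologicalSpace (TotalSpace F E)]
  [∀ x, AddCommGroup (E x)] [∀ x, Module ℝ (E x)] [∀ x, TopologicalSpace (E x)]
  [FiberBundle F E] [VectorBundle ℝ F E]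
  [∀ x, IsTopologicalAddGroup (E x)] [∀ x, ContinuousSMul ℝ (E x)]
  [IsManifold 𝓘(ℝ, B) ∞ M] [ContMDiffVectorBundle ∞ F E 𝓘(ℝ, B)]
  [FiniteDimensional ℝ B] [T2Space M] [FiniteDimensional ℝ F]


namespace SkewAlgebroid

variable {𝔞 : SkewAlgebroid B F E} {L : TotalSpace F E → ℝ} {t₀ t₁ s : ℝ} {k : ℕ∞}
  {γ : ℝ → TotalSpace F E} {x₀ : M} {η ξ : ∀ t, E (γ t).1} {Δξ : ℝ → TE B F E}

/-- The variation of the momentum in coordinates. -/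
def momCo (𝔞 : SkewAlgebroid B F E) (L : TotalSpace F E → ℝ) (x₀ : M) (t₀ t₁ : ℝ)
    (γ : ℝ → TotalSpace F E) (η : ∀ t, E (γ t).1) (s : ℝ) : F →L[ℝ] ℝ :=
  fderiv ℝ (legCo x₀ L) (co B x₀ (γ s)) (𝔞.varCo x₀ t₀ t₁ γ η s)

/-- The expression of the Jacobi defect in coordinates. -/
def jacobiCo (𝔞 : SkewAlgebroid B F E) (L : TotalSpace F E → ℝ) (x₀ : M) (t₀ t₁ : ℝ)
    (γ : ℝ → TotalSpace F E) (η : ∀ t, E (γ t).1) (s : ℝ) : F →L[ℝ] ℝ :=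
  fderiv ℝ (𝔞.forceCo x₀ L) (co B x₀ (γ s)) (𝔞.varCo x₀ t₀ t₁ γ η s) -
    derivWithin (𝔞.momCo L x₀ t₀ t₁ γ η) (Icc t₀ t₁) s

namespace VariationData

variable (D : 𝔞.VariationData L k t₀ t₁ γ η ξ Δξ)
include D

theorem contDiffWithinAt_momCo (hs : s ∈ Icc t₀ t₁) (hx : (γ s).1 ∈ fdom B F E x₀) :
    ContDiffWithinAt ℝ 1 (𝔞.momCo L x₀ t₀ t₁ γ η) (Icc t₀ t₁) s := by
  have h1 : ContDiffAt ℝ 1 (fderiv ℝ (legCo x₀ L)) (co B x₀ (γ s)) :=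
    (contDiffAt_legCo D.smooth (fdom_subset hx)).fderiv_right
      (one_add_one_eq_two.trans_le ENat.LEInfty.out)
  have h2 := h1.comp_contDiffWithinAt s
    ((contDiffWithinAt_co_two D.two_le D.curve hs (fdom_subset hx)).of_le one_le_two)
  exact h2.clm_apply (contDiffWithinAt_varCo D.lt D.two_le D.curve D.eta hs hx)

theorem cD_tangentMap_legendre_var (hs : s ∈ Icc t₀ t₁) (hx : (γ s).1 ∈ fdom B F E x₀) :
    cD x₀ (tangentMap (𝓘(ℝ, B).prod 𝓘(ℝ, F)) (𝓘(ℝ, B).prod 𝓘(ℝ, F →L[ℝ] ℝ)) (𝔞.legendre L)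
      (𝔞.var t₀ t₁ γ η s)) =
    (((co B x₀ (γ s)).1, legCo x₀ L (co B x₀ (γ s))),
      (𝔞.anchorCo x₀ (co B x₀ (γ s)).1 (alongCo x₀ γ η s), 𝔞.momCo L x₀ t₀ t₁ γ η s)) := by
  refine (𝔞.cD_tangentMap_legendre D.smooth (X := 𝔞.var t₀ t₁ γ η s) (fdom_subset hx)).trans ?_
  rw [D.cE_var_eta hs hx]; rfl

theorem cTD_jacobiForce (hs : s ∈ Icc t₀ t₁) (hx : (γ s).1 ∈ fdom B F E x₀) :
    cTD x₀ (𝔞.jacobiForce L t₀ t₁ γ η s) =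
    ((((co B x₀ (γ s)).1, legCo x₀ L (co B x₀ (γ s))),
      (𝔞.anchorCo x₀ (co B x₀ (γ s)).1 (alongCo x₀ γ η s), 𝔞.momCo L x₀ t₀ t₁ γ η s)),
      ((𝔞.anchorCo x₀ (co B x₀ (γ s)).1 (co B x₀ (γ s)).2, 𝔞.forceCo x₀ L (co B x₀ (γ s))),
        (𝔞.anchorVel x₀ (co B x₀ (γ s)).1 (𝔞.varCo x₀ t₀ t₁ γ η s).1 (co B x₀ (γ s)).2
          (𝔞.varCo x₀ t₀ t₁ γ η s).2,
        fderiv ℝ (𝔞.forceCo x₀ L) (co B x₀ (γ s)) (𝔞.varCo x₀ t₀ t₁ γ η s)))) := by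
  have hxd := fdom_subset hx
  refine (tco_tflip _ (mem_source_origin (F := F →L[ℝ] ℝ) (E := DualFib E)
    (by rw [dom_dual]; exact hxd))).trans ?_
  rw [𝔞.tco_tangentMap_tulczyjew D.smooth (X := 𝔞.var t₀ t₁ γ η s) hx, D.cE_var_eta hs hx]
  rfl

theorem cTD_jacobiMomentum (hs : s ∈ Icc t₀ t₁) (hx : (γ s).1 ∈ fdom B F E x₀) :
    cTD x₀ (𝔞.jacobiMomentum L t₀ t₁ γ η s) =
    ((((co B x₀ (γ s)).1, legCo x₀ L (co B x₀ (γ s))),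
      (𝔞.anchorCo x₀ (co B x₀ (γ s)).1 (alongCo x₀ γ η s), 𝔞.momCo L x₀ t₀ t₁ γ η s)),
      ((𝔞.anchorCo x₀ (co B x₀ (γ s)).1 (co B x₀ (γ s)).2, 𝔞.forceCo x₀ L (co B x₀ (γ s))),
        (𝔞.anchorVel x₀ (co B x₀ (γ s)).1
          (𝔞.anchorCo x₀ (co B x₀ (γ s)).1 (co B x₀ (γ s)).2) (alongCo x₀ γ η s)
          (derivWithin (alongCo x₀ γ η) (Icc t₀ t₁) s),
        derivWithin (𝔞.momCo L x₀ t₀ t₁ γ η) (Icc t₀ t₁) s))) := by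
  have hxd := fdom_subset hx
  have hev := eventually_mem_fdom D.curve hs hx
  have hsrc : ∀ {e : DualTot F E}, e.1 ∈ fdom B F E x₀ →
      e ∈ (chartAt (ModelProd B (F →L[ℝ] ℝ)) (origin (F →L[ℝ] ℝ) (DualFib E) x₀)).source :=
    fun h => mem_source_origin (by rw [dom_dual]; exact fdom_subset h)
  have hco : ∀ᶠ r in 𝓝[Icc t₀ t₁] s, cD x₀ (tangentMap (𝓘(ℝ, B).prod 𝓘(ℝ, F))
      (𝓘(ℝ, B).prod 𝓘(ℝ, F →L[ℝ] ℝ)) (𝔞.legendre L) (𝔞.var t₀ t₁ γ η r)) = _ :=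
    hev.mono fun r hr => D.cD_tangentMap_legendre_var hr.1 hr.2
  have hEL := D.hasDerivWithinAt hs hx
  have dη := ((contDiffWithinAt_alongCo D.two_le D.eta hs hxd).differentiableWithinAt
    two_ne_zero).hasDerivWithinAt
  have cP := D.contDiffWithinAt_momCo hs hx
  have dP := (cP.differentiableWithinAt one_ne_zero).hasDerivWithinAt
  have hA := 𝔞.hasDerivWithinAt_anchorCo (co_fst_mem_fimg hx) hEL.fst dη
  -- The derivative of `(u, p)` is not computed but taken from the Euler-Lagrange equation, so it
  -- appears as `(ρ̂y, f)` and matches the corresponding components of `jacobiForce` literally.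
  have hD := hEL.prodMk (hA.prodMk dP)
  have cγ := (contDiffWithinAt_co_two D.two_le D.curve hs hxd).of_le (one_le_two (α := ℕ∞ω))
  have cη := (contDiffWithinAt_alongCo D.two_le D.eta hs hxd).of_le (one_le_two (α := ℕ∞ω))
  have cL := ((contDiffAt_legCo D.smooth hxd).of_le (m := 1)
    (by exact_mod_cast le_top)).comp_contDiffWithinAt s cγ
  have cA := (((𝔞.contDiffAt_anchorCo_fst hx).of_le (m := 1)
    (by exact_mod_cast le_top)).comp_contDiffWithinAt s cγ).clm_apply cη
  have cγ1 := (contDiff_fst (E := B) (F := F)).contDiffAt.comp_contDiffWithinAt s cγ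
  have cX := (((cγ1.prodMk cL).prodMk (cA.prodMk cP)).congr_of_eventuallyEq hco
    (D.cD_tangentMap_legendre_var hs hx))
  -- The velocity of a curve in `T E*` is meaningful only after the curve is known to be
  -- differentiable; its coordinates are `C¹` because the varied momentum is.
  have hX := contMDiffWithinAt_of_tco (n := 1)
    (hev.mono fun r hr => hsrc (e := 𝔞.legendre L (γ r)) hr.2)
    (hsrc (e := 𝔞.legendre L (γ s)) hx) cX
  have h1 := tco_prolong_tangent D.lt hs hX (hsrc (e := 𝔞.legendre L (γ s)) hx)
  refine h1.trans (congrArg₂ Prod.mk (D.cD_tangentMap_legendre_var hs hx) ?_)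
  exact (hD.congr_of_eventuallyEq hco (D.cD_tangentMap_legendre_var hs hx)).derivWithin
    (uniqueDiffOn_Icc D.lt s hs)

theorem jacobiForce_fst (hs : s ∈ Icc t₀ t₁) :
    (𝔞.jacobiForce L t₀ t₁ γ η s).1 = (𝔞.jacobiMomentum L t₀ t₁ γ η s).1 := by
  have hx := mem_fdom_self B F E (γ s).1
  have hxd := fdom_subset hx
  have hsrc := mem_source_origin (B := B) (F := F →L[ℝ] ℝ) (E := DualFib E)
    (e := 𝔞.legendre L (γ s))
    (x₀ := (γ s).1) (by rw [dom_dual]; exact hxd)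
  refine tco_inj hsrc hsrc ?_
  have h1 := congrArg Prod.fst (D.cTD_jacobiForce hs hx)
  have h2 := congrArg Prod.fst (D.cTD_jacobiMomentum hs hx)
  exact ((cTD_fst (A := 𝔞.jacobiForce L t₀ t₁ γ η s) hxd).symm.trans h1).trans
    (h2.symm.trans (cTD_fst (A := 𝔞.jacobiMomentum L t₀ t₁ γ η s) hxd))

/-- The velocities `δx` and `δz` cancel by the Euler-Lagrange equation, `δẋ` by the almost-Lie
commutation `anchorVel_comm`, and only `δż` is left. The subtraction is made in the chart centred at
`γ(s)`, where components and coordinates agree. -/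
theorem raw_jacobiDefect (hs : s ∈ Icc t₀ t₁) :
    raw (𝓘(ℝ, B).prod 𝓘(ℝ, F →L[ℝ] ℝ)).tangent (𝔞.jacobiDefect L t₀ t₁ γ η s) =
      ((0, 0), (0, 𝔞.jacobiCo L (γ s).1 t₀ t₁ γ η s)) := by
  have hx := mem_fdom_self B F E (γ s).1
  have h1 := (cTE_center_snd (E := DualFib E) (𝔞.jacobiForce L t₀ t₁ γ η s)).symm.trans
    (congrArg Prod.snd (D.cTD_jacobiForce hs hx))
  have h2 := (cTE_center_snd (E := DualFib E) (𝔞.jacobiMomentum L t₀ t₁ γ η s)).symm.trans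
    (congrArg Prod.snd (D.cTD_jacobiMomentum hs hx))
  have h3 : raw (𝓘(ℝ, B).prod 𝓘(ℝ, F →L[ℝ] ℝ)).tangent (𝔞.jacobiDefect L t₀ t₁ γ η s) =
      raw (𝓘(ℝ, B).prod 𝓘(ℝ, F →L[ℝ] ℝ)).tangent (𝔞.jacobiForce L t₀ t₁ γ η s) -
      raw (𝓘(ℝ, B).prod 𝓘(ℝ, F →L[ℝ] ℝ)).tangent (𝔞.jacobiMomentum L t₀ t₁ γ η s) := rfl
  refine h3.trans ((congrArg₂ (· - ·) h1 h2).trans ?_)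
  refine Prod.ext (sub_self _) (Prod.ext ?_ rfl)
  refine sub_eq_zero.2 (Eq.symm ?_)
  exact anchorVel_comm D.almostLie (γ s).1 _ _ _

theorem isVert_jacobiDefect (hs : s ∈ Icc t₀ t₁) : IsVert (𝔞.jacobiDefect L t₀ t₁ γ η s) :=
  isVert_of_raw (congrArg (fun c => c.1.1) (D.raw_jacobiDefect hs))
    (congrArg (fun c => c.2.1) (D.raw_jacobiDefect hs))

theorem raw_vertPart_jacobiDefect (hs : s ∈ Icc t₀ t₁) :
    raw (𝓘(ℝ, B).prod 𝓘(ℝ, F →L[ℝ] ℝ)) (vertPart (𝔞.jacobiDefect L t₀ t₁ γ η s)) =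
      (𝔞.anchorCo (γ s).1 (co B (γ s).1 (γ s)).1 (alongCo (γ s).1 γ η s),
        𝔞.jacobiCo L (γ s).1 t₀ t₁ γ η s) := by
  have hx := mem_fdom_self B F E (γ s).1
  have hxd := fdom_subset hx
  have h1 := congrArg Prod.snd (tco_center (E := DualFib E) (𝔞.jacobiForce L t₀ t₁ γ η s).1)
  have h2 := (cTD_fst (A := 𝔞.jacobiForce L t₀ t₁ γ η s) hxd).symm.trans
    (congrArg Prod.fst (D.cTD_jacobiForce hs hx))
  refine Prod.ext ?_ (congrArg (fun c => c.2.2) (D.raw_jacobiDefect hs))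
  exact (congrArg Prod.fst h1).symm.trans (congrArg (fun c => c.2.1) h2)

theorem Tπ_vertPart (hs : s ∈ Icc t₀ t₁) :
    Tπ (vertPart (𝔞.jacobiDefect L t₀ t₁ γ η s)) = Tτ (Δξ s) := by
  have hx := mem_fdom_self B F E (γ s).1
  have hxd := fdom_subset hx
  have hx' := D.lift.base_mem hs hxd
  refine tco_inj (q₀ := (γ s).1) hxd.1 hx'.1 ?_
  refine (tco_Tπ _ hxd).trans (Eq.trans ?_ (tco_Tτ _ hx').symm)
  have h1 := tco_center (E := DualFib E) (vertPart (𝔞.jacobiDefect L t₀ t₁ γ η s))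
  have h2 := D.lift.cE_eq hs hxd
  refine Prod.ext ((congrArg (fun c => c.1.1) h1).trans (congrArg (fun c => c.1.1) h2).symm)
    (((congrArg (fun c => c.2.1) h1).trans ?_).trans (congrArg (fun c => c.2.1) h2).symm)
  exact congrArg Prod.fst (D.raw_vertPart_jacobiDefect hs)

/-- The vertical part has zero component in `E*`, so the term of the pairing which involves the free
component of `Δξ` disappears. This is the source of the independence of `Δξ`. -/
theorem pairT_vertPart (hs : s ∈ Icc t₀ t₁) :
    pairT (Δξ s) (vertPart (𝔞.jacobiDefect L t₀ t₁ γ η s)) =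
      𝔞.jacobiCo L (γ s).1 t₀ t₁ γ η s (alongCo (γ s).1 γ ξ s) := by
  have hx := mem_fdom_self B F E (γ s).1
  have hxd := fdom_subset hx
  have hx' := D.lift.base_mem hs hxd
  have h1 := tco_center (E := DualFib E) (vertPart (𝔞.jacobiDefect L t₀ t₁ γ η s))
  have h2 := D.lift.cE_eq hs hxd
  have h3 : (trivializationAt (F →L[ℝ] ℝ) (DualFib E) (γ s).1
      (vertPart (𝔞.jacobiDefect L t₀ t₁ γ η s)).1).2 = 0 := by
    ext v
    have h4 := dual_triv_apply hxd (vertPart (𝔞.jacobiDefect L t₀ t₁ γ η s)).1.2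
      (locSec (γ s).1 v (γ s).1)
    have h5 := congrArg (fun c => c.1.2) (D.raw_jacobiDefect hs)
    rw [triv_locSec hxd] at h4
    refine h4.trans ?_
    exact congrArg (fun φ : F →L[ℝ] ℝ => φ ((trivializationAt F E (γ s).1).continuousLinearMapAt ℝ
      (γ s).1 (locSec (γ s).1 v (γ s).1))) h5
  refine (pairT_eq (γ s).1 (Δξ s) _ hx' (D.Tπ_vertPart hs).symm).trans ?_
  have h6 := congrArg (fun c => c.1.2) h1
  have h7 := (congrArg (fun c => c.2.2) h1).trans
    (congrArg Prod.snd (D.raw_vertPart_jacobiDefect hs))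
  have h8 := congrArg (fun c => c.1.2) h2
  refine (congrArg₂ (· + ·) (congrArg₂ (fun (φ : F →L[ℝ] ℝ) v => φ v) h7 h8)
    (congrArg (fun (φ : F →L[ℝ] ℝ) => φ _) (h6.trans h3))).trans ?_
  exact add_zero _

end VariationData

end SkewAlgebroid

end JacobiDefect

/-! ### The first integral formula -/

section FirstFormula

variable {B : Type*} [NormedAddCommGroup B] [NormedSpace ℝ B]
  {F : Type*} [NormedAddCommGroup F] [NormedSpace ℝ F]
  {M : Type*} [TopologicalSpace M] [ChartedSpace B M]
  {E : M → Type*} [TopologicalSpace (TotalSpace F E)]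
  [∀ x, AddCommGroup (E x)] [∀ x, Module ℝ (E x)] [∀ x, TopologicalSpace (E x)]
  [FiberBundle F E] [VectorBundle ℝ F E]
  [∀ x, IsTopologicalAddGroup (E x)] [∀ x, ContinuousSMul ℝ (E x)]
  [IsManifold 𝓘(ℝ, B) ∞ M] [ContMDiffVectorBundle ∞ F E 𝓘(ℝ, B)]
  [FiniteDimensional ℝ B] [T2Space M] [FiniteDimensional ℝ F]


theorem fderiv_legCo_apply {L : TotalSpace F E → ℝ} {x₀ : M} {e : TotalSpace F E}
    (hL : ContMDiff (𝓘(ℝ, B).prod 𝓘(ℝ, F)) 𝓘(ℝ, ℝ) ∞ L) (he : e.1 ∈ dom B F E x₀)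
    (δ : B × F) (v : F) :
    fderiv ℝ (legCo x₀ L) (co B x₀ e) δ v =
      fderiv ℝ (fderiv ℝ (Lco x₀ L)) (co B x₀ e) δ (0, v) := by
  have h1 := ((contDiffAt_fderiv_Lco hL he).differentiableAt (by simp)).hasFDerivAt
  have h2 : HasFDerivAt (legCo x₀ L) _ (co B x₀ e) :=
    h1.clm_comp (hasFDerivAt_const (ContinuousLinearMap.inr ℝ B F) (co B x₀ e))
  rw [h2.fderiv]
  simp

/-- The derivative of `d_T L` in coordinates. -/
theorem dT_dT {L : TotalSpace F E → ℝ} {x₀ : M}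
    (hL : ContMDiff (𝓘(ℝ, B).prod 𝓘(ℝ, F)) 𝓘(ℝ, ℝ) ∞ L) {A : TTE B F E}
    (hA : A.1.1.1 ∈ dom B F E x₀) :
    dT (𝓘(ℝ, B).prod 𝓘(ℝ, F)).tangent (dT (𝓘(ℝ, B).prod 𝓘(ℝ, F)) L) A =
      fderiv ℝ (fderiv ℝ (Lco x₀ L)) (cTE x₀ A).1.1 (cTE x₀ A).2.1 (cTE x₀ A).1.2 +
        fderiv ℝ (Lco x₀ L) (cTE x₀ A).1.1 (cTE x₀ A).2.2 := by
  have hev : dT (𝓘(ℝ, B).prod 𝓘(ℝ, F)) L =ᶠ[𝓝 A.1] fun X =>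
      (fun p : (B × F) × (B × F) => fderiv ℝ (Lco x₀ L) p.1 p.2)
        (extChartAt (𝓘(ℝ, B).prod 𝓘(ℝ, F)).tangent (⟨origin F E x₀, 0⟩ : TE B F E) X) := by
    filter_upwards [(continuous_base (B := B) (F := F) (E := E)).continuousAt.eventually
      ((isOpen_dom B F E x₀).mem_nhds hA)] with X hX
    rw [extChartAt_TE hX]
    exact (mfderiv_Lco hL hX X.2).trans
      (congrArg (fun p => fderiv ℝ (Lco x₀ L) p (cE x₀ X).2) (cE_fst hX).symm)
  have hc : (cTE x₀ A).1.1 = co B x₀ A.1.1 := (congrArg Prod.fst (cTE_fst hA)).trans (cE_fst hA)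
  have h1 := ((contDiffAt_fderiv_Lco hL hA).differentiableAt (by simp)).hasFDerivAt
  rw [← hc] at h1
  have h2 : HasFDerivAt (fun p : (B × F) × (B × F) => fderiv ℝ (Lco x₀ L) p.1)
      ((fderiv ℝ (fderiv ℝ (Lco x₀ L)) (cTE x₀ A).1.1).comp
        (ContinuousLinearMap.fst ℝ (B × F) (B × F))) (cTE x₀ A).1 :=
    h1.comp (cTE x₀ A).1 hasFDerivAt_fst
  have h3 := h2.clm_apply (hasFDerivAt_snd (p := (cTE x₀ A).1))
  refine (mfderiv_eq_of_coord (mem_source_TE hA) hev h3 A.2).trans ?_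
  exact add_comm _ _

namespace SkewAlgebroid

variable {𝔞 : SkewAlgebroid B F E} {L : TotalSpace F E → ℝ} {t₀ t₁ s : ℝ} {k : ℕ∞}
  {γ : ℝ → TotalSpace F E} {x₀ : M} {η ξ : ∀ t, E (γ t).1} {Δξ : ℝ → TE B F E}

theorem forceCo_apply (x₀ : M) (p : B × F) (v : F) :
    𝔞.forceCo x₀ L p v = fderiv ℝ (Lco x₀ L) p
      (𝔞.anchorCo x₀ p.1 v, 𝔞.bracketCo x₀ p.1 p.2 v) := by
  have h : (𝔞.anchorCo x₀ p.1 v, 𝔞.bracketCo x₀ p.1 p.2 v) =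
      ((0 : B), 𝔞.bracketCo x₀ p.1 p.2 v) + (𝔞.anchorCo x₀ p.1 v, (0 : F)) := by simp
  rw [h, map_add]; rfl

/-- For fixed `v` the identity `f(p)v = DL(p)(ρ̂v, ĉ(y, v))` is differentiated along the line `p + s
δ`; `v` is constant, hence the zeros in `anchorVel` and `bracketVel`. -/
theorem fderiv_forceCo_apply (hL : ContMDiff (𝓘(ℝ, B).prod 𝓘(ℝ, F)) 𝓘(ℝ, ℝ) ∞ L)
    {e : TotalSpace F E} (he : e.1 ∈ fdom B F E x₀) (δ : B × F) (v : F) :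
    fderiv ℝ (𝔞.forceCo x₀ L) (co B x₀ e) δ v =
      fderiv ℝ (fderiv ℝ (Lco x₀ L)) (co B x₀ e) δ
        (𝔞.anchorCo x₀ (co B x₀ e).1 v, 𝔞.bracketCo x₀ (co B x₀ e).1 (co B x₀ e).2 v) +
      fderiv ℝ (Lco x₀ L) (co B x₀ e) (𝔞.anchorVel x₀ (co B x₀ e).1 δ.1 v 0,
        𝔞.bracketVel x₀ (co B x₀ e).1 δ.1 (co B x₀ e).2 δ.2 v 0) := by
  set p := co B x₀ e with hp
  have hl : HasDerivWithinAt (fun s : ℝ => p + s • δ) δ univ 0 := by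
    simpa using! (((hasDerivAt_id (0 : ℝ)).smul_const δ).const_add p).hasDerivWithinAt (s := univ)
  have h0 : p = p + (0 : ℝ) • δ := by simp
  have h1 := ((𝔞.contDiffAt_forceCo hL he).differentiableAt (by simp)).hasFDerivAt
  have h2 := ((contDiffAt_fderiv_Lco hL (fdom_subset he)).differentiableAt (by simp)).hasFDerivAt
  have hu : p.1 ∈ fimg B F E x₀ := co_fst_mem_fimg he
  rw [← hp] at h1 h2
  have h1' := (HasFDerivAt.comp_hasDerivWithinAt_of_eq (0 : ℝ) h1 hl h0).clm_apply
    (hasDerivWithinAt_const (0 : ℝ) univ v)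
  have h2' := HasFDerivAt.comp_hasDerivWithinAt_of_eq (0 : ℝ) h2 hl h0
  have hu' : (p + (0 : ℝ) • δ).1 ∈ fimg B F E x₀ := h0 ▸ hu
  have hA := 𝔞.hasDerivWithinAt_anchorCo hu' hl.fst (hasDerivWithinAt_const (0 : ℝ) univ v)
  have hB := 𝔞.hasDerivWithinAt_bracketCo hu' hl.fst hl.snd (hasDerivWithinAt_const (0 : ℝ) univ v)
  have h3 := h2'.clm_apply (hA.prodMk hB)
  have h4 := (hasDerivWithinAt_univ.1 h1').unique ((hasDerivWithinAt_univ.1 h3).congr_of_eventuallyEq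
    (Filter.Eventually.of_forall fun s => forceCo_apply x₀ (p + s • δ) v))
  simpa using h4

theorem anchorVel_eq (x₀ : M) (u u' : B) (y y' : F) :
    𝔞.anchorVel x₀ u u' y y' = 𝔞.anchorVel x₀ u u' y 0 + 𝔞.anchorCo x₀ u y' := by
  simp [anchorVel]

theorem bracketVel_eq (x₀ : M) (u u' : B) (y y' a a' : F) :
    𝔞.bracketVel x₀ u u' y y' a a' =
      𝔞.bracketVel x₀ u u' y y' a 0 + 𝔞.bracketCo x₀ u y a' := by
  simp [bracketVel]

namespace VariationData

variable (D : 𝔞.VariationData L k t₀ t₁ γ η ξ Δξ)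
include D

/-- `D²L(δ_ηγ, δ_ξγ) + DL(δ²γ)` is sorted by the occurrences of `ξ`, `ξ̇`, `ζ` and `ζ̇`, where `ζ`
is the free component of `Δξ` and `δ²γ` is `var₂Co`. The terms in `ξ` assemble into the derivative
of the force, and the others are prepared for integration by parts. -/
theorem dT_dT_var₂ (hs : s ∈ Icc t₀ t₁) (hx : (γ s).1 ∈ fdom B F E x₀) :
    dT (𝓘(ℝ, B).prod 𝓘(ℝ, F)).tangent (dT (𝓘(ℝ, B).prod 𝓘(ℝ, F)) L)
        (𝔞.var₂ t₀ t₁ γ η Δξ s) =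
      fderiv ℝ (𝔞.forceCo x₀ L) (co B x₀ (γ s)) (𝔞.varCo x₀ t₀ t₁ γ η s) (alongCo x₀ γ ξ s) +
      𝔞.momCo L x₀ t₀ t₁ γ η s (derivWithin (alongCo x₀ γ ξ) (Icc t₀ t₁) s) +
      (𝔞.forceCo x₀ L (co B x₀ (γ s)) (liftCo x₀ Δξ s) +
        legCo x₀ L (co B x₀ (γ s)) (derivWithin (liftCo x₀ Δξ) (Icc t₀ t₁) s)) := by
  have hxd := fdom_subset hx
  rw [dT_dT (x₀ := x₀) D.smooth (A := 𝔞.var₂ t₀ t₁ γ η Δξ s) hxd, D.cTE_var₂ hs hx,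
    fderiv_forceCo_apply D.smooth hx, momCo, fderiv_legCo_apply D.smooth hxd, forceCo_apply]
  -- The variation `δ_ξγ` is split into its part linear in the value of `ξ` and `(0, ξ̇)`; the next
  -- identity splits the second variation in the same way with respect to `ζ` and `ζ̇`.
  have h1 : 𝔞.varCo x₀ t₀ t₁ γ ξ s = (𝔞.anchorCo x₀ (co B x₀ (γ s)).1 (alongCo x₀ γ ξ s),
      𝔞.bracketCo x₀ (co B x₀ (γ s)).1 (co B x₀ (γ s)).2 (alongCo x₀ γ ξ s)) +
      (0, derivWithin (alongCo x₀ γ ξ) (Icc t₀ t₁) s) :=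
    Prod.ext (add_zero _).symm (add_comm _ _)
  have h2 : 𝔞.var₂Co x₀ t₀ t₁ γ η ξ Δξ s =
      (𝔞.anchorVel x₀ (co B x₀ (γ s)).1 (𝔞.varCo x₀ t₀ t₁ γ η s).1 (alongCo x₀ γ ξ s) 0,
        𝔞.bracketVel x₀ (co B x₀ (γ s)).1 (𝔞.varCo x₀ t₀ t₁ γ η s).1 (co B x₀ (γ s)).2
          (𝔞.varCo x₀ t₀ t₁ γ η s).2 (alongCo x₀ γ ξ s) 0) +
      (𝔞.anchorCo x₀ (co B x₀ (γ s)).1 (liftCo x₀ Δξ s),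
        𝔞.bracketCo x₀ (co B x₀ (γ s)).1 (co B x₀ (γ s)).2 (liftCo x₀ Δξ s)) +
      (0, derivWithin (liftCo x₀ Δξ) (Icc t₀ t₁) s) := by
    rw [var₂Co, anchorVel_eq, bracketVel_eq]
    refine Prod.ext (by simp) ?_
    simp only [Prod.snd_add]
    abel
  have h3 : ∀ v : F, legCo x₀ L (co B x₀ (γ s)) v = fderiv ℝ (Lco x₀ L) (co B x₀ (γ s)) (0, v) :=
    fun v => rfl
  simp only [h1, h2, h3, map_add]
  ring

/-- The pairing of the lifted generator with the variation of the momentum. -/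
theorem pairT_momentum (hs : s ∈ Icc t₀ t₁) (hx : (γ s).1 ∈ fdom B F E x₀) :
    pairT (Δξ s) (tangentMap (𝓘(ℝ, B).prod 𝓘(ℝ, F)) (𝓘(ℝ, B).prod 𝓘(ℝ, F →L[ℝ] ℝ))
      (𝔞.legendre L) (𝔞.var t₀ t₁ γ η s)) =
    𝔞.momCo L x₀ t₀ t₁ γ η s (alongCo x₀ γ ξ s) +
      legCo x₀ L (co B x₀ (γ s)) (liftCo x₀ Δξ s) := by
  have hxd := fdom_subset hx
  have hx' := D.lift.base_mem hs hxd
  have h1 := D.cD_tangentMap_legendre_var hs hx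
  have h2 := D.lift.cE_eq hs hxd
  refine (pairT_eq x₀ _ _ hx' ?_).trans ?_
  · refine tco_inj (q₀ := x₀) hx'.1 hxd.1 ((tco_Tτ _ hx').trans (Eq.trans ?_
      (tco_Tπ (x₀ := x₀) (tangentMap (𝓘(ℝ, B).prod 𝓘(ℝ, F)) (𝓘(ℝ, B).prod 𝓘(ℝ, F →L[ℝ] ℝ))
      (𝔞.legendre L) (𝔞.var t₀ t₁ γ η s)) hxd).symm))
    exact Prod.ext ((congrArg (fun c => c.1.1) h2).trans (congrArg (fun c => c.1.1) h1).symm)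
      ((congrArg (fun c => c.2.1) h2).trans (congrArg (fun c => c.2.1) h1).symm)
  · exact congrArg₂ (fun (c : (B × (F →L[ℝ] ℝ)) × (B × (F →L[ℝ] ℝ))) (d : (B × F) × (B × F)) =>
      c.2.2 d.1.2 + c.1.2 d.2.2) h1 h2

end VariationData

end SkewAlgebroid

end FirstFormula

/-! ### Integration by parts and equality of the two integrals -/

section Integrals

variable {B : Type*} [NormedAddCommGroup B] [NormedSpace ℝ B]
  {F : Type*} [NormedAddCommGroup F] [NormedSpace ℝ F]
  {M : Type*} [TopologicalSpace M] [ChartedSpace B M]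
  {E : M → Type*} [TopologicalSpace (TotalSpace F E)]
  [∀ x, AddCommGroup (E x)] [∀ x, Module ℝ (E x)] [∀ x, TopologicalSpace (E x)]
  [FiberBundle F E] [VectorBundle ℝ F E]
  [∀ x, IsTopologicalAddGroup (E x)] [∀ x, ContinuousSMul ℝ (E x)]
  [IsManifold 𝓘(ℝ, B) ∞ M] [ContMDiffVectorBundle ∞ F E 𝓘(ℝ, B)]
  [FiniteDimensional ℝ B] [T2Space M] [FiniteDimensional ℝ F]


namespace SkewAlgebroid

variable {𝔞 : SkewAlgebroid B F E} {L : TotalSpace F E → ℝ} {t₀ t₁ s : ℝ} {k : ℕ∞}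
  {γ : ℝ → TotalSpace F E} {x₀ : M} {η ξ : ∀ t, E (γ t).1} {Δξ : ℝ → TE B F E}

theorem contDiffWithinAt_one_comp_co {G : Type*} [NormedAddCommGroup G] [NormedSpace ℝ G]
    {f : B × F → G} (hk : 2 ≤ k)
    (hγ : ContMDiffOn 𝓘(ℝ, ℝ) (𝓘(ℝ, B).prod 𝓘(ℝ, F)) k γ (Icc t₀ t₁))
    (hs : s ∈ Icc t₀ t₁) (hx : (γ s).1 ∈ fdom B F E x₀)
    (hf : ContDiffAt ℝ ∞ f (co B x₀ (γ s))) :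
    ContDiffWithinAt ℝ 1 (fun r => f (co B x₀ (γ r))) (Icc t₀ t₁) s :=
  (hf.of_le (m := 1) (by exact_mod_cast le_top)).comp_contDiffWithinAt s
    ((contDiffWithinAt_co_two hk hγ hs (fdom_subset hx)).of_le one_le_two)

namespace VariationData

variable (D : 𝔞.VariationData L k t₀ t₁ γ η ξ Δξ)
include D

theorem contDiffOn_pairT_momentum : ContDiffOn ℝ 1 (fun s => pairT (Δξ s)
    (tangentMap (𝓘(ℝ, B).prod 𝓘(ℝ, F)) (𝓘(ℝ, B).prod 𝓘(ℝ, F →L[ℝ] ℝ)) (𝔞.legendre L)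
      (𝔞.var t₀ t₁ γ η s))) (Icc t₀ t₁) := by
  intro s hs
  have hx := mem_fdom_self B F E (γ s).1
  have hxd := fdom_subset hx
  have h1 := (D.contDiffWithinAt_momCo hs hx).clm_apply
    ((contDiffWithinAt_alongCo D.two_le D.xi hs hxd).of_le one_le_two)
  have h2 := (contDiffWithinAt_one_comp_co D.two_le D.curve hs hx
    (contDiffAt_legCo D.smooth hxd)).clm_apply
    ((D.lift.contDiffWithinAt_liftCo D.two_le hs hxd).of_le one_le_two)
  refine (h1.add h2).congr_of_eventuallyEq ?_ (D.pairT_momentum hs hx)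
  filter_upwards [eventually_mem_fdom D.curve hs hx] with r hr
  exact D.pairT_momentum hr.1 hr.2

/-- This is the integration by parts formula in differential form. The product rule applied to
`Dp(δ_ηγ)ξ + p ζ`, together with `ṗ = f`, reproduces every term of `dT_dT_var₂` except that
`Df(δ_ηγ)ξ` is replaced by `d/dt(Dp(δ_ηγ))ξ`; the discrepancy is the Jacobi term. -/
theorem hasDerivWithinAt_pairT_momentum (hs : s ∈ Icc t₀ t₁) :
    HasDerivWithinAt (fun s => pairT (Δξ s)
      (tangentMap (𝓘(ℝ, B).prod 𝓘(ℝ, F)) (𝓘(ℝ, B).prod 𝓘(ℝ, F →L[ℝ] ℝ)) (𝔞.legendre L)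
        (𝔞.var t₀ t₁ γ η s)))
      (dT (𝓘(ℝ, B).prod 𝓘(ℝ, F)).tangent (dT (𝓘(ℝ, B).prod 𝓘(ℝ, F)) L)
        (𝔞.var₂ t₀ t₁ γ η Δξ s) - pairT (Δξ s) (vertPart (𝔞.jacobiDefect L t₀ t₁ γ η s)))
      (Icc t₀ t₁) s := by
  have hx := mem_fdom_self B F E (γ s).1
  have hxd := fdom_subset hx
  have d1 := ((D.contDiffWithinAt_momCo hs hx).differentiableWithinAt one_ne_zero).hasDerivWithinAt
  have d2 := ((contDiffWithinAt_alongCo D.two_le D.xi hs hxd).differentiableWithinAt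
    two_ne_zero).hasDerivWithinAt
  have d3 := ((D.lift.contDiffWithinAt_liftCo D.two_le hs hxd).differentiableWithinAt
    two_ne_zero).hasDerivWithinAt
  have d0 : HasDerivWithinAt (fun r => legCo (γ s).1 L (co B (γ s).1 (γ r)))
      (𝔞.forceCo (γ s).1 L (co B (γ s).1 (γ s))) (Icc t₀ t₁) s := (D.hasDerivWithinAt hs hx).snd
  have d4 := (d1.clm_apply d2).fun_add (d0.clm_apply d3)
  rw [D.dT_dT_var₂ hs hx, D.pairT_vertPart hs]
  refine (d4.congr_deriv ?_).congr_of_eventuallyEq ?_ (D.pairT_momentum hs hx)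
  · rw [jacobiCo, sub_apply]
    ring
  · filter_upwards [eventually_mem_fdom D.curve hs hx] with r hr
    exact D.pairT_momentum hr.1 hr.2

theorem continuousOn_dT_dT_var₂ : ContinuousOn (fun s => dT (𝓘(ℝ, B).prod 𝓘(ℝ, F)).tangent
    (dT (𝓘(ℝ, B).prod 𝓘(ℝ, F)) L) (𝔞.var₂ t₀ t₁ γ η Δξ s)) (Icc t₀ t₁) := by
  intro s hs
  have hx := mem_fdom_self B F E (γ s).1
  have hxd := fdom_subset hx
  have c1 := contDiffWithinAt_one_comp_co D.two_le D.curve hs hx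
    ((𝔞.contDiffAt_forceCo D.smooth hx).fderiv_right (m := ∞) (by simp))
  have c2 := contDiffWithinAt_one_comp_co D.two_le D.curve hs hx (𝔞.contDiffAt_forceCo D.smooth hx)
  have c3 := contDiffWithinAt_one_comp_co D.two_le D.curve hs hx (contDiffAt_legCo D.smooth hxd)
  have c4 := contDiffWithinAt_varCo (𝔞 := 𝔞) D.lt D.two_le D.curve D.eta hs hx
  have c5 := contDiffWithinAt_alongCo D.two_le D.xi hs hxd
  have c6 := D.contDiffWithinAt_momCo hs hx
  have c7 := D.lift.contDiffWithinAt_liftCo D.two_le hs hxd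
  have h := (((c1.clm_apply c4).clm_apply (c5.of_le one_le_two)).add
    (c6.clm_apply (contDiffWithinAt_derivWithin D.lt hs c5))).add
    ((c2.clm_apply (c7.of_le one_le_two)).add
      (c3.clm_apply (contDiffWithinAt_derivWithin D.lt hs c7)))
  refine h.continuousWithinAt.congr_of_eventuallyEq ?_ (D.dT_dT_var₂ hs hx)
  filter_upwards [eventually_mem_fdom D.curve hs hx] with r hr
  exact D.dT_dT_var₂ hr.1 hr.2

/-- For a null vector both `ξ` and the free component of `Δξ` vanish, and the pairing is linear in
these two. Vanishing of `ξ` alone would leave the boundary term `p ζ`. -/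
theorem pairT_momentum_eq_zero (hs : s ∈ Icc t₀ t₁) (h : Δξ s = nullVec (Tτ (Δξ s))) :
    pairT (Δξ s) (tangentMap (𝓘(ℝ, B).prod 𝓘(ℝ, F)) (𝓘(ℝ, B).prod 𝓘(ℝ, F →L[ℝ] ℝ))
      (𝔞.legendre L) (𝔞.var t₀ t₁ γ η s)) = 0 := by
  have hx := mem_fdom_self B F E (γ s).1
  have hxd := fdom_subset hx
  have h1 := (congrArg (cE (γ s).1) h).trans
    (tco_nullVec (Tτ (Δξ s)) (x₀ := (γ s).1) (D.lift.base_mem hs hxd))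
  have h2 := D.lift.cE_eq hs hxd
  have h3 : alongCo (γ s).1 γ ξ s = 0 :=
    (congrArg (fun c => c.1.2) h2).symm.trans (congrArg (fun c => c.1.2) h1)
  have h4 : liftCo (γ s).1 Δξ s = 0 := congrArg (fun c => c.2.2) h1
  rw [D.pairT_momentum hs hx, h3, h4, map_zero, map_zero, add_zero]

/-- `pairT_vertPart` expresses the pairing in a chart which changes with `s`, so continuity in `s`
is not visible there. Written as a continuous function minus the derivative of a `C¹` function, the
pairing is seen to be continuous, hence integrable. -/
theorem eqOn_pairT_vertPart : EqOn
    (fun s => pairT (Δξ s) (vertPart (𝔞.jacobiDefect L t₀ t₁ γ η s)))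
    (fun s => dT (𝓘(ℝ, B).prod 𝓘(ℝ, F)).tangent (dT (𝓘(ℝ, B).prod 𝓘(ℝ, F)) L)
        (𝔞.var₂ t₀ t₁ γ η Δξ s) - derivWithin (fun s => pairT (Δξ s)
      (tangentMap (𝓘(ℝ, B).prod 𝓘(ℝ, F)) (𝓘(ℝ, B).prod 𝓘(ℝ, F →L[ℝ] ℝ)) (𝔞.legendre L)
        (𝔞.var t₀ t₁ γ η s))) (Icc t₀ t₁) s) (Icc t₀ t₁) := by
  intro s hs
  have h := (D.hasDerivWithinAt_pairT_momentum hs).derivWithin (uniqueDiffOn_Icc D.lt s hs)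
  simp only
  rw [h]; ring

theorem intervalIntegrable_dT_dT_var₂ : IntervalIntegrable
    (fun s => dT (𝓘(ℝ, B).prod 𝓘(ℝ, F)).tangent (dT (𝓘(ℝ, B).prod 𝓘(ℝ, F)) L)
      (𝔞.var₂ t₀ t₁ γ η Δξ s)) MeasureTheory.volume t₀ t₁ :=
  D.continuousOn_dT_dT_var₂.intervalIntegrable_of_Icc D.lt.le

theorem continuousOn_derivWithin_pairT : ContinuousOn (derivWithin (fun s => pairT (Δξ s)
      (tangentMap (𝓘(ℝ, B).prod 𝓘(ℝ, F)) (𝓘(ℝ, B).prod 𝓘(ℝ, F →L[ℝ] ℝ)) (𝔞.legendre L)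
        (𝔞.var t₀ t₁ γ η s))) (Icc t₀ t₁)) (Icc t₀ t₁) :=
  D.contDiffOn_pairT_momentum.continuousOn_derivWithin (uniqueDiffOn_Icc D.lt) le_rfl

theorem intervalIntegrable_pairT_vertPart : IntervalIntegrable
    (fun s => pairT (Δξ s) (vertPart (𝔞.jacobiDefect L t₀ t₁ γ η s)))
    MeasureTheory.volume t₀ t₁ :=
  ((D.continuousOn_dT_dT_var₂.sub D.continuousOn_derivWithin_pairT).congr
    D.eqOn_pairT_vertPart).intervalIntegrable_of_Icc D.lt.le

/-- The integral of the derivative of the momentum pairing is the difference of its boundary values,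
and both are zero because `Δξ` is null at the end-points. -/
theorem integral_dT_dT_var₂ :
    ∫ s in t₀..t₁, dT (𝓘(ℝ, B).prod 𝓘(ℝ, F)).tangent (dT (𝓘(ℝ, B).prod 𝓘(ℝ, F)) L)
      (𝔞.var₂ t₀ t₁ γ η Δξ s) =
    ∫ s in t₀..t₁, pairT (Δξ s) (vertPart (𝔞.jacobiDefect L t₀ t₁ γ η s)) := by
  have h1 := intervalIntegral.integral_derivWithin_Icc_of_contDiffOn_Icc
    D.contDiffOn_pairT_momentum D.lt.le
  rw [D.pairT_momentum_eq_zero (right_mem_Icc.2 D.lt.le) D.lift.null_right,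
    D.pairT_momentum_eq_zero (left_mem_Icc.2 D.lt.le) D.lift.null_left, sub_zero] at h1
  have h2 := intervalIntegral.integral_congr (μ := MeasureTheory.volume) fun s hs =>
    D.eqOn_pairT_vertPart (uIcc_of_le D.lt.le ▸ hs)
  rw [intervalIntegral.integral_sub D.intervalIntegrable_dT_dT_var₂
    (D.continuousOn_derivWithin_pairT.intervalIntegrable_of_Icc D.lt.le), h1, sub_zero] at h2
  exact h2.symm

theorem integral_pairT_vertPart :
    ∫ s in t₀..t₁, pairT (Δξ s) (vertPart (𝔞.jacobiDefect L t₀ t₁ γ η s)) =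
    ∫ s in t₀..t₁, 𝔞.jacobiCo L (γ s).1 t₀ t₁ γ η s (alongCo (γ s).1 γ ξ s) := by
  refine intervalIntegral.integral_congr fun s hs => ?_
  rw [uIcc_of_le D.lt.le] at hs
  exact D.pairT_vertPart hs

theorem intervalIntegrable_jacobiCo : IntervalIntegrable
    (fun s => 𝔞.jacobiCo L (γ s).1 t₀ t₁ γ η s (alongCo (γ s).1 γ ξ s))
    MeasureTheory.volume t₀ t₁ := by
  refine D.intervalIntegrable_pairT_vertPart.congr_ae ?_
  refine (MeasureTheory.ae_restrict_mem measurableSet_uIoc).mono fun s hs => ?_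
  rw [uIoc_of_le D.lt.le] at hs
  exact D.pairT_vertPart (Ioc_subset_Icc_self hs)

end VariationData

end SkewAlgebroid

end Integrals

/-! ### Linearity of the Jacobi operator in `η` -/

section Linearity

variable {B : Type*} [NormedAddCommGroup B] [NormedSpace ℝ B]
  {F : Type*} [NormedAddCommGroup F] [NormedSpace ℝ F]
  {M : Type*} [TopologicalSpace M] [ChartedSpace B M]
  {E : M → Type*} [TopologicalSpace (TotalSpace F E)]
  [∀ x, AddCommGroup (E x)] [∀ x, Module ℝ (E x)] [∀ x, TopologicalSpace (E x)]
  [FiberBundle F E] [VectorBundle ℝ F E]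
  [∀ x, IsTopologicalAddGroup (E x)] [∀ x, ContinuousSMul ℝ (E x)]
  [IsManifold 𝓘(ℝ, B) ∞ M] [ContMDiffVectorBundle ∞ F E 𝓘(ℝ, B)]
  [FiniteDimensional ℝ B] [T2Space M] [FiniteDimensional ℝ F]


namespace SkewAlgebroid

variable {𝔞 : SkewAlgebroid B F E} {L : TotalSpace F E → ℝ} {t₀ t₁ s : ℝ} {k : ℕ∞}
  {γ : ℝ → TotalSpace F E} {x₀ : M} {η₁ η₂ : ∀ t, E (γ t).1}

theorem alongCo_linear (a b : ℝ) (hx : (γ s).1 ∈ dom B F E x₀) :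
    alongCo x₀ γ (a • η₁ + b • η₂) s = a • alongCo x₀ γ η₁ s + b • alongCo x₀ γ η₂ s :=
  (triv_add hx (a • η₁ s) (b • η₂ s)).trans
    (congrArg₂ (· + ·) (triv_smul hx a (η₁ s)) (triv_smul hx b (η₂ s)))

theorem derivWithin_linear {G : Type*} [NormedAddCommGroup G] [NormedSpace ℝ G] {f g h : ℝ → G}
    (a b : ℝ) (ht : t₀ < t₁) (hs : s ∈ Icc t₀ t₁)
    (hf : f =ᶠ[𝓝[Icc t₀ t₁] s] fun r => a • g r + b • h r)
    (hg : DifferentiableWithinAt ℝ g (Icc t₀ t₁) s)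
    (hh : DifferentiableWithinAt ℝ h (Icc t₀ t₁) s) :
    derivWithin f (Icc t₀ t₁) s =
      a • derivWithin g (Icc t₀ t₁) s + b • derivWithin h (Icc t₀ t₁) s :=
  (((hg.hasDerivWithinAt.const_smul a).fun_add
    (hh.hasDerivWithinAt.const_smul b)).congr_of_eventuallyEq hf
      (hf.self_of_nhdsWithin hs)).derivWithin (uniqueDiffOn_Icc ht s hs)

variable (hL : ContMDiff (𝓘(ℝ, B).prod 𝓘(ℝ, F)) 𝓘(ℝ, ℝ) ∞ L) (ht : t₀ < t₁) (hk : 2 ≤ k)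
  (hγ : ContMDiffOn 𝓘(ℝ, ℝ) (𝓘(ℝ, B).prod 𝓘(ℝ, F)) k γ (Icc t₀ t₁))
  (h₁ : ContMDiffOn 𝓘(ℝ, ℝ) (𝓘(ℝ, B).prod 𝓘(ℝ, F)) k
    (fun t => (⟨(γ t).1, η₁ t⟩ : TotalSpace F E)) (Icc t₀ t₁))
  (h₂ : ContMDiffOn 𝓘(ℝ, ℝ) (𝓘(ℝ, B).prod 𝓘(ℝ, F)) k
    (fun t => (⟨(γ t).1, η₂ t⟩ : TotalSpace F E)) (Icc t₀ t₁))
include ht hk hγ h₁ h₂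

theorem varCo_linear (a b : ℝ) (hs : s ∈ Icc t₀ t₁) (hx : (γ s).1 ∈ fdom B F E x₀) :
    𝔞.varCo x₀ t₀ t₁ γ (a • η₁ + b • η₂) s =
      a • 𝔞.varCo x₀ t₀ t₁ γ η₁ s + b • 𝔞.varCo x₀ t₀ t₁ γ η₂ s := by
  have hxd := fdom_subset hx
  have hd := derivWithin_linear a b ht hs
    ((eventually_mem_fdom hγ hs hx).mono fun r hr => alongCo_linear (η₁ := η₁) (η₂ := η₂) a b
      (fdom_subset hr.2))
    ((contDiffWithinAt_alongCo hk h₁ hs hxd).differentiableWithinAt two_ne_zero)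
    ((contDiffWithinAt_alongCo hk h₂ hs hxd).differentiableWithinAt two_ne_zero)
  refine Prod.ext ?_ ?_
  · simp only [varCo, alongCo_linear a b hxd, map_add, map_smul]; rfl
  · change derivWithin (alongCo x₀ γ (a • η₁ + b • η₂)) (Icc t₀ t₁) s + _ = _
    rw [alongCo_linear a b hxd, map_add, map_smul, map_smul]
    refine (congrArg (· + _) hd).trans ?_
    simp only [varCo, Prod.snd_add, Prod.smul_snd, smul_add]
    abel

include hL

theorem jacobiCo_linear (a b : ℝ) (hs : s ∈ Icc t₀ t₁) (hx : (γ s).1 ∈ fdom B F E x₀) :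
    𝔞.jacobiCo L x₀ t₀ t₁ γ (a • η₁ + b • η₂) s =
      a • 𝔞.jacobiCo L x₀ t₀ t₁ γ η₁ s + b • 𝔞.jacobiCo L x₀ t₀ t₁ γ η₂ s := by
  have hm : ∀ {η : ∀ t, E (γ t).1}, ContMDiffOn 𝓘(ℝ, ℝ) (𝓘(ℝ, B).prod 𝓘(ℝ, F)) k
      (fun t => (⟨(γ t).1, η t⟩ : TotalSpace F E)) (Icc t₀ t₁) →
      DifferentiableWithinAt ℝ (𝔞.momCo L x₀ t₀ t₁ γ η) (Icc t₀ t₁) s := fun h => by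
    have h1 : ContDiffAt ℝ 1 (fderiv ℝ (legCo x₀ L)) (co B x₀ (γ s)) :=
      (contDiffAt_legCo hL (fdom_subset hx)).fderiv_right
        (one_add_one_eq_two.trans_le ENat.LEInfty.out)
    have h2 := h1.comp_contDiffWithinAt s
      ((contDiffWithinAt_co_two hk hγ hs (fdom_subset hx)).of_le one_le_two)
    exact (h2.clm_apply (contDiffWithinAt_varCo ht hk hγ h hs hx)).differentiableWithinAt
      one_ne_zero
  -- Linearity of `momCo` at `s` alone would not pass to its time derivative; it is used for all
  -- nearby times, in the one fixed chart at `x₀`.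
  have hd := derivWithin_linear (f := 𝔞.momCo L x₀ t₀ t₁ γ (a • η₁ + b • η₂)) a b ht hs
    ((eventually_mem_fdom hγ hs hx).mono fun r hr => by
      simp only [momCo]
      rw [varCo_linear ht hk hγ h₁ h₂ a b hr.1 hr.2, map_add, map_smul, map_smul])
    (hm h₁) (hm h₂)
  rw [jacobiCo, hd, varCo_linear ht hk hγ h₁ h₂ a b hs hx, map_add, map_smul, map_smul,
    jacobiCo, jacobiCo]
  module

end SkewAlgebroid

end Linearity

/-! ### Existence of lifted generators -/

section LiftedGenerators

variable {B : Type*} [NormedAddCommGroup B] [NormedSpace ℝ B]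
  {F : Type*} [NormedAddCommGroup F] [NormedSpace ℝ F]
  {M : Type*} [TopologicalSpace M] [ChartedSpace B M]
  {E : M → Type*} [TopologicalSpace (TotalSpace F E)]
  [∀ x, AddCommGroup (E x)] [∀ x, Module ℝ (E x)] [∀ x, TopologicalSpace (E x)]
  [FiberBundle F E] [VectorBundle ℝ F E]
  [∀ x, IsTopologicalAddGroup (E x)] [∀ x, ContinuousSMul ℝ (E x)]
  [IsManifold 𝓘(ℝ, B) ∞ M] [ContMDiffVectorBundle ∞ F E 𝓘(ℝ, B)]
  [FiniteDimensional ℝ B] [T2Space M] [FiniteDimensional ℝ F]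


namespace SkewAlgebroid

variable (𝔞 : SkewAlgebroid B F E) {t₀ t₁ s : ℝ} {k : ℕ∞}
  {γ : ℝ → TotalSpace F E} {x₀ : M} {η ξ : ∀ t, E (γ t).1}

/-- The vector at `e` over `ρ(v)` which is horizontal in the coordinates at `x₀`. -/
def horVec (x₀ : M) (e : TotalSpace F E) (v : E e.1) :
    TangentSpace (𝓘(ℝ, B).prod 𝓘(ℝ, F)) e :=
  (mfderiv (𝓘(ℝ, B).prod 𝓘(ℝ, F)) 𝓘(ℝ, B × F)
    (extChartAt (𝓘(ℝ, B).prod 𝓘(ℝ, F)) (origin F E x₀)) e).inverse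
      ((𝔞.anc x₀ v, (0 : F)) : B × F)

theorem cE_horVec {e : TotalSpace F E} (he : e.1 ∈ dom B F E x₀) (v : E e.1) :
    cE x₀ (⟨e, 𝔞.horVec x₀ e v⟩ : TE B F E) = (co B x₀ e, (𝔞.anc x₀ v, 0)) := by
  have hinv := isInvertible_mfderiv_extChartAt (I := 𝓘(ℝ, B).prod 𝓘(ℝ, F))
    (x := origin F E x₀) (y := e) (by rw [extChartAt_source]; exact mem_source_origin he)
  exact Prod.ext (cE_fst he) (hinv.self_apply_inverse _)

theorem Tτ_horVec {e : TotalSpace F E} (he : e.1 ∈ dom B F E x₀) (v : E e.1) :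
    Tτ (⟨e, 𝔞.horVec x₀ e v⟩ : TE B F E) = 𝔞.ρ ⟨e.1, v⟩ := by
  refine tco_inj (q₀ := x₀) he.1 he.1 ((tco_Tτ _ he).trans ?_)
  have h := 𝔞.cE_horVec he v
  exact Prod.ext (congrArg (fun c => c.1.1) h) (congrArg (fun c => c.2.1) h)

theorem horVec_eq_nullVec {e : TotalSpace F E} (he : e.1 ∈ dom B F E x₀) (v : E e.1)
    (h0 : e.2 = 0) :
    (⟨e, 𝔞.horVec x₀ e v⟩ : TE B F E) = nullVec (𝔞.ρ ⟨e.1, v⟩) := by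
  refine tco_inj (q₀ := origin F E x₀) (mem_source_origin he) (mem_source_origin he) ?_
  refine (𝔞.cE_horVec he v).trans (Eq.trans ?_ (tco_nullVec (𝔞.ρ ⟨e.1, v⟩) (x₀ := x₀) he).symm)
  refine Prod.ext (Prod.ext rfl ?_) rfl
  have h := triv_smul he (0 : ℝ) e.2
  rw [zero_smul, zero_smul, ← h0] at h
  exact h

theorem contMDiffWithinAt_horVec
    (hγ : ContMDiffOn 𝓘(ℝ, ℝ) (𝓘(ℝ, B).prod 𝓘(ℝ, F)) k γ (Icc t₀ t₁))
    (hη : ContMDiffOn 𝓘(ℝ, ℝ) (𝓘(ℝ, B).prod 𝓘(ℝ, F)) k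
      (fun t => (⟨(γ t).1, η t⟩ : TotalSpace F E)) (Icc t₀ t₁))
    (hξ : ContMDiffOn 𝓘(ℝ, ℝ) (𝓘(ℝ, B).prod 𝓘(ℝ, F)) k
      (fun t => (⟨(γ t).1, ξ t⟩ : TotalSpace F E)) (Icc t₀ t₁))
    (hs : s ∈ Icc t₀ t₁) (hx : (γ s).1 ∈ fdom B F E x₀) :
    ContMDiffWithinAt 𝓘(ℝ, ℝ) (𝓘(ℝ, B).prod 𝓘(ℝ, F)).tangent k
      (fun r => (⟨⟨(γ r).1, ξ r⟩, 𝔞.horVec x₀ ⟨(γ r).1, ξ r⟩ (η r)⟩ : TE B F E))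
      (Icc t₀ t₁) s := by
  have hxd := fdom_subset hx
  have hev := eventually_mem_fdom hγ hs hx
  have cγ := contDiffWithinAt_co (hγ s hs) hxd
  have cξ := contDiffWithinAt_co (x₀ := x₀) (hξ s hs) hxd
  have cη := (contDiff_snd (E := B) (F := F)).contDiffAt.comp_contDiffWithinAt s
    (contDiffWithinAt_co (x₀ := x₀) (hη s hs) hxd)
  have cA := ((𝔞.contDiffAt_anchorCo_fst hx).of_le (m := k)
    (by exact_mod_cast le_top)).comp_contDiffWithinAt s cγ
  have h1 := cξ.prodMk ((cA.clm_apply cη).prodMk (contDiffWithinAt_const (c := (0 : F))))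
  have key : ∀ r, (γ r).1 ∈ fdom B F E x₀ →
      cE x₀ (⟨⟨(γ r).1, ξ r⟩, 𝔞.horVec x₀ ⟨(γ r).1, ξ r⟩ (η r)⟩ : TE B F E) =
      (co B x₀ (⟨(γ r).1, ξ r⟩ : TotalSpace F E),
        (𝔞.anchorCo x₀ (co B x₀ (γ r)).1 (co B x₀ (⟨(γ r).1, η r⟩ : TotalSpace F E)).2, 0)) :=
    fun r hr => (𝔞.cE_horVec (e := ⟨(γ r).1, ξ r⟩) (fdom_subset hr) (η r)).trans
      (Prod.ext rfl (Prod.ext (𝔞.anchorCo_apply (fdom_subset hr) (η r)).symm rfl))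
  refine contMDiffWithinAt_of_tco (q₀ := origin F E x₀)
    (hev.mono fun r hr => mem_source_origin (fdom_subset hr.2)) (mem_source_origin hxd) ?_
  exact h1.congr_of_eventuallyEq (hev.mono fun r hr => key r hr.2) (key s hx)

/-- At each time the vectors at `ξ` lying over `ρ(η)` form an affine space, so local horizontal
lifts may be averaged with weights of sum `1`. Where `ξ = 0` every local lift is the null vector
over `ρ(η)`, and so is the average. -/
theorem exists_isLiftedGenerator
    (hγ : ContMDiffOn 𝓘(ℝ, ℝ) (𝓘(ℝ, B).prod 𝓘(ℝ, F)) k γ (Icc t₀ t₁)) (ht : t₀ < t₁)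
    (hη : ContMDiffOn 𝓘(ℝ, ℝ) (𝓘(ℝ, B).prod 𝓘(ℝ, F)) k
      (fun t => (⟨(γ t).1, η t⟩ : TotalSpace F E)) (Icc t₀ t₁))
    (hξ : ContMDiffOn 𝓘(ℝ, ℝ) (𝓘(ℝ, B).prod 𝓘(ℝ, F)) k
      (fun t => (⟨(γ t).1, ξ t⟩ : TotalSpace F E)) (Icc t₀ t₁))
    (hξ₀ : ξ t₀ = 0) (hξ₁ : ξ t₁ = 0) : ∃ Δξ, 𝔞.IsLiftedGenerator k t₀ t₁ γ η ξ Δξ := by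
  have hU : ∀ τ : ℝ, ∃ U : Set ℝ, IsOpen U ∧ (τ ∈ Icc t₀ t₁ → τ ∈ U) ∧
      ∀ r ∈ U, r ∈ Icc t₀ t₁ → (γ r).1 ∈ fdom B F E (γ τ).1 := fun τ => by
    by_cases hτ : τ ∈ Icc t₀ t₁
    · obtain ⟨U, hU, hτU, hsub⟩ := mem_nhdsWithin.1
        (eventually_mem_fdom hγ hτ (mem_fdom_self B F E (γ τ).1))
      exact ⟨U, hU, fun _ => hτU, fun r hr hrs => (hsub ⟨hr, hrs⟩).2⟩
    · exact ⟨∅, isOpen_empty, fun h => absurd h hτ, fun r hr => absurd hr (notMem_empty r)⟩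
  choose U hUo hUm hUf using hU
  obtain ⟨T, hT⟩ := (isCompact_Icc (a := t₀) (b := t₁)).elim_finite_subcover U hUo
    fun τ hτ => mem_iUnion.2 ⟨τ, hUm τ hτ⟩
  -- The partition of unity is in time. Finitely many pieces suffice by compactness, and on each of
  -- them the base path stays in one coordinate domain.
  obtain ⟨χ, hχ⟩ := SmoothPartitionOfUnity.exists_isSubordinate 𝓘(ℝ, ℝ)
    (isClosed_Icc (a := t₀) (b := t₁)) (fun i : T => U i) (fun i => hUo i)
    (fun τ hτ => by
      obtain ⟨i, hi, hτi⟩ := mem_iUnion₂.1 (hT hτ)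
      exact mem_iUnion.2 ⟨⟨i, hi⟩, hτi⟩)
  have hsum : ∀ r ∈ Icc t₀ t₁, ∑ i, χ i r = 1 := fun r hr => by
    rw [← finsum_eq_sum_of_fintype]; exact χ.sum_eq_one hr
  -- `horVec` uses `inverse`, which has a default value where the derivative is not invertible.
  -- Nonzero weight at a time in `[t₀, t₁]` guarantees that the point lies in the right coordinate
  -- domain, so spurious values are multiplied by `0`.
  have hmem : ∀ i r, r ∈ Icc t₀ t₁ → χ i r ≠ 0 → (γ r).1 ∈ fdom B F E (γ i).1 := fun i r hr h =>
    hUf i r (hχ i (subset_tsupport _ h)) hr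
  obtain ⟨Δξ, hΔ⟩ : ∃ Δξ : ℝ → TE B F E, Δξ = fun r => ⟨⟨(γ r).1, ξ r⟩,
    ∑ i, χ i r • 𝔞.horVec (γ i).1 ⟨(γ r).1, ξ r⟩ (η r)⟩ := ⟨_, rfl⟩
  have hco : ∀ (x₀ : M) (r : ℝ), (cE x₀ (Δξ r)).2 = ∑ i, χ i r •
      (cE x₀ (⟨⟨(γ r).1, ξ r⟩, 𝔞.horVec (γ i).1 ⟨(γ r).1, ξ r⟩ (η r)⟩ : TE B F E)).2 := by
    intro x₀ r
    rw [hΔ]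
    refine (map_sum (mfderiv (𝓘(ℝ, B).prod 𝓘(ℝ, F)) 𝓘(ℝ, B × F)
      (extChartAt (𝓘(ℝ, B).prod 𝓘(ℝ, F)) (origin F E x₀)) (⟨(γ r).1, ξ r⟩ : TotalSpace F E))
      _ _).trans (Finset.sum_congr rfl fun i _ => ?_)
    exact map_smul (mfderiv (𝓘(ℝ, B).prod 𝓘(ℝ, F)) 𝓘(ℝ, B × F)
      (extChartAt (𝓘(ℝ, B).prod 𝓘(ℝ, F)) (origin F E x₀)) (⟨(γ r).1, ξ r⟩ : TotalSpace F E)) _ _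
  have hbase : ∀ r, (Δξ r).1 = ⟨(γ r).1, ξ r⟩ := fun r => by rw [hΔ]
  have hbm : ∀ {V : Set M} (r : ℝ), (γ r).1 ∈ V → (Δξ r).1.1 ∈ V := fun r h => by
    rw [hbase]; exact h
  have havg : ∀ (r : ℝ) (g : T → B × F) (g₀ : B × F), r ∈ Icc t₀ t₁ →
      (∀ i, χ i r ≠ 0 → g i = g₀) → ∑ i, χ i r • g i = g₀ := by
    intro r g g₀ hr hg
    rw [← one_smul ℝ g₀, ← hsum r hr, Finset.sum_smul]
    refine Finset.sum_congr rfl fun i _ => ?_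
    by_cases h : χ i r = 0
    · rw [h, zero_smul, zero_smul]
    · rw [hg i h]
  have hanch : ∀ r ∈ Icc t₀ t₁, Tτ (Δξ r) = 𝔞.ρ ⟨(γ r).1, η r⟩ := by
    intro r hr
    have hd := mem_dom_self B F E (γ r).1
    refine tco_inj (q₀ := (γ r).1) (hbm (V := (chartAt B (γ r).1).source) r hd.1) hd.1
      ((tco_Tτ (Δξ r) (hbm r hd)).trans (Prod.ext ?_ ?_))
    · refine (congrArg (fun c : (B × F) × B × F => c.1.1) (Prod.ext (cE_fst (hbm r hd)) rfl :
        cE (γ r).1 (Δξ r) = (co B (γ r).1 (Δξ r).1, (cE (γ r).1 (Δξ r)).2))).trans ?_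
      have hp : (Δξ r).1.1 = (γ r).1 := by rw [hbase r]
      exact congrArg (extChartAt 𝓘(ℝ, B) (γ r).1) hp
    · refine (congrArg Prod.fst (hco (γ r).1 r)).trans ?_
      rw [Prod.fst_sum]
      have h := congrArg Prod.fst (havg r (fun i => ((cE (γ r).1 (⟨⟨(γ r).1, ξ r⟩,
        𝔞.horVec (γ i).1 ⟨(γ r).1, ξ r⟩ (η r)⟩ : TE B F E)).2.1, 0))
        (𝔞.anc (γ r).1 (η r), 0) hr fun i hi => ?_)
      · rw [Prod.fst_sum] at h
        exact h
      · have h1 := congrArg (tco 𝓘(ℝ, B) (γ r).1)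
          (𝔞.Tτ_horVec (e := ⟨(γ r).1, ξ r⟩) (fdom_subset (hmem i r hr hi)) (η r))
        exact Prod.ext (congrArg Prod.snd ((tco_Tτ _ hd).symm.trans h1)) rfl
  have hnull : ∀ r ∈ Icc t₀ t₁, ξ r = 0 → Δξ r = nullVec (Tτ (Δξ r)) := by
    intro r hr h0
    have hd := mem_dom_self B F E (γ r).1
    have hN : ∀ i, χ i r ≠ 0 → (⟨⟨(γ r).1, ξ r⟩,
        𝔞.horVec (γ i).1 ⟨(γ r).1, ξ r⟩ (η r)⟩ : TE B F E) = nullVec (𝔞.ρ ⟨(γ r).1, η r⟩) :=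
      fun i hi => 𝔞.horVec_eq_nullVec (e := ⟨(γ r).1, ξ r⟩) (fdom_subset (hmem i r hr hi)) (η r) h0
    refine Eq.trans ?_ (congrArg nullVec (hanch r hr)).symm
    obtain ⟨i, hi⟩ : ∃ i, χ i r ≠ 0 := by
      by_contra! h
      have := hsum r hr
      simp only [h, Finset.sum_const_zero] at this
      exact zero_ne_one this
    refine tco_inj (q₀ := origin F E (γ r).1) (mem_source_origin (hbm r hd))
      (mem_source_origin hd) (Prod.ext ?_ ((hco (γ r).1 r).trans
        (havg r _ _ hr fun i hi => congrArg (fun X => (cE (γ r).1 X).2) (hN i hi))))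
    refine Eq.trans ?_ (congrArg (fun X => (cE (γ r).1 X).1) (hN i hi))
    refine (cE_fst (hbm r hd)).trans (Eq.trans ?_ (cE_fst (X := ⟨⟨(γ r).1, ξ r⟩, _⟩) hd).symm)
    exact congrArg (co B (γ r).1) (hbase r)
  refine ⟨Δξ, fun s hs => ?_, fun t _ => hbase t, hanch, hnull t₀ (left_mem_Icc.2 ht.le) hξ₀,
    hnull t₁ (right_mem_Icc.2 ht.le) hξ₁⟩
  have hd := mem_dom_self B F E (γ s).1
  have hterm : ∀ i, ContDiffWithinAt ℝ k (fun r => χ i r • (cE (γ s).1 (⟨⟨(γ r).1, ξ r⟩,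
      𝔞.horVec (γ i).1 ⟨(γ r).1, ξ r⟩ (η r)⟩ : TE B F E)).2) (Icc t₀ t₁) s := by
    intro i
    -- Either `s` is in the support of the weight and the local lift is smooth near `s`, or the
    -- weight vanishes near `s` and the term is locally zero, whatever the lift is there.
    by_cases hi : s ∈ tsupport (χ i)
    · have h1 := contDiffWithinAt_tco (q₀ := origin F E (γ s).1)
        (𝔞.contMDiffWithinAt_horVec hγ hη hξ hs (hUf i s (hχ i hi) hs)) (mem_source_origin hd)
      exact ((χ i).contMDiff.contDiff.of_le
        (by exact_mod_cast le_top)).contDiffWithinAt.smul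
        (contDiff_snd.contDiffAt.comp_contDiffWithinAt s h1)
    · have h0 := notMem_tsupport_iff_eventuallyEq.1 hi
      refine (contDiffWithinAt_const (c := (0 : B × F))).congr_of_eventuallyEq
        ((h0.filter_mono nhdsWithin_le_nhds).mono fun r hr => ?_) ?_
      · exact (congrArg (· • _) hr).trans (zero_smul ℝ _)
      · exact (congrArg (· • _) h0.self_of_nhds).trans (zero_smul ℝ _)
  have h1 := (contDiffWithinAt_co (hξ s hs) hd).prodMk
    (ContDiffWithinAt.sum (s := Finset.univ) fun i _ => hterm i)
  have hev := (eventually_mem_fdom hγ hs (mem_fdom_self B F E (γ s).1)).mono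
    fun r hr => fdom_subset hr.2
  have key : ∀ r, (γ r).1 ∈ dom B F E (γ s).1 → cE (γ s).1 (Δξ r) =
      (co B (γ s).1 (⟨(γ r).1, ξ r⟩ : TotalSpace F E), ∑ i, χ i r • (cE (γ s).1
        (⟨⟨(γ r).1, ξ r⟩, 𝔞.horVec (γ i).1 ⟨(γ r).1, ξ r⟩ (η r)⟩ : TE B F E)).2) :=
    fun r hr => Prod.ext ((cE_fst (hbm r hr)).trans (congrArg (co B (γ s).1) (hbase r)))
      (hco (γ s).1 r)
  exact contMDiffWithinAt_of_tco (q₀ := origin F E (γ s).1)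
    (hev.mono fun r hr => mem_source_origin (hbm r hr)) (mem_source_origin (hbm s hd))
    (h1.congr_of_eventuallyEq (hev.mono key) (key s hd))

end SkewAlgebroid

end LiftedGenerators

/-! ### The second variation -/

section SecondVariation

variable {B : Type*} [NormedAddCommGroup B] [NormedSpace ℝ B]
  {F : Type*} [NormedAddCommGroup F] [NormedSpace ℝ F]
  {M : Type*} [TopologicalSpace M] [ChartedSpace B M]
  {E : M → Type*} [TopologicalSpace (TotalSpace F E)]
  [∀ x, AddCommGroup (E x)] [∀ x, Module ℝ (E x)] [∀ x, TopologicalSpace (E x)]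
  [FiberBundle F E] [VectorBundle ℝ F E]
  [∀ x, IsTopologicalAddGroup (E x)] [∀ x, ContinuousSMul ℝ (E x)]
  [IsManifold 𝓘(ℝ, B) ∞ M] [ContMDiffVectorBundle ∞ F E 𝓘(ℝ, B)]
  [FiniteDimensional ℝ B] [T2Space M] [FiniteDimensional ℝ F]


namespace SkewAlgebroid

variable (𝔞 : SkewAlgebroid B F E) (L : TotalSpace F E → ℝ) {t₀ t₁ : ℝ} {k : ℕ∞}
  {γ : ℝ → TotalSpace F E}

/-- The integral of the Jacobi operator along `η` paired with `ξ`, with the coordinates centred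
at the base point at each time. -/
def jacobiIntegral (t₀ t₁ : ℝ) (γ : ℝ → TotalSpace F E) (η ξ : ∀ t, E (γ t).1) : ℝ :=
  ∫ s in t₀..t₁, 𝔞.jacobiCo L (γ s).1 t₀ t₁ γ η s (alongCo (γ s).1 γ ξ s)

variable {𝔞 L} (h𝔞 : 𝔞.IsAlmostLie)
  (hL : ContMDiff (𝓘(ℝ, B).prod 𝓘(ℝ, F)) 𝓘(ℝ, ℝ) ∞ L) (ht : t₀ < t₁) (hk : 2 ≤ k)
  (hγ : ContMDiffOn 𝓘(ℝ, ℝ) (𝓘(ℝ, B).prod 𝓘(ℝ, F)) k γ (Icc t₀ t₁))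
  (hEL : 𝔞.IsELSolution L t₀ t₁ γ)
include h𝔞 hL ht hk hEL

/-- The integrand does not mention `Δξ`, but its integrability comes from the pairing with some
lifted generator, whose existence is therefore used. Without integrability the integral would not be
additive. -/
theorem intervalIntegrable_jacobiCo (η : sectionsAlong k t₀ t₁ γ hγ)
    (ξ : sectionsAlong₀ k t₀ t₁ γ hγ) : IntervalIntegrable
    (fun s => 𝔞.jacobiCo L (γ s).1 t₀ t₁ γ η s (alongCo (γ s).1 γ ξ s))
    MeasureTheory.volume t₀ t₁ := by
  obtain ⟨Δξ, hΔ⟩ := 𝔞.exists_isLiftedGenerator hγ ht η.2 ξ.2.1 ξ.2.2.1 ξ.2.2.2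
  exact (VariationData.mk h𝔞 hL ht hk hγ hEL η.2 ξ.2.1 hΔ).intervalIntegrable_jacobiCo

theorem jacobiIntegral_linear_left (a b : ℝ) (η₁ η₂ : sectionsAlong k t₀ t₁ γ hγ)
    (ξ : sectionsAlong₀ k t₀ t₁ γ hγ) :
    𝔞.jacobiIntegral L t₀ t₁ γ (a • η₁.1 + b • η₂.1) ξ =
      a * 𝔞.jacobiIntegral L t₀ t₁ γ η₁ ξ + b * 𝔞.jacobiIntegral L t₀ t₁ γ η₂ ξ := by
  have i₁ := intervalIntegrable_jacobiCo h𝔞 hL ht hk hγ hEL η₁ ξ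
  have i₂ := intervalIntegrable_jacobiCo h𝔞 hL ht hk hγ hEL η₂ ξ
  rw [jacobiIntegral, jacobiIntegral, jacobiIntegral, ← intervalIntegral.integral_const_mul,
    ← intervalIntegral.integral_const_mul,
    ← intervalIntegral.integral_add (i₁.const_mul a) (i₂.const_mul b)]
  refine intervalIntegral.integral_congr fun s hs => ?_
  rw [uIcc_of_le ht.le] at hs
  exact congrArg (fun l : F →L[ℝ] ℝ => l (alongCo (γ s).1 γ ξ s))
    (jacobiCo_linear hL ht hk hγ η₁.2 η₂.2 a b hs (mem_fdom_self B F E (γ s).1))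

theorem jacobiIntegral_linear_right (a b : ℝ) (η : sectionsAlong k t₀ t₁ γ hγ)
    (ξ₁ ξ₂ : sectionsAlong₀ k t₀ t₁ γ hγ) :
    𝔞.jacobiIntegral L t₀ t₁ γ η (a • ξ₁.1 + b • ξ₂.1) =
      a * 𝔞.jacobiIntegral L t₀ t₁ γ η ξ₁ + b * 𝔞.jacobiIntegral L t₀ t₁ γ η ξ₂ := by
  have i₁ := intervalIntegrable_jacobiCo h𝔞 hL ht hk hγ hEL η ξ₁
  have i₂ := intervalIntegrable_jacobiCo h𝔞 hL ht hk hγ hEL η ξ₂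
  rw [jacobiIntegral, jacobiIntegral, jacobiIntegral, ← intervalIntegral.integral_const_mul,
    ← intervalIntegral.integral_const_mul,
    ← intervalIntegral.integral_add (i₁.const_mul a) (i₂.const_mul b)]
  refine intervalIntegral.integral_congr fun s _ => ?_
  have h := alongCo_linear (η₁ := ξ₁.1) (η₂ := ξ₂.1) a b (mem_dom_self B F E (γ s).1)
  exact (congrArg (𝔞.jacobiCo L (γ s).1 t₀ t₁ γ η s) h).trans (by
    rw [map_add, map_smul, map_smul, smul_eq_mul, smul_eq_mul])

/-- The form is defined by the integral of the Jacobi term, in which no lifted generator occurs.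
Independence of `Δξ` then follows once the two formulas are proved for each `Δξ`. -/
theorem exists_secondVariation :
    ∃ δ2S : sectionsAlong k t₀ t₁ γ hγ →ₗ[ℝ] sectionsAlong₀ k t₀ t₁ γ hγ →ₗ[ℝ] ℝ,
      ∀ η ξ, δ2S η ξ = 𝔞.jacobiIntegral L t₀ t₁ γ η ξ := by
  refine ⟨LinearMap.mk₂ ℝ (fun η ξ => 𝔞.jacobiIntegral L t₀ t₁ γ η ξ) ?_ ?_ ?_ ?_,
    fun _ _ => rfl⟩
  · intro η₁ η₂ ξ
    have h := jacobiIntegral_linear_left h𝔞 hL ht hk hγ hEL 1 1 η₁ η₂ ξ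
    rwa [one_smul, one_smul, one_mul, one_mul] at h
  · intro c η ξ
    have h := jacobiIntegral_linear_left h𝔞 hL ht hk hγ hEL c 0 η η ξ
    rwa [zero_smul, zero_mul, add_zero, add_zero] at h
  · intro η ξ₁ ξ₂
    have h := jacobiIntegral_linear_right h𝔞 hL ht hk hγ hEL 1 1 η ξ₁ ξ₂
    rwa [one_smul, one_smul, one_mul, one_mul] at h
  · intro c η ξ
    have h := jacobiIntegral_linear_right h𝔞 hL ht hk hγ hEL c 0 η ξ ξ
    rwa [zero_smul, zero_mul, add_zero, add_zero] at h

end SkewAlgebroid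

end SecondVariation

end Algebroid

end

open Algebroid in
theorem mainTheorem3
    {B : Type*} [NormedAddCommGroup B] [NormedSpace ℝ B] [FiniteDimensional ℝ B]
    {F : Type*} [NormedAddCommGroup F] [NormedSpace ℝ F] [FiniteDimensional ℝ F]
    {M : Type*} [TopologicalSpace M] [T2Space M] [SigmaCompactSpace M]
    [ChartedSpace B M] [IsManifold 𝓘(ℝ, B) ∞ M]
    {E : M → Type*} [TopologicalSpace (TotalSpace F E)]
    [∀ x, AddCommGroup (E x)] [∀ x, Module ℝ (E x)] [∀ x, TopologicalSpace (E x)]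
    [∀ x, IsTopologicalAddGroup (E x)] [∀ x, ContinuousSMul ℝ (E x)]
    [FiberBundle F E] [VectorBundle ℝ F E] [ContMDiffVectorBundle ∞ F E 𝓘(ℝ, B)]
    (𝔞 : SkewAlgebroid B F E) (h𝔞 : 𝔞.IsAlmostLie)
    (L : TotalSpace F E → ℝ) (hL : ContMDiff (𝓘(ℝ, B).prod 𝓘(ℝ, F)) 𝓘(ℝ, ℝ) ∞ L)
    (t₀ t₁ : ℝ) (ht : t₀ < t₁) (k : ℕ∞) (hk : 2 ≤ k)
    (γ : ℝ → TotalSpace F E)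
    (hγ : ContMDiffOn 𝓘(ℝ, ℝ) (𝓘(ℝ, B).prod 𝓘(ℝ, F)) k γ (Icc t₀ t₁))
    (hEL : 𝔞.IsELSolution L t₀ t₁ γ) :
    -- the morphism `ε` and the admissible variations of `γ` are well defined
    (∀ (e : TotalSpace F E) (A : TangentSpace (𝓘(ℝ, B).prod 𝓘(ℝ, F)) e →L[ℝ] ℝ),
      ∃! V, 𝔞.IsEps e A V) ∧
    (∀ ξ ∈ sectionsAlong k t₀ t₁ γ hγ, ∀ t ∈ Icc t₀ t₁,
      ∃! V : TangentSpace (𝓘(ℝ, B).prod 𝓘(ℝ, F)) (γ t),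
        𝔞.Kappa (prolong (𝓘(ℝ, B).prod 𝓘(ℝ, F)) t₀ t₁
          (fun s => (⟨(γ s).1, ξ s⟩ : TotalSpace F E)) t) ⟨γ t, V⟩) ∧
    -- the second variation is a well-defined bilinear form
    ∃ δ2S : sectionsAlong k t₀ t₁ γ hγ →ₗ[ℝ] sectionsAlong₀ k t₀ t₁ γ hγ →ₗ[ℝ] ℝ,
      ∀ (η : sectionsAlong k t₀ t₁ γ hγ) (ξ : sectionsAlong₀ k t₀ t₁ γ hγ),
        (∃ Δξ, 𝔞.IsLiftedGenerator k t₀ t₁ γ η ξ Δξ) ∧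
        ∀ Δξ, 𝔞.IsLiftedGenerator k t₀ t₁ γ η ξ Δξ →
          -- the curve `δ_{(Δξ, η)} γ` is well defined, with the expected projections
          (∀ t ∈ Icc t₀ t₁,
            (∃! W : TangentSpace (𝓘(ℝ, B).prod 𝓘(ℝ, F)).tangent (𝔞.var t₀ t₁ γ η t),
              𝔞.dTKappa (prolong (𝓘(ℝ, B).prod 𝓘(ℝ, F)).tangent t₀ t₁ Δξ t)
                ⟨𝔞.var t₀ t₁ γ η t, W⟩) ∧
            (𝔞.var₂ t₀ t₁ γ η Δξ t).1 = 𝔞.var t₀ t₁ γ ξ t ∧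
            tangentMap (𝓘(ℝ, B).prod 𝓘(ℝ, F)).tangent (𝓘(ℝ, B).prod 𝓘(ℝ, F))
              (fun X : TE B F E => X.1) (𝔞.var₂ t₀ t₁ γ η Δξ t) = 𝔞.var t₀ t₁ γ η t) ∧
          -- `δ²S_L(γ)(η, ξ) = ∫ ⟨d d_T L(δ_ξ γ), δ_{(Δξ, η)} γ⟩ dt`
          IntervalIntegrable (fun t => dT (𝓘(ℝ, B).prod 𝓘(ℝ, F)).tangent
            (dT (𝓘(ℝ, B).prod 𝓘(ℝ, F)) L) (𝔞.var₂ t₀ t₁ γ η Δξ t))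
            MeasureTheory.volume t₀ t₁ ∧
          δ2S η ξ = ∫ t in t₀..t₁, dT (𝓘(ℝ, B).prod 𝓘(ℝ, F)).tangent
            (dT (𝓘(ℝ, B).prod 𝓘(ℝ, F)) L) (𝔞.var₂ t₀ t₁ γ η Δξ t) ∧
          -- `κ_{E*} ∘ TΛ_L(δ_η γ)` and `d/dt Tλ_L(δ_η γ)` have a vertical difference
          (∀ t ∈ Icc t₀ t₁,
            (𝔞.jacobiForce L t₀ t₁ γ η t).1 = (𝔞.jacobiMomentum L t₀ t₁ γ η t).1 ∧
            IsVert (𝔞.jacobiDefect L t₀ t₁ γ η t) ∧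
            Tπ (vertPart (𝔞.jacobiDefect L t₀ t₁ γ η t)) = Tτ (Δξ t)) ∧
          -- `δ²S_L(γ)(η, ξ) = ∫ ⟨Δξ, 𝒱_{κ_{E*} ∘ TΛ_L(δ_η γ) - d/dt Tλ_L(δ_η γ)}⟩_{Tτ} dt`
          IntervalIntegrable (fun t => pairT (Δξ t)
            (vertPart (𝔞.jacobiDefect L t₀ t₁ γ η t))) MeasureTheory.volume t₀ t₁ ∧
          δ2S η ξ = ∫ t in t₀..t₁,
            pairT (Δξ t) (vertPart (𝔞.jacobiDefect L t₀ t₁ γ η t)) := by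
  obtain ⟨δ2S, hδ⟩ := SkewAlgebroid.exists_secondVariation h𝔞 hL ht hk hγ hEL
  refine ⟨fun e A => 𝔞.existsUnique_isEps e A, fun ξ hξ t hs =>
    SkewAlgebroid.existsUnique_kappa_prolong hL ht hk hγ hEL hξ hs, δ2S, fun η ξ =>
    ⟨𝔞.exists_isLiftedGenerator hγ ht η.2 ξ.2.1 ξ.2.2.1 ξ.2.2.2, fun Δξ hΔ => ?_⟩⟩
  have D : 𝔞.VariationData L k t₀ t₁ γ η ξ Δξ := ⟨h𝔞, hL, ht, hk, hγ, hEL, η.2, ξ.2.1, hΔ⟩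
  -- This identifies the form with the pairing formula for the given `Δξ`; the formula with `d d_T
  -- L` follows by integration by parts.
  have hpair := (hδ η ξ).trans D.integral_pairT_vertPart.symm
  exact ⟨fun t hs => ⟨D.existsUnique_dTKappa hs, D.var₂_fst hs, D.tangentMap_var₂ hs⟩,
    D.intervalIntegrable_dT_dT_var₂, hpair.trans D.integral_dT_dT_var₂.symm,
    fun t hs => ⟨D.jacobiForce_fst hs, D.isVert_jacobiDefect hs, D.Tπ_vertPart hs⟩,
    D.intervalIntegrable_pairT_vertPart, hpair⟩
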